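/- Let $M$ be a simply connected complex manifold with a holomorphic $\mathbb C^\times$-action (for instance a simply connected smooth projective variety with an algebraic action), and let $L\subset M$ be a path-connected subset with $\lambda L\subset L$ for all $\lambda\in S^1$ (for instance a connected $S^1$-invariant Lagrangian submanifold). Homology is singular with integer coefficients. Let $\mathbb D=\{|z|\le 1\}$ and $$E=M\times(\mathbb C^2\setminus 0)/\mathbb C^\times,\qquad \mathcal E=\{(x,z,t,(\alpha,\beta))\in M\times\mathbb D\times\mathbb C\times(\mathbb C^2\setminus 0): z\beta=t\alpha\}/\mathbb C^\times,$$ where $\lambda\in\mathbb C^\times$ acts by $(x,v)\mapsto(\lambda x,\lambda v)$ and $(x,z,t,v)\mapsto(\lambda x,z,t,\lambda v)$. Let $\mathcal E_t$ be the fibre over $t$, $\hat L_t=\{[x,z,t,(z,t)]:x\in L,\ |z|=1\}\subset\mathcal E_t$ and $\mathcal L=\bigcup_t\hat L_t$. For $t\ne0$, $M\times\mathbb D\cong\mathcal E_t$ by $(x,z)\mapsto[x,z,t,(z,t)]$. For $t=0$, $\mathcal E_0=E\cup_M(M\times\mathbb D)$ by $[x,v]\mapsto[x,0,0,v]$ and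 $(x,z)\mapsto[x,z,0,(1,0)]$; it lies over $\mathbb P^1\cup\mathbb D$, the fibre over $0$ of the blowup of $\mathbb D\times\mathbb C$ at the origin. Let $H_2^{\rm sec}(\mathcal E_t,\hat L_t)$ $(t\neq0)$ be the set of classes mapping to $[\mathbb D,S^1]\in H_2(\mathbb D,S^1)$, and $H_2^{\rm sec}(\mathcal E_0,\hat L_0)$ the set of classes mapping to $[\mathbb P^1]+[\mathbb D,S^1]\in H_2(\mathbb P^1\cup\mathbb D,S^1)$. For $\beta\in H_2(M,L)$ there is a unique $\hat\beta\in H_2(M\times\mathbb D,L\times S^1)$ projecting to $\beta$ and to $[\mathbb D,S^1]$; via $M\times\mathbb D\cong\mathcal E_t$ it is also viewed in $H_2(\mathcal E_t,\hat L_t)$ for $t\neq0$. For $\sigma\in H_2(E)$ let $\sigma+\hat\beta\in H_2(\mathcal E_0,\hat L_0)$ be the sum of the images of $\sigma$ and $\hat\beta$ under the two inclusions above. In $\sigma_0+\hat\alpha_0+\hat\beta$ and $\sigma-\hat u+\hat\beta$ the terms after $\sigma$ stand for $\widehat{\alpha_0+\beta}$ and $\widehat{\beta-[u]}$. Let $F_{\max}$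 be the set of $\mathbb C^\times$-fixed points at which the normal space of the fixed locus has only negative weights. Given $p\in F_{\max}$ and a path $\gamma:[0,1]\to M$ with $\gamma(1)\in L$ whose starting point lies in the same path component of $F_{\max}$ as $p$, let $\sigma_0\in H_2(E)$ be the class of the section $[v]\mapsto[p,v]$ and $\alpha_0\in H_2(M,L)$ the class of the disc $re^{i\theta}\mapsto e^{-i\theta}\gamma(r)$. For a disc $u:\mathbb D\to M$ with $u(1)\in L$ and $u(e^{i\theta})=e^{i\theta}u(1)$, let $\sigma(u)$ be the class of the section of $E$ given by $[w:1]\mapsto[u(1),(w,1)]$ and $[1:w]\mapsto[u(w),(1,w)]$ for $|w|\le1$. Then, for every $t\neq 0$, the inclusion induces an isomorphism $H_2(\mathcal E_0,\hat L_0)\cong H_2(\mathcal E,\mathcal L)$, and the resulting retraction map $$r:H_2(\mathcal E_t,\hat L_t)\to H_2(\mathcal E,\mathcal L)\cong H_2(\mathcal E_0,\hat L_0)$$ restricts to a bijection $H_2^{\rm sec}(\mathcal E_t,\hat L_t)\to H_2^{\rm sec}(\mathcal E_0,\hat L_0)$. For all $\beta\in H_2(M,L)$, all $u$ as above and all maximal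 classes $\sigma_0,\alpha_0$ as above, $$r(\hat\beta)=\sigma(u)-\hat u+\hat\beta=\sigma_0+\hat\alpha_0+\hat\beta .$$ Moreover, let $\partial$ denote the boundary in $H_1(L)$, taken through the projections $\hat L_t\to L$, $[x,z,t,(z,t)]\mapsto x$, for $t\ne0$ and $\hat L_0\to L$, $[y,z,0,(1,0)]\mapsto y$, for $t=0$. Then $\partial(r(a))=\partial a-\lambda$ for every section class $a\in H_2^{\rm sec}(\mathcal E_t,\hat L_t)$, where $\lambda\in H_1(L)$ is the class of the $S^1$-orbit $e^{i\theta}\mapsto e^{i\theta}x$ of any point $x\in L$; and $[\partial u]$ is the class of the $S^1$-orbit of $u(1)$, so that $\lambda=[\partial u]$. -/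

import Mathlib

open CategoryTheory Limits
open scoped Manifold ContDiff

namespace Degeneration
noncomputable section

set_option linter.unusedSectionVars false

/-! ### Singular homology of spaces and pairs, with integer coefficients -/

/-- The coefficient module `ℤ`. -/
abbrev Zc : ModuleCat.{0} ℤ := ModuleCat.of ℤ ℤ
/-- The singular chain complex `C_•(X)`. -/
abbrev Chains (X : Type) [TopologicalSpace X] : ChainComplex (ModuleCat.{0} ℤ) ℕ :=
  ((AlgebraicTopology.singularChainComplexFunctor (ModuleCat.{0} ℤ)).obj Zc).obj (TopCat.of X)
/-- The chain map induced by a continuous map. -/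
abbrev chainsMap {X Y : Type} [TopologicalSpace X] [TopologicalSpace Y] (f : C(X, Y)) :
    Chains X ⟶ Chains Y :=
  ((AlgebraicTopology.singularChainComplexFunctor (ModuleCat.{0} ℤ)).obj Zc).map (TopCat.ofHom f)

/-- The inclusion of a subspace. -/
def incl {X : Type} [TopologicalSpace X] (A : Set X) : C(A, X) := ⟨Subtype.val, continuous_subtype_val⟩

/-- The relative singular chain complex `C_•(X, A) = C_•(X) / C_•(A)`. -/
abbrev RelChains {X : Type} [TopologicalSpace X] (A : Set X) : ChainComplex (ModuleCat.{0} ℤ) ℕ :=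
  cokernel (chainsMap (incl A))

lemma mono_chainsMap_incl {X : Type} [TopologicalSpace X] (A : Set X) :
    Mono (chainsMap (incl A)) := by
  have : ∀ n, Mono ((chainsMap (incl A)).f n) := by
    intro n
    have hinj : Function.Injective ((TopCat.toSSet.map (TopCat.ofHom (incl A))).app (Opposite.op (SimplexCategory.mk n))) := by
      intro x y h
      have := congrArg (TopCat.toSSetObjEquiv _ _) h
      apply (TopCat.toSSetObjEquiv _ _).injective
      ext p
      exact congrFun (congrArg DFunLike.coe this) p
    have := MonoCoprod.mono_map'_of_injective
      (fun _ : ((TopCat.toSSet.obj (TopCat.of X)).obj (Opposite.op (SimplexCategory.mk n))) => Zc) _ hinj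
    exact this
  exact HomologicalComplex.mono_of_mono_f _ this

/-- `H_n(X)`. -/
abbrev SingH (n : ℕ) (X : Type) [TopologicalSpace X] : ModuleCat.{0} ℤ :=
  ((AlgebraicTopology.singularHomologyFunctor (ModuleCat.{0} ℤ) n).obj Zc).obj (TopCat.of X)

/-- `f_* : H_n(X) → H_n(Y)`. -/
def pushH (n : ℕ) {X Y : Type} [TopologicalSpace X] [TopologicalSpace Y] (f : C(X, Y)) :
    SingH n X →ₗ[ℤ] SingH n Y :=
  (((AlgebraicTopology.singularHomologyFunctor (ModuleCat.{0} ℤ) n).obj Zc).map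
    (TopCat.ofHom f)).hom

/-- `H_n(X, A)`. -/
abbrev RelH (n : ℕ) {X : Type} [TopologicalSpace X] (A : Set X) : ModuleCat.{0} ℤ :=
  (RelChains A).homology n

/-- The restriction `A → B` of a map of pairs `(X, A) → (Y, B)`. -/
def restr {X Y : Type} [TopologicalSpace X] [TopologicalSpace Y] (f : C(X, Y))
    {A : Set X} {B : Set Y} (h : Set.MapsTo f A B) : C(A, B) :=
  ⟨fun a => ⟨f a.1, h a.2⟩, by fun_prop⟩

/-- The map of relative chain complexes induced by a map of pairs. -/
def relChainsMap {X Y : Type} [TopologicalSpace X] [TopologicalSpace Y] (f : C(X, Y))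
    {A : Set X} {B : Set Y} (h : Set.MapsTo f A B) : RelChains A ⟶ RelChains B :=
  cokernel.map (chainsMap (incl A)) (chainsMap (incl B)) (chainsMap (restr f h)) (chainsMap f)
    (by rw [← Functor.map_comp, ← Functor.map_comp]; rfl)

/-- `f_* : H_n(X, A) → H_n(Y, B)`. -/
def pushRel (n : ℕ) {X Y : Type} [TopologicalSpace X] [TopologicalSpace Y] (f : C(X, Y))
    {A : Set X} {B : Set Y} (h : Set.MapsTo f A B) : RelH n A →ₗ[ℤ] RelH n B :=
  (HomologicalComplex.homologyMap (relChainsMap f h) n).hom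

/-- The natural map `H_n(X) → H_n(X, A)`. -/
def toRel (n : ℕ) {X : Type} [TopologicalSpace X] (A : Set X) : SingH n X →ₗ[ℤ] RelH n A :=
  (HomologicalComplex.homologyMap (cokernel.π (chainsMap (incl A))) n).hom

lemma pair_shortExact {X : Type} [TopologicalSpace X] (A : Set X) :
    (ShortComplex.mk (chainsMap (incl A)) (cokernel.π (chainsMap (incl A)))
      (cokernel.condition _)).ShortExact :=
  have := mono_chainsMap_incl A
  { exact := ShortComplex.exact_cokernel _
    mono_f := this
    epi_g := inferInstance }

/-- The connecting homomorphism `∂ : H_{n+1}(X, A) → H_n(A)` of the pair. -/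
def bdry (n : ℕ) {X : Type} [TopologicalSpace X] (A : Set X) :
    RelH (n + 1) A →ₗ[ℤ] SingH n A :=
  ((pair_shortExact A).δ (n + 1) n (by simp)).hom

/-- The homology class in degree 2 of a 2-cycle, given as the image of `1` under `φ : ℤ → K_2`. -/
def classOf (K : ChainComplex (ModuleCat.{0} ℤ) ℕ) (φ : Zc ⟶ K.X 2) (h : φ ≫ K.d 2 1 = 0) :
    K.homology 2 :=
  (K.liftCycles φ 1 (by simp) h ≫ K.homologyπ 2).hom (1 : ℤ)

/-- A continuous map `Δⁿ → X` as a singular simplex. -/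
abbrev simplexOf {X : Type} [TopologicalSpace X] {n : ℕ} (s : C(stdSimplex ℝ (Fin (n + 1)), X)) :
    (TopCat.toSSet.obj (TopCat.of X)).obj (Opposite.op (SimplexCategory.mk n)) :=
  (TopCat.toSSetObjEquiv (TopCat.of X) (Opposite.op (SimplexCategory.mk n))).symm s

/-- The singular chain of a continuous map `Δⁿ → X` (a chain `c` is encoded as `ℤ → C_n`, `1 ↦ c`). -/
abbrev chainOf {X : Type} [TopologicalSpace X] {n : ℕ} (s : C(stdSimplex ℝ (Fin (n + 1)), X)) :
    Zc ⟶ (Chains X).X n :=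
  SSet.ιChainComplex (TopCat.toSSet.obj (TopCat.of X)) (R := Zc) (simplexOf s)

/-- The `i`-th face inclusion `Δⁿ → Δⁿ⁺¹`. -/
def face {n : ℕ} (i : Fin (n + 2)) :
    C(stdSimplex ℝ (Fin (n + 1)), stdSimplex ℝ (Fin (n + 2))) :=
  ⟨stdSimplex.map (SimplexCategory.δ i), by continuity⟩

lemma chainOf_d {X : Type} [TopologicalSpace X] {n : ℕ}
    (s : C(stdSimplex ℝ (Fin (n + 2)), X)) :
    chainOf s ≫ (Chains X).d (n + 1) n =
      ∑ i : Fin (n + 2), (-1 : ℤ) ^ i.val • chainOf (s.comp (face i)) := by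
  exact SSet.ιChainComplex_d (TopCat.toSSet.obj (TopCat.of X)) (R := Zc) (simplexOf s)

lemma face_apply_zero {n : ℕ} (i : Fin (n + 2)) (p : stdSimplex ℝ (Fin (n + 1))) :
    (face i p) i = 0 := by
  change FunOnFinite.linearMap ℝ ℝ _ _ i = 0
  rw [FunOnFinite.linearMap_apply_apply]
  refine Finset.sum_eq_zero fun j hj => ?_
  exact absurd (Finset.mem_filter.mp hj).2 (Fin.succAbove_ne i j)

/-- The relative chain of a continuous map `Δⁿ → X`. -/
def relChainOf {X : Type} [TopologicalSpace X] (A : Set X) {n : ℕ} (s : C(stdSimplex ℝ (Fin (n + 1)), X)) :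
    Zc ⟶ (RelChains A).X n :=
  chainOf s ≫ (cokernel.π (chainsMap (incl A))).f n

lemma relChainOf_eq_zero {X : Type} [TopologicalSpace X] (A : Set X) {n : ℕ}
    (s : C(stdSimplex ℝ (Fin (n + 1)), X)) (h : ∀ p, s p ∈ A) : relChainOf A s = 0 := by
  have : chainOf s = chainOf (⟨fun p => ⟨s p, h p⟩, by fun_prop⟩ : C(stdSimplex ℝ (Fin (n + 1)), A)) ≫
      (chainsMap (incl A)).f n := by
    exact (SSet.ι_chainComplexMap_f _ _ (TopCat.toSSet.map (TopCat.ofHom (incl A))) Zc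
      (simplexOf (⟨fun p => ⟨s p, h p⟩, by fun_prop⟩ : C(stdSimplex ℝ (Fin (n + 1)), A)))).symm
  rw [relChainOf, this, Category.assoc, ← HomologicalComplex.comp_f, cokernel.condition]
  simp

lemma relChainOf_d {X : Type} [TopologicalSpace X] (A : Set X) (s : C(stdSimplex ℝ (Fin 3), X))
    (h : ∀ p, (∃ i, p i = 0) → s p ∈ A) : relChainOf A s ≫ (RelChains A).d 2 1 = 0 := by
  rw [relChainOf, Category.assoc]
  erw [HomologicalComplex.Hom.comm]
  rw [← Category.assoc]
  erw [chainOf_d]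
  rw [Preadditive.sum_comp]
  refine Finset.sum_eq_zero fun i _ => ?_
  rw [Preadditive.zsmul_comp]
  exact (congrArg _ (relChainOf_eq_zero A (s.comp (face i))
    (fun p => h _ ⟨i, face_apply_zero i p⟩))).trans (smul_zero _)

lemma chainOf_sub_d {X : Type} [TopologicalSpace X] (s s' : C(stdSimplex ℝ (Fin 3), X))
    (h : ∀ p, (∃ i, p i = 0) → s p = s' p) :
    (chainOf s - chainOf s') ≫ (Chains X).d 2 1 = 0 := by
  rw [Preadditive.sub_comp, chainOf_d, chainOf_d, sub_eq_zero]
  refine Finset.sum_congr rfl fun i _ => ?_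
  congr 2
  ext p
  exact h _ ⟨i, face_apply_zero i p⟩

/-! ### The disc, the projective line and their fundamental classes -/

/-- The closed unit disc `𝔻 ⊂ ℂ`. -/
abbrev Disc : Type := Metric.closedBall (0 : ℂ) 1

/-- The unit circle `S¹ = ∂𝔻`, as a subset of the disc. -/
def circ : Set Disc := {z | ‖(z : ℂ)‖ = 1}

lemma Disc.norm_le (z : Disc) : ‖(z : ℂ)‖ ≤ 1 := mem_closedBall_zero_iff.mp z.2

/-- The radial retraction of `ℂ` onto the unit disc (the identity on the disc). -/
def clamp : C(ℂ, Disc) where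
  toFun z := ⟨z / ((max 1 ‖z‖ : ℝ) : ℂ), by
    have h : (0 : ℝ) < max 1 ‖z‖ := lt_max_of_lt_left one_pos
    rw [mem_closedBall_zero_iff, norm_div, Complex.norm_real, Real.norm_of_nonneg h.le,
      div_le_one h]
    exact le_max_right _ _⟩
  continuous_toFun := by
    refine Continuous.subtype_mk (Continuous.div continuous_id (by fun_prop) fun z => ?_) _
    have h : (0 : ℝ) < max 1 ‖z‖ := lt_max_of_lt_left one_pos
    exact_mod_cast h.ne'

/-- The affine map of the standard 2-simplex onto the positively oriented triangle with vertices
`-4 - 2i`, `4 - 2i`, `4i`; the unit disc lies in its interior. -/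
def triangle : C(stdSimplex ℝ (Fin 3), ℂ) where
  toFun p := ⟨4 * (p 1 - p 0), 4 * p 2 - 2 * p 0 - 2 * p 1⟩
  continuous_toFun := by
    have hc : ∀ i, Continuous fun p : stdSimplex ℝ (Fin 3) => p i := fun i =>
      (continuous_apply i).comp continuous_subtype_val
    have h : (fun p : stdSimplex ℝ (Fin 3) =>
        (⟨4 * (p 1 - p 0), 4 * p 2 - 2 * p 0 - 2 * p 1⟩ : ℂ)) = fun p =>
        ((4 * (p 1 - p 0) : ℝ) : ℂ) + ((4 * p 2 - 2 * p 0 - 2 * p 1 : ℝ) : ℂ) * Complex.I := by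
      funext p
      apply Complex.ext <;> simp
    rw [h]
    exact (Complex.continuous_ofReal.comp (continuous_const.mul ((hc 1).sub (hc 0)))).add
      ((Complex.continuous_ofReal.comp (((continuous_const.mul (hc 2)).sub
        (continuous_const.mul (hc 0))).sub (continuous_const.mul (hc 1)))).mul continuous_const)

/-- A singular 2-simplex in the disc whose boundary runs once around the circle in the positive
direction: the triangle retracted radially onto the disc. -/
def discSimplex : C(stdSimplex ℝ (Fin 3), Disc) := clamp.comp triangle

lemma one_le_norm_triangle (p : stdSimplex ℝ (Fin 3)) (h : ∃ i, p i = 0) : 1 ≤ ‖triangle p‖ := by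
  have hs : p 0 + p 1 + p 2 = 1 := by
    have := stdSimplex.sum_eq_one p
    rwa [Fin.sum_univ_three] at this
  have hsq : (1 : ℝ) ≤ Complex.normSq (triangle p) := by
    change 1 ≤ (4 * (p 1 - p 0)) * (4 * (p 1 - p 0)) +
      (4 * p 2 - 2 * p 0 - 2 * p 1) * (4 * p 2 - 2 * p 0 - 2 * p 1)
    obtain ⟨i, hi⟩ := h
    fin_cases i <;> simp only [Fin.zero_eta, Fin.mk_one, Fin.reduceFinMk] at hi
    · have e : p 2 = 1 - p 1 := by linarith
      rw [hi, e]
      nlinarith [sq_nonneg (p 1 * 52 - 24)]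
    · have e : p 2 = 1 - p 0 := by linarith
      rw [hi, e]
      nlinarith [sq_nonneg (p 0 * 52 - 24)]
    · have e : p 1 = 1 - p 0 := by linarith
      rw [hi, e]
      nlinarith [sq_nonneg (1 - 2 * p 0)]
  rw [Complex.normSq_eq_norm_sq] at hsq
  nlinarith [norm_nonneg (triangle p)]

lemma clamp_mem_circ {z : ℂ} (h : 1 ≤ ‖z‖) : clamp z ∈ circ := by
  change ‖z / ((max 1 ‖z‖ : ℝ) : ℂ)‖ = 1
  rw [max_eq_right h, norm_div, Complex.norm_real, norm_norm]
  exact div_self (by linarith)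

/-- The fundamental class `[𝔻, S¹] ∈ H₂(𝔻, S¹)`. -/
def discClass : RelH 2 circ :=
  classOf _ (relChainOf circ discSimplex)
    (relChainOf_d _ _ fun p hp => clamp_mem_circ (one_le_norm_triangle p hp))

/-- The fundamental class `[S¹] = ∂[𝔻, S¹] ∈ H₁(S¹)`. -/
def circleClass : SingH 1 circ := bdry 1 circ discClass

/-- `ℂ² ∖ {0}`, with the scalar action of `ℂˣ` provided by Mathlib. -/
abbrev V2 : Type := {v : ℂ × ℂ // v ≠ 0}

instance : ContinuousSMul ℂˣ V2 :=
  ⟨Continuous.subtype_mk (by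
    have : Continuous fun p : ℂˣ × V2 => ((p.1 : ℂ) • (p.2 : ℂ × ℂ)) := by fun_prop
    exact this) _⟩

/-- `ℙ¹ = (ℂ² ∖ {0}) / ℂˣ`. -/
abbrev P1 : Type := Quotient (MulAction.orbitRel ℂˣ V2)

/-- The class `[α : β]`. -/
def toP1 : C(V2, P1) := ⟨Quotient.mk _, continuous_quotient_mk'⟩

/-- The map `𝔻 → ℙ¹`, `z ↦ [z : 1 - |z|]`, collapsing the circle to the point `[1 : 0]`. It is an
orientation preserving homeomorphism of the open disc onto `ℙ¹ ∖ {[1 : 0]}`. -/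
def collapse : C(Disc, P1) :=
  toP1.comp ⟨fun z => ⟨((z : ℂ), 1 - ((‖(z : ℂ)‖ : ℝ) : ℂ)), fun h => by
    have h1 : (z : ℂ) = 0 := congrArg Prod.fst h
    have h2 : 1 - ((‖(z : ℂ)‖ : ℝ) : ℂ) = 0 := congrArg Prod.snd h
    rw [h1] at h2
    simp at h2⟩, by fun_prop⟩

/-- The point `[1 : 0]`. -/
def infPt : P1 := toP1 ⟨(1, 0), fun h => one_ne_zero (congrArg Prod.fst h)⟩

lemma collapse_circ {z : Disc} (h : z ∈ circ) : collapse z = infPt := by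
  have h1 : ‖(z : ℂ)‖ = 1 := h
  have h0 : (z : ℂ) ≠ 0 := fun h => by rw [h] at h1; simp at h1
  refine Quotient.sound ⟨Units.mk0 (z : ℂ) h0, ?_⟩
  apply Subtype.ext
  change ((z : ℂ) • ((1 : ℂ), (0 : ℂ))) = ((z : ℂ), 1 - ((‖(z : ℂ)‖ : ℝ) : ℂ))
  simp [h1]

/-- The fundamental class `[ℙ¹] ∈ H₂(ℙ¹)` for the complex orientation: the collapsed disc minus a
constant simplex. -/
def sphereClass : SingH 2 P1 :=
  classOf _ (chainOf (collapse.comp discSimplex) - chainOf (ContinuousMap.const _ infPt))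
    (chainOf_sub_d _ _ fun p hp =>
      collapse_circ (clamp_mem_circ (one_le_norm_triangle p hp)))

/-! ### The associated bundle and the degenerating family -/

/-- `e^{iθ}` as a point of the disc. -/
def ofCircle (c : Circle) : Disc :=
  ⟨c, mem_closedBall_zero_iff.mpr (Circle.norm_coe c).le⟩

/-- A point of the boundary circle, as an element of `ℂˣ`. -/
def circUnit : C(circ, ℂˣ) where
  toFun z := Units.mk0 ((z : Disc) : ℂ) fun h => by
    have h1 : ‖((z : Disc) : ℂ)‖ = 1 := z.2
    rw [h] at h1
    simp at h1
  continuous_toFun := by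
    rw [Units.isEmbedding_val₀.continuous_iff]
    exact continuous_subtype_val.comp continuous_subtype_val

section Space

variable (M : Type) [TopologicalSpace M] [MulAction ℂˣ M]

/-- The associated bundle `E = M × (ℂ² ∖ {0}) / ℂˣ` (diagonal action). -/
abbrev AssocBundle : Type := Quotient (MulAction.orbitRel ℂˣ (M × V2))

/-- The points `(x, z, t, (α, β)) ∈ M × 𝔻 × ℂ × (ℂ² ∖ {0})` with `z β = t α`. -/
def PreTotal : Type :=
  {p : M × Disc × ℂ × V2 //
    (p.2.1 : ℂ) * (p.2.2.2 : ℂ × ℂ).2 = p.2.2.1 * (p.2.2.2 : ℂ × ℂ).1}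

instance : TopologicalSpace (PreTotal M) := instTopologicalSpaceSubtype

/-- The action `λ · (x, z, t, (α, β)) = (λ x, z, t, (λ α, λ β))`. -/
instance : MulAction ℂˣ (PreTotal M) where
  smul c p := ⟨(c • p.1.1, p.1.2.1, p.1.2.2.1, c • p.1.2.2.2), by
    have h := p.2
    change (p.1.2.1 : ℂ) * ((c : ℂ) * (p.1.2.2.2 : ℂ × ℂ).2) =
      p.1.2.2.1 * ((c : ℂ) * (p.1.2.2.2 : ℂ × ℂ).1)
    linear_combination (c : ℂ) * h⟩
  one_smul p := Subtype.ext (by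
    change ((1 : ℂˣ) • p.1.1, p.1.2.1, p.1.2.2.1, (1 : ℂˣ) • p.1.2.2.2) = p.1
    rw [one_smul, one_smul])
  mul_smul c d p := Subtype.ext (by
    change ((c * d) • p.1.1, p.1.2.1, p.1.2.2.1, (c * d) • p.1.2.2.2) =
      (c • d • p.1.1, p.1.2.1, p.1.2.2.1, c • d • p.1.2.2.2)
    rw [mul_smul, mul_smul])

/-- The total space `𝓔` of the degenerating family. -/
abbrev Total : Type := Quotient (MulAction.orbitRel ℂˣ (PreTotal M))

/-- The blowup `Bl_{(0,0)}(𝔻 × ℂ) = {(z, t, [α : β]) : z β = t α} ⊂ 𝔻 × ℂ × ℙ¹`. -/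
abbrev Blowup : Type :=
  {q : Disc × ℂ × P1 // ∃ v : V2, toP1 v = q.2.2 ∧
    (q.1 : ℂ) * (v : ℂ × ℂ).2 = q.2.1 * (v : ℂ × ℂ).1}

variable {M}

/-- The class `[x, v] ∈ E`. -/
def mkAssoc : C(M × V2, AssocBundle M) := ⟨Quotient.mk _, continuous_quotient_mk'⟩

/-- The class `[x, z, t, (α, β)] ∈ 𝓔`. -/
def mkTotal : C(PreTotal M, Total M) := ⟨Quotient.mk _, continuous_quotient_mk'⟩

/-- The projection `𝓔 → Bl_{(0,0)}(𝔻 × ℂ)`, `[x, z, t, (α, β)] ↦ (z, t, [α : β])`. -/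
def toBlowup : C(Total M, Blowup) where
  toFun := Quotient.lift
    (fun p : PreTotal M => (⟨(p.1.2.1, p.1.2.2.1, toP1 p.1.2.2.2), p.1.2.2.2, rfl, p.2⟩ : Blowup))
    (by
      rintro p q ⟨c, rfl⟩
      apply Subtype.ext
      refine Prod.ext rfl (Prod.ext rfl ?_)
      exact Quotient.sound ⟨c, rfl⟩)
  continuous_toFun := by
    refine Continuous.quotient_lift ?_ _
    refine Continuous.subtype_mk ?_ _
    have h : Continuous fun p : PreTotal M => p.1 := continuous_subtype_val
    exact (h.snd.fst).prodMk ((h.snd.snd.fst).prodMk (toP1.continuous.comp h.snd.snd.snd))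

/-- The fibre `𝓔_t` over `t ∈ ℂ`. -/
abbrev Fibre (M : Type) [TopologicalSpace M] [MulAction ℂˣ M] (t : ℂ) : Type := {e : Total M // (toBlowup e).1.2.1 = t}

/-- The inclusion `𝓔_t → 𝓔`. -/
def fibreIncl (t : ℂ) : C(Fibre M t, Total M) := ⟨Subtype.val, continuous_subtype_val⟩

/-- The projection `𝓔_t → 𝔻`, `[x, z, t, (α, β)] ↦ z`. -/
def fibreToDisc (t : ℂ) : C(Fibre M t, Disc) :=
  ⟨fun e => (toBlowup e.1).1.1, by fun_prop⟩

/-- The central fibre `𝔻 ∪ ℙ¹` of the blowup over `t = 0`. -/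
abbrev BlowupZero : Type := {b : Blowup // b.1.2.1 = 0}

/-- The boundary circle `{|z| = 1}` of `𝔻 ∪ ℙ¹`. -/
def blowupCirc : Set BlowupZero := {b | b.1.1.1 ∈ circ}

/-- The projection `𝓔_0 → 𝔻 ∪ ℙ¹`. -/
def fibreToBlowup : C(Fibre M 0, BlowupZero) :=
  ⟨fun e => ⟨toBlowup e.1, e.2⟩, by fun_prop⟩

/-- The inclusion of the exceptional curve `ℙ¹ → 𝔻 ∪ ℙ¹`, `ℓ ↦ (0, 0, ℓ)`. -/
def sphereToBlowup : C(P1, BlowupZero) where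
  toFun l := ⟨⟨(⟨0, by simp⟩, 0, l), by
    obtain ⟨v, rfl⟩ := Quotient.exists_rep l
    exact ⟨v, rfl, by simp⟩⟩, rfl⟩
  continuous_toFun := by fun_prop

/-- The inclusion of the strict transform of the disc `𝔻 → 𝔻 ∪ ℙ¹`, `z ↦ (z, 0, [1 : 0])`. -/
def discToBlowup : C(Disc, BlowupZero) where
  toFun z := ⟨⟨(z, 0, infPt), _, rfl, by simp⟩, rfl⟩
  continuous_toFun := by fun_prop

lemma mapsTo_discToBlowup : Set.MapsTo discToBlowup circ blowupCirc := fun _ h => h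

/-- The trivialization `M × 𝔻 → 𝓔_t`, `(x, z) ↦ [x, z, t, (z, t)]`, for `t ≠ 0`. -/
def trivialization (t : ℂ) (ht : t ≠ 0) : C(M × Disc, Fibre M t) where
  toFun p := ⟨mkTotal ⟨(p.1, p.2, t, ⟨((p.2 : ℂ), t), fun h => ht (congrArg Prod.snd h)⟩),
    mul_comm _ _⟩, rfl⟩
  continuous_toFun := by
    refine Continuous.subtype_mk (mkTotal.continuous.comp (Continuous.subtype_mk ?_ _)) _
    fun_prop

/-- The inclusion `M × 𝔻 → 𝓔_0 = E ∪_M (M × 𝔻)`, `(x, z) ↦ [x, z, 0, (1, 0)]`. -/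
def discPart : C(M × Disc, Fibre M 0) where
  toFun p := ⟨mkTotal ⟨(p.1, p.2, 0, ⟨(1, 0), fun h => one_ne_zero (congrArg Prod.fst h)⟩),
    by simp⟩, rfl⟩
  continuous_toFun := by
    refine Continuous.subtype_mk (mkTotal.continuous.comp (Continuous.subtype_mk ?_ _)) _
    fun_prop

/-- The inclusion `E → 𝓔_0 = E ∪_M (M × 𝔻)`, `[x, (α, β)] ↦ [x, 0, 0, (α, β)]`. -/
def bundlePart : C(AssocBundle M, Fibre M 0) where
  toFun := Quotient.lift
    (fun p : M × V2 => (⟨mkTotal ⟨(p.1, ⟨0, by simp⟩, 0, p.2), by simp⟩, rfl⟩ : Fibre M 0))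
    (by
      rintro p q ⟨c, rfl⟩
      exact Subtype.ext (Quotient.sound ⟨c, rfl⟩))
  continuous_toFun := by
    refine Continuous.quotient_lift ?_ _
    refine Continuous.subtype_mk (mkTotal.continuous.comp (Continuous.subtype_mk ?_ _)) _
    fun_prop

/-! ### The Lagrangian boundary condition -/

/-- The representative `(x, z, t, (z, t))`, `|z| = 1`, of a boundary point. -/
def preBdryPoint (x : M) (z : circ) (t : ℂ) : PreTotal M :=
  ⟨(x, z, t, ⟨((z : Disc), t), fun h =>
    (circUnit z).ne_zero (congrArg Prod.fst h)⟩), mul_comm _ _⟩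

/-- The boundary point `[x, z, t, (z, t)]`, `|z| = 1`, of `𝓔`. -/
def bdryPoint (x : M) (z : circ) (t : ℂ) : Total M := mkTotal (preBdryPoint x z t)

/-- `𝓛 = ⋃_t L̂_t ⊂ 𝓔`, where `L̂_t` is the image of `L × S¹` under `(x, z) ↦ [x, z, t, (z, t)]`. -/
def totalBdry (L : Set M) : Set (Total M) :=
  {e | ∃ x ∈ L, ∃ z : circ, ∃ t : ℂ, e = bdryPoint x z t}

/-- `L̂_t ⊂ 𝓔_t`. -/
def fibreBdry (L : Set M) (t : ℂ) : Set (Fibre M t) :=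
  {e | ∃ x ∈ L, ∃ z : circ, e.1 = bdryPoint x z t}

/-- `λ L ⊂ L` for `λ ∈ S¹`. -/
def CircleInvariant {M : Type} [MulAction ℂˣ M] (L : Set M) : Prop :=
  ∀ c : Circle, ∀ x ∈ L, Circle.toUnits c • x ∈ L

lemma CircleInvariant.circUnit_smul {L : Set M} (hL : CircleInvariant L) (z : circ) {x : M}
    (hx : x ∈ L) : circUnit z • x ∈ L := by
  have h := hL ⟨((z : Disc) : ℂ), mem_sphere_zero_iff_norm.mpr z.2⟩ x hx
  have e : Circle.toUnits ⟨((z : Disc) : ℂ), mem_sphere_zero_iff_norm.mpr z.2⟩ = circUnit z :=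
    Units.ext rfl
  rwa [e] at h

lemma CircleInvariant.inv_smul {L : Set M} (hL : CircleInvariant L) (c : Circle) {x : M}
    (hx : x ∈ L) : (Circle.toUnits c)⁻¹ • x ∈ L := by
  have h := hL c⁻¹ x hx
  rwa [map_inv] at h

lemma CircleInvariant.circUnit_inv_smul {L : Set M} (hL : CircleInvariant L) (z : circ) {x : M}
    (hx : x ∈ L) : (circUnit z)⁻¹ • x ∈ L := by
  have h := hL.inv_smul ⟨((z : Disc) : ℂ), mem_sphere_zero_iff_norm.mpr z.2⟩ hx
  have e : Circle.toUnits ⟨((z : Disc) : ℂ), mem_sphere_zero_iff_norm.mpr z.2⟩ = circUnit z :=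
    Units.ext rfl
  rwa [e] at h

lemma mapsTo_fibreIncl (L : Set M) (t : ℂ) :
    Set.MapsTo (fibreIncl t) (fibreBdry L t) (totalBdry L) := by
  rintro e ⟨x, hx, z, h⟩
  exact ⟨x, hx, z, t, h⟩

lemma mapsTo_fibreToDisc (L : Set M) (t : ℂ) :
    Set.MapsTo (fibreToDisc t) (fibreBdry L t) circ := by
  rintro e ⟨x, hx, z, h⟩
  change (toBlowup e.1).1.1 ∈ circ
  rw [h]
  exact z.2

lemma mapsTo_fibreToBlowup (L : Set M) :
    Set.MapsTo fibreToBlowup (fibreBdry L 0) blowupCirc := by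
  rintro e ⟨x, hx, z, h⟩
  change (toBlowup e.1).1.1 ∈ circ
  rw [h]
  exact z.2

lemma mapsTo_trivialization (L : Set M) (t : ℂ) (ht : t ≠ 0) :
    Set.MapsTo (trivialization t ht) (L ×ˢ circ) (fibreBdry L t) := by
  rintro ⟨x, z⟩ ⟨hx, hz⟩
  exact ⟨x, hx, ⟨z, hz⟩, rfl⟩

lemma mapsTo_discPart {L : Set M} (hL : CircleInvariant L) :
    Set.MapsTo discPart (L ×ˢ circ) (fibreBdry L 0) := by
  rintro ⟨x, z⟩ ⟨hx, hz⟩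
  refine ⟨circUnit ⟨z, hz⟩ • x, hL.circUnit_smul ⟨z, hz⟩ hx, ⟨z, hz⟩, ?_⟩
  refine (Quotient.sound (MulAction.orbitRel_apply.mpr ⟨circUnit ⟨z, hz⟩, ?_⟩)).symm
  apply Subtype.ext
  refine Prod.ext rfl (Prod.ext rfl (Prod.ext rfl (Subtype.ext ?_)))
  change ((z : ℂ) • ((1 : ℂ), (0 : ℂ))) = ((z : ℂ), (0 : ℂ))
  simp

/-- The scaling factor `z / α` (with junk value `1` if it vanishes). -/
def scaleOne (p : PreTotal M) : ℂˣ :=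
  if h : (p.1.2.1 : ℂ) / (p.1.2.2.2 : ℂ × ℂ).1 = 0 then 1 else Units.mk0 _ h

/-- The scaling factor `1 / α` (with junk value `1` if `α = 0`). -/
def scaleZero (p : PreTotal M) : ℂˣ :=
  if h : (1 : ℂ) / (p.1.2.2.2 : ℂ × ℂ).1 = 0 then 1 else Units.mk0 _ h

lemma alpha_ne_zero (p : PreTotal M) (hz : (p.1.2.1 : ℂ) ≠ 0) :
    (p.1.2.2.2 : ℂ × ℂ).1 ≠ 0 := by
  intro h
  have h1 := p.2
  rw [h, mul_zero] at h1
  exact p.1.2.2.2.2 (Prod.ext h ((mul_eq_zero.mp h1).resolve_left hz))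

lemma scaleOne_val (p : PreTotal M) (hz : (p.1.2.1 : ℂ) ≠ 0) :
    (scaleOne p : ℂ) = (p.1.2.1 : ℂ) / (p.1.2.2.2 : ℂ × ℂ).1 := by
  rw [scaleOne, dif_neg (div_ne_zero hz (alpha_ne_zero p hz))]
  rfl

lemma scaleZero_val (p : PreTotal M) (hz : (p.1.2.1 : ℂ) ≠ 0) :
    (scaleZero p : ℂ) = 1 / (p.1.2.2.2 : ℂ × ℂ).1 := by
  rw [scaleZero, dif_neg (div_ne_zero one_ne_zero (alpha_ne_zero p hz))]
  rfl

lemma scaleOne_smul (c : ℂˣ) (p : PreTotal M) (hz : (p.1.2.1 : ℂ) ≠ 0) :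
    scaleOne (c • p) * c = scaleOne p := by
  apply Units.ext
  rw [Units.val_mul, scaleOne_val (c • p) hz, scaleOne_val p hz]
  change (p.1.2.1 : ℂ) / ((c : ℂ) * (p.1.2.2.2 : ℂ × ℂ).1) * (c : ℂ) = _
  have := alpha_ne_zero p hz
  have := c.ne_zero
  field_simp

lemma scaleZero_smul (c : ℂˣ) (p : PreTotal M) (hz : (p.1.2.1 : ℂ) ≠ 0) :
    scaleZero (c • p) * c = scaleZero p := by
  apply Units.ext
  rw [Units.val_mul, scaleZero_val (c • p) hz, scaleZero_val p hz]
  change 1 / ((c : ℂ) * (p.1.2.2.2 : ℂ × ℂ).1) * (c : ℂ) = _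
  have := alpha_ne_zero p hz
  have := c.ne_zero
  field_simp

lemma continuousOn_scaleOne :
    ContinuousOn (scaleOne (M := M)) {p | (p.1.2.1 : ℂ) ≠ 0} := by
  have hv : Continuous fun p : PreTotal M => p.1 := continuous_subtype_val
  rw [Units.isEmbedding_val₀.continuousOn_iff]
  refine ContinuousOn.congr (f := fun p : PreTotal M =>
    (p.1.2.1 : ℂ) / (p.1.2.2.2 : ℂ × ℂ).1) ?_ (fun p hp => scaleOne_val p hp)
  refine ContinuousOn.div (Continuous.continuousOn (by fun_prop))
    (Continuous.continuousOn (by fun_prop)) fun p hp => alpha_ne_zero p hp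

lemma continuousOn_scaleZero :
    ContinuousOn (scaleZero (M := M)) {p | (p.1.2.1 : ℂ) ≠ 0} := by
  have hv : Continuous fun p : PreTotal M => p.1 := continuous_subtype_val
  rw [Units.isEmbedding_val₀.continuousOn_iff]
  refine ContinuousOn.congr (f := fun p : PreTotal M =>
    1 / (p.1.2.2.2 : ℂ × ℂ).1) ?_ (fun p hp => scaleZero_val p hp)
  refine ContinuousOn.div continuousOn_const
    (Continuous.continuousOn (by fun_prop)) fun p hp => alpha_ne_zero p hp

/-- For a scaling factor `s`, the `M`-coordinate `[x, z, t, (α, β)] ↦ s • x`; it does not depend on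
the representative where `z ≠ 0`. -/
def coord (s : PreTotal M → ℂˣ) (e : Total M) : M :=
  s e.out • e.out.1.1

lemma coord_mk {s : PreTotal M → ℂˣ}
    (hs : ∀ (c : ℂˣ) (p : PreTotal M), (p.1.2.1 : ℂ) ≠ 0 → s (c • p) * c = s p)
    (p : PreTotal M) (hz : (p.1.2.1 : ℂ) ≠ 0) : coord s (mkTotal p) = s p • p.1.1 := by
  obtain ⟨c, hc⟩ : ∃ c : ℂˣ, c • p = (mkTotal p).out :=
    MulAction.orbitRel_apply.mp (Quotient.mk_out (s := MulAction.orbitRel ℂˣ (PreTotal M)) p)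
  rw [coord, ← hc, ← hs c p hz, mul_smul]
  rfl

lemma continuousOn_coord [ContinuousSMul ℂˣ M] {s : PreTotal M → ℂˣ}
    (hs : ∀ (c : ℂˣ) (p : PreTotal M), (p.1.2.1 : ℂ) ≠ 0 → s (c • p) * c = s p)
    (hc : ContinuousOn s {p | (p.1.2.1 : ℂ) ≠ 0}) :
    ContinuousOn (coord s) {e : Total M | ((toBlowup e).1.1 : ℂ) ≠ 0} := by
  have ho : IsOpen {e : Total M | ((toBlowup e).1.1 : ℂ) ≠ 0} :=
    isOpen_ne_fun (by fun_prop) continuous_const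
  have hq : Topology.IsQuotientMap (mkTotal : PreTotal M → Total M) := isQuotientMap_quotient_mk'
  rw [hq.continuousOn_isOpen_iff ho]
  refine ContinuousOn.congr (f := fun p : PreTotal M => s p • p.1.1) ?_
    (fun p hp => coord_mk hs p hp)
  have hv : Continuous fun p : PreTotal M => p.1 := continuous_subtype_val
  exact ContinuousOn.smul hc (Continuous.continuousOn hv.fst)

lemma circ_ne_zero (z : circ) : ((z : Disc) : ℂ) ≠ 0 := (circUnit z).ne_zero

/-- The projection `L̂_t ≅ L × S¹ → L` for the trivialization of the boundary induced by
`𝓔_t ≅ M × 𝔻` (`t ≠ 0`), that is `[x, z, t, (z, t)] ↦ x`. -/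
def bdryProj [ContinuousSMul ℂˣ M] (L : Set M) (t : ℂ) : C(fibreBdry L t, L) where
  toFun e := ⟨coord scaleOne e.1.1, by
    obtain ⟨e, x, hx, z, h⟩ := e
    have h1 : coord scaleOne e.1 = scaleOne (preBdryPoint x z t) • x := by
      rw [h]
      exact coord_mk scaleOne_smul (preBdryPoint x z t) (circ_ne_zero z)
    have h2 : scaleOne (preBdryPoint x z t) = 1 :=
      Units.ext ((scaleOne_val (preBdryPoint x z t) (circ_ne_zero z)).trans
        (div_self (circ_ne_zero z)))
    change coord scaleOne e.1 ∈ L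
    rwa [h1, h2, one_smul]⟩
  continuous_toFun := by
    refine Continuous.subtype_mk ?_ _
    refine (continuousOn_coord scaleOne_smul continuousOn_scaleOne).comp_continuous
      (by fun_prop) fun e => ?_
    obtain ⟨e, x, hx, z, h⟩ := e
    change ((toBlowup e.1).1.1 : ℂ) ≠ 0
    rw [h]
    exact circ_ne_zero z

/-- The projection `L̂_0 ≅ L × S¹ → L` for the trivialization of the boundary induced by
`M × 𝔻 ⊂ E ∪_M (M × 𝔻) = 𝓔_0`, that is `[y, z, 0, (1, 0)] ↦ y`. -/
def bdryProjZero [ContinuousSMul ℂˣ M] {L : Set M} (hL : CircleInvariant L) :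
    C(fibreBdry L 0, L) where
  toFun e := ⟨coord scaleZero e.1.1, by
    obtain ⟨e, x, hx, z, h⟩ := e
    have h1 : coord scaleZero e.1 = scaleZero (preBdryPoint x z 0) • x := by
      rw [h]
      exact coord_mk scaleZero_smul (preBdryPoint x z 0) (circ_ne_zero z)
    have h2 : scaleZero (preBdryPoint x z 0) = (circUnit z)⁻¹ := by
      apply Units.ext
      rw [scaleZero_val (preBdryPoint x z 0) (circ_ne_zero z), Units.val_inv_eq_inv_val, one_div]
      rfl
    change coord scaleZero e.1 ∈ L
    rw [h1, h2]
    exact hL.circUnit_inv_smul z hx⟩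
  continuous_toFun := by
    refine Continuous.subtype_mk ?_ _
    refine (continuousOn_coord scaleZero_smul continuousOn_scaleZero).comp_continuous
      (by fun_prop) fun e => ?_
    obtain ⟨e, x, hx, z, h⟩ := e
    change ((toBlowup e.1).1.1 : ℂ) ≠ 0
    rw [h]
    exact circ_ne_zero z

/-! ### Discs bounding orbits, and the maximal classes -/

/-- The orbit map `S¹ → L`, `z ↦ z x`, of a point `x ∈ L`. -/
def orbitMap [ContinuousSMul ℂˣ M] {L : Set M} (hL : CircleInvariant L) (x : L) : C(circ, L) :=
  ⟨fun z => ⟨circUnit z • x.1, hL.circUnit_smul z x.2⟩, by fun_prop⟩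

/-- `u : 𝔻 → M` is a disc contracting an `S¹`-orbit in `L`: `u(1) ∈ L` and
`u(e^{iθ}) = e^{iθ} u(1)`. -/
def IsOrbitDisc (L : Set M) (u : C(Disc, M)) : Prop :=
  u (ofCircle 1) ∈ L ∧ ∀ c : Circle, u (ofCircle c) = Circle.toUnits c • u (ofCircle 1)

lemma IsOrbitDisc.mapsTo {L : Set M} (hL : CircleInvariant L) {u : C(Disc, M)}
    (hu : IsOrbitDisc L u) : Set.MapsTo u circ L := by
  intro z hz
  have hz' : ‖(z : ℂ)‖ = 1 := hz
  have h := hu.2 ⟨(z : ℂ), mem_sphere_zero_iff_norm.mpr hz'⟩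
  change u z = _ at h
  rw [h]
  exact hL _ _ hu.1

/-- The point `(w, 1)` of `ℂ² ∖ {0}`. -/
def chartZero (w : ℂ) : V2 := ⟨(w, 1), fun h => one_ne_zero (congrArg Prod.snd h)⟩

/-- The point `(1, w)` of `ℂ² ∖ {0}`. -/
def chartInf (w : ℂ) : V2 := ⟨(1, w), fun h => one_ne_zero (congrArg Prod.fst h)⟩

/-- The lift of the section `σ(u)` to `ℂ² ∖ {0}`. -/
def preSectionOf (u : C(Disc, M)) (v : V2) : AssocBundle M :=
  if ‖(v : ℂ × ℂ).1‖ ≤ ‖(v : ℂ × ℂ).2‖ then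
    mkAssoc (u (ofCircle 1), chartZero ((v : ℂ × ℂ).1 / (v : ℂ × ℂ).2))
  else mkAssoc (u (clamp ((v : ℂ × ℂ).2 / (v : ℂ × ℂ).1)),
    chartInf ((v : ℂ × ℂ).2 / (v : ℂ × ℂ).1))

lemma continuous_preSectionOf {L : Set M} {u : C(Disc, M)} (hu : IsOrbitDisc L u) :
    Continuous (preSectionOf u) := by
  have hne : ∀ v : V2, ‖(v : ℂ × ℂ).1‖ ≤ ‖(v : ℂ × ℂ).2‖ → (v : ℂ × ℂ).2 ≠ 0 := by
    intro v h h2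
    rw [h2, norm_zero, norm_le_zero_iff] at h
    exact v.2 (Prod.ext h h2)
  have hne' : ∀ v : V2, ‖(v : ℂ × ℂ).2‖ ≤ ‖(v : ℂ × ℂ).1‖ → (v : ℂ × ℂ).1 ≠ 0 := by
    intro v h h2
    rw [h2, norm_zero, norm_le_zero_iff] at h
    exact v.2 (Prod.ext h2 h)
  refine continuous_if_le (by fun_prop) (by fun_prop) ?_ ?_ ?_
  · refine mkAssoc.continuous.comp_continuousOn ?_
    refine continuousOn_const.prodMk ?_
    have hc : Continuous chartZero := Continuous.subtype_mk (by fun_prop) _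
    exact hc.comp_continuousOn (ContinuousOn.div (Continuous.continuousOn (by fun_prop))
      (Continuous.continuousOn (by fun_prop)) fun v hv => hne v hv)
  · refine mkAssoc.continuous.comp_continuousOn ?_
    have hd : ContinuousOn (fun v : V2 => (v : ℂ × ℂ).2 / (v : ℂ × ℂ).1)
        {v | ‖(v : ℂ × ℂ).2‖ ≤ ‖(v : ℂ × ℂ).1‖} :=
      ContinuousOn.div (Continuous.continuousOn (by fun_prop))
        (Continuous.continuousOn (by fun_prop)) fun v hv => hne' v hv
    have hc : Continuous chartInf := Continuous.subtype_mk (by fun_prop) _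
    exact ((u.continuous.comp clamp.continuous).comp_continuousOn hd).prodMk
      (hc.comp_continuousOn hd)
  · intro v hv
    have h1 := hne' v hv.ge
    have h2 := hne v hv.le
    have hn : ‖(v : ℂ × ℂ).2 / (v : ℂ × ℂ).1‖ = 1 := by
      rw [norm_div, hv, div_self (norm_ne_zero_iff.mpr h2)]
    set c : Circle := ⟨(v : ℂ × ℂ).2 / (v : ℂ × ℂ).1, mem_sphere_zero_iff_norm.mpr hn⟩ with hcdef
    have hcl : clamp ((v : ℂ × ℂ).2 / (v : ℂ × ℂ).1) = ofCircle c := by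
      apply Subtype.ext
      change _ / ((max 1 ‖_‖ : ℝ) : ℂ) = _
      rw [hn, max_self, Complex.ofReal_one, div_one]
      rfl
    rw [hcl, hu.2 c]
    refine (Quotient.sound (MulAction.orbitRel_apply.mpr ⟨Circle.toUnits c, ?_⟩)).symm
    refine Prod.ext ?_ (Subtype.ext ?_)
    · rfl
    change (((v : ℂ × ℂ).2 / (v : ℂ × ℂ).1) • ((v : ℂ × ℂ).1 / (v : ℂ × ℂ).2, (1 : ℂ))) =
      ((1 : ℂ), (v : ℂ × ℂ).2 / (v : ℂ × ℂ).1)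
    ext <;> simp
    field_simp

/-- The section `σ(u) : ℙ¹ → E` defined by a disc `u` contracting an `S¹`-orbit:
`[w : 1] ↦ [u(1), (w, 1)]` and `[1 : w] ↦ [u(w), (1, w)]` for `|w| ≤ 1`. In the coordinate
`z = α / β` this is `z ↦ (u(1), z)` on `𝔻_0` and `z ↦ (u(z⁻¹), z)` on `𝔻_∞`. -/
def sectionOf {L : Set M} {u : C(Disc, M)} (hu : IsOrbitDisc L u) : C(P1, AssocBundle M) where
  toFun := Quotient.lift (preSectionOf u) (by
    rintro v w ⟨c, rfl⟩
    have hc : (c : ℂ) ≠ 0 := c.ne_zero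
    have h1 : ((c • w : V2) : ℂ × ℂ).1 = (c : ℂ) * (w : ℂ × ℂ).1 := rfl
    have h2 : ((c • w : V2) : ℂ × ℂ).2 = (c : ℂ) * (w : ℂ × ℂ).2 := rfl
    have hle : (‖(c : ℂ)‖ * ‖(w : ℂ × ℂ).1‖ ≤ ‖(c : ℂ)‖ * ‖(w : ℂ × ℂ).2‖) ↔
        ‖(w : ℂ × ℂ).1‖ ≤ ‖(w : ℂ × ℂ).2‖ :=
      mul_le_mul_iff_right₀ (norm_pos_iff.mpr hc)
    change preSectionOf u (c • w) = preSectionOf u w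
    simp only [preSectionOf, h1, h2, norm_mul, hle, mul_div_mul_left _ _ hc])
  continuous_toFun := Continuous.quotient_lift (continuous_preSectionOf hu) _

/-- The section `σ_p : ℙ¹ → E`, `[v] ↦ [p, v]`, of a `ℂˣ`-fixed point `p`. -/
def fixedSection {p : M} (hp : ∀ c : ℂˣ, c • p = p) : C(P1, AssocBundle M) where
  toFun := Quotient.lift (fun v : V2 => mkAssoc (p, v)) (by
    rintro v w ⟨c, rfl⟩
    exact Quotient.sound (MulAction.orbitRel_apply.mpr ⟨c, Prod.ext (hp c) rfl⟩))
  continuous_toFun := Continuous.quotient_lift (by fun_prop) _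

/-- The disc `r e^{iθ} ↦ e^{-iθ} γ(r)` of a path `γ` starting at a `ℂˣ`-fixed point. -/
def pathDisc [ContinuousSMul ℂˣ M] (γ : C(unitInterval, M)) (h0 : ∀ c : ℂˣ, c • γ 0 = γ 0) :
    C(Disc, M) where
  toFun z := (Circle.toUnits (Circle.exp (Complex.arg z)))⁻¹ • γ ⟨‖(z : ℂ)‖, norm_nonneg _, z.norm_le⟩
  continuous_toFun := by
    let q : Circle × unitInterval → Disc := fun a =>
      ⟨((a.2 : ℝ) : ℂ) * (a.1 : ℂ), by
        rw [mem_closedBall_zero_iff, norm_mul, Circle.norm_coe, mul_one, Complex.norm_real,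
          Real.norm_of_nonneg a.2.2.1]
        exact a.2.2.2⟩
    have hq : Continuous q := Continuous.subtype_mk (by fun_prop) _
    have hs : Function.Surjective q := fun z =>
      ⟨(Circle.exp (Complex.arg z), ⟨‖(z : ℂ)‖, norm_nonneg _, z.norm_le⟩),
        Subtype.ext (by
          change ((‖(z : ℂ)‖ : ℝ) : ℂ) * ((Circle.exp (Complex.arg z) : Circle) : ℂ) = z
          rw [Circle.coe_exp, Complex.norm_mul_exp_arg_mul_I])⟩
    rw [(hq.isClosedMap.isQuotientMap hq hs).continuous_iff]
    have hu : Continuous fun c : Circle => Circle.toUnits c := by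
      rw [Units.isEmbedding_val₀.continuous_iff]
      exact continuous_subtype_val
    refine Continuous.congr (f := fun a : Circle × unitInterval =>
      (Circle.toUnits a.1)⁻¹ • γ a.2) (by fun_prop) fun a => ?_
    obtain ⟨c, r⟩ := a
    have hn : ‖(q (c, r) : ℂ)‖ = r := by
      change ‖((r : ℝ) : ℂ) * (c : ℂ)‖ = r
      rw [norm_mul, Circle.norm_coe, mul_one, Complex.norm_real, Real.norm_of_nonneg r.2.1]
    have hr : (⟨‖(q (c, r) : ℂ)‖, norm_nonneg _, (q (c, r)).norm_le⟩ : unitInterval) = r :=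
      Subtype.ext hn
    change _ = (Circle.toUnits (Circle.exp (Complex.arg (q (c, r)))))⁻¹ •
      γ ⟨‖(q (c, r) : ℂ)‖, norm_nonneg _, (q (c, r)).norm_le⟩
    rw [hr]
    rcases eq_or_lt_of_le r.2.1 with h | h
    · have h' : r = 0 := Subtype.ext h.symm
      rw [h', ← Circle.toUnits.map_inv, ← Circle.toUnits.map_inv, h0, h0]
    · have ha : Complex.arg (q (c, r)) = Complex.arg c := Complex.arg_real_mul _ h
      rw [ha, Circle.exp_arg]

lemma mapsTo_pathDisc [ContinuousSMul ℂˣ M] {L : Set M} (hL : CircleInvariant L)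
    (γ : C(unitInterval, M)) (h0 : ∀ c : ℂˣ, c • γ 0 = γ 0) (h1 : γ 1 ∈ L) :
    Set.MapsTo (pathDisc γ h0) circ L := by
  intro z hz
  have hr : (⟨‖(z : ℂ)‖, norm_nonneg _, z.norm_le⟩ : unitInterval) = 1 := Subtype.ext hz
  change (Circle.toUnits (Circle.exp (Complex.arg z)))⁻¹ •
    γ ⟨‖(z : ℂ)‖, norm_nonneg _, z.norm_le⟩ ∈ L
  rw [hr]
  exact hL.inv_smul _ h1

/-- The maximal fixed locus `F_max`: the `ℂˣ`-fixed points `p` at which the normal space of the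
fixed locus has only negative weights. The weight `0` part of `T_p M` is tangent to the fixed
locus, so this says that no weight of `ℂˣ` on `T_p M` is positive. -/
def maximalLocus (V : Type*) [NormedAddCommGroup V] [NormedSpace ℂ V] (M : Type)
    [TopologicalSpace M] [ChartedSpace V M] [MulAction ℂˣ M] : Set M :=
  {p | (∀ c : ℂˣ, c • p = p) ∧ ∀ (k : ℤ) (v : V), v ≠ 0 →
    (∀ c : ℂˣ, mfderiv 𝓘(ℂ, V) 𝓘(ℂ, V) (fun x : M => c • x) p v = ((c : ℂ) ^ k • v : V)) → k ≤ 0}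

/-! ### Section classes -/

/-- `H₂^sec(𝓔_t, L̂_t)` for `t ≠ 0`: the classes mapping to `[𝔻, S¹]`. -/
def secClasses (L : Set M) (t : ℂ) : Set (RelH 2 (fibreBdry L t)) :=
  {a | pushRel 2 (fibreToDisc t) (mapsTo_fibreToDisc L t) a = discClass}

/-- `H₂^sec(𝓔_0, L̂_0)`: the classes mapping to `[ℙ¹] + [𝔻, S¹] ∈ H₂(ℙ¹ ∪ 𝔻, S¹)`. -/
def secClassesZero (L : Set M) : Set (RelH 2 (fibreBdry L 0)) :=
  {a | pushRel 2 fibreToBlowup (mapsTo_fibreToBlowup L) a =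
    toRel 2 blowupCirc (pushH 2 sphereToBlowup sphereClass) +
      pushRel 2 discToBlowup mapsTo_discToBlowup discClass}

/-- `b ∈ H₂(M × 𝔻, L × S¹)` is the section class `β̂` of `β ∈ H₂(M, L)`: it projects to `β` and to
`[𝔻, S¹]`. -/
def IsHat (L : Set M) (β : RelH 2 L) (b : RelH 2 (L ×ˢ circ : Set (M × Disc))) : Prop :=
  pushRel 2 (ContinuousMap.fst : C(M × Disc, M)) (fun _ h => h.1) b = β ∧
    pushRel 2 (ContinuousMap.snd : C(M × Disc, Disc)) (fun _ h => h.2) b = discClass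

/-- The class in `H₂(𝓔_t, L̂_t)`, `t ≠ 0`, of `b ∈ H₂(M × 𝔻, L × S¹)` under `𝓔_t ≅ M × 𝔻`. -/
def generalClass (L : Set M) (t : ℂ) (ht : t ≠ 0) :
    RelH 2 (L ×ˢ circ : Set (M × Disc)) →ₗ[ℤ] RelH 2 (fibreBdry L t) :=
  pushRel 2 (trivialization t ht) (mapsTo_trivialization L t ht)

/-- The class `σ + b ∈ H₂(𝓔_0, L̂_0)` of `σ ∈ H₂(E)` and `b ∈ H₂(M × 𝔻, L × S¹)`. -/
def glue {L : Set M} (hL : CircleInvariant L) (σ : SingH 2 (AssocBundle M))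
    (b : RelH 2 (L ×ˢ circ : Set (M × Disc))) : RelH 2 (fibreBdry L 0) :=
  toRel 2 (fibreBdry L 0) (pushH 2 bundlePart σ) + pushRel 2 discPart (mapsTo_discPart hL) b

/-- The class `[u] ∈ H₂(M, L)` of a disc contracting an `S¹`-orbit in `L`. -/
def orbitDiscClass {L : Set M} (hL : CircleInvariant L) {u : C(Disc, M)} (hu : IsOrbitDisc L u) :
    RelH 2 L :=
  pushRel 2 u (hu.mapsTo hL) discClass

/-- The disc class `α ∈ H₂(M, L)` of `r e^{iθ} ↦ e^{-iθ} γ(r)`. -/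
def pathDiscClass [ContinuousSMul ℂˣ M] {L : Set M} (hL : CircleInvariant L)
    (γ : C(unitInterval, M)) (h0 : ∀ c : ℂˣ, c • γ 0 = γ 0) (h1 : γ 1 ∈ L) : RelH 2 L :=
  pushRel 2 (pathDisc γ h0) (mapsTo_pathDisc hL γ h0 h1) discClass

/-- The class in `H₁(L)` of the `S¹`-orbit of `x ∈ L`. -/
def orbitClass [ContinuousSMul ℂˣ M] {L : Set M} (hL : CircleInvariant L) (x : L) : SingH 1 L :=
  pushH 1 (orbitMap hL x) circleClass

/-- The boundary `H₂(𝓔_t, L̂_t) → H₁(L̂_t) → H₁(L)`, used for `t ≠ 0`. -/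
def bdryGeneral [ContinuousSMul ℂˣ M] (L : Set M) (t : ℂ) :
    RelH 2 (fibreBdry L t) →ₗ[ℤ] SingH 1 L :=
  pushH 1 (bdryProj L t) ∘ₗ bdry 1 (fibreBdry L t)

/-- The boundary `H₂(𝓔_0, L̂_0) → H₁(L̂_0) → H₁(L)`. -/
def bdryCentral [ContinuousSMul ℂˣ M] {L : Set M} (hL : CircleInvariant L) :
    RelH 2 (fibreBdry L 0) →ₗ[ℤ] SingH 1 L :=
  pushH 1 (bdryProjZero hL) ∘ₗ bdry 1 (fibreBdry L 0)

end Space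

end

end Degeneration

namespace Degeneration
noncomputable section

set_option linter.unusedSectionVars false

/-! ### Singular chains as a free module -/

/-! Everything rests on one explicit deformation of `𝓔` onto its central fibre, `[x, z, t, (α, β)] ↦
[x, k z, k r t, (α, r β)]`. Here `k` and `r` are real functions of `|z|` that move from `1` to `max
0 (2|z| - 1)` and `max 0 (1 - 2|z|)`. The product of the two final functions is zero, so `t` ends at
`0`. Since `r = 1` at `z = 0`, the vector never vanishes. On `|z| = 1` only `t` and `β` change, by
the same factor, so `𝓛` is preserved. This is `deformation`; it gives `H₂(𝓔_0, L̂_0) ≅ H₂(𝓔, 𝓛)` and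
lets `r` be computed on representatives.

By a relative Künneth formula (`relH_two_prod`, `isHat_iff`), `β̂` is the sum of `β`, placed in the
fibre over `z = 1`, and a constant section through a point `x₀` of `L`. The retraction carries the
first summand to its obvious counterpart in `𝓔_0`. The constant section becomes `retractDisc`, whose
inner half sweeps the exceptional curve and whose outer half sweeps the disc.

Let `α : 𝔻 → M` satisfy `α z = z⁻¹ x₀` on the circle. Because `[x₀, z, 0, (z, 0)] = [z⁻¹ x₀, z, 0,
(1, 0)]`, the retracted section and the graph of `α` in `M × 𝔻` have the same boundary and form a
sphere. Shrinking the `z`-coordinates moves this sphere into `E`, where it is a section over the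
disc closed up by `α` in the fibre over `[1 : 0]`: the class `capClass`. Hence `r(β̂)` is the cap
class plus the hat of `[α] + β` (`pushRel_retractDisc`, `retractionMap_generalClass`). For `α = u ∘
conj` one has `[α] = -[u]` and the cap class is `σ(u)` (`capClass_conjDisc`). For `α(r e^{iθ}) =
e^{-iθ} γ(r)` the cap contracts along `γ` to a fixed point, and the cap class is `σ₀`
(`capClass_pathDisc`).

On boundaries, `β` contributes `∂β` on both sides, while the retracted constant section has boundary
`z ↦ z⁻¹ x₀`, that is `-λ`.

For the bijection, the section classes of `𝓔_t` are the sums of a class from `H₂(M, L)` and the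
constant section, and those of `𝓔_0` form a coset of the kernel of the projection to `ℙ¹ ∪ 𝔻`. So
`H₂(M, L)` must map bijectively onto that kernel (`boundaryFibre_injective`,
`exists_boundaryFibre_of_base_eq_zero`). The sequences of the pairs reduce this to `H₂(M) → H₂(E)`
being injective with image containing the kernel of `H₂(E) → H₂(ℙ¹)`. Excision for the two charts of
`E`, with overlap `M × ℂˣ`, and simple connectivity of `M` give both facts.

The homological tools are built on singular chains: excision from barycentric subdivision, homotopy
invariance of pairs from the cylinder, and computations in degree one from explicit paths. -/

/-- The singular simplex `s` as an element of the chain group. -/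
def sx {X : Type} [TopologicalSpace X] {n : ℕ} (s : C(stdSimplex ℝ (Fin (n + 1)), X)) :
    (Chains X).X n := (chainOf s).hom (1 : ℤ)

/-- The linear map out of the chain group with prescribed values on simplices. -/
def chainLift {X : Type} [TopologicalSpace X] {n : ℕ} {N : Type} [AddCommGroup N] [Module ℤ N]
    (f : C(stdSimplex ℝ (Fin (n + 1)), X) → N) : (Chains X).X n →ₗ[ℤ] N :=
  (Sigma.desc (f := fun _ : (TopCat.toSSet.obj (TopCat.of X)).obj (Opposite.op (SimplexCategory.mk n)) => Zc)
    (fun x => ModuleCat.ofHom (LinearMap.toSpanSingleton ℤ N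
      (f (TopCat.toSSetObjEquiv (TopCat.of X) (Opposite.op (SimplexCategory.mk n)) x))))).hom

lemma chainLift_sx {X : Type} [TopologicalSpace X] {n : ℕ} {N : Type} [AddCommGroup N] [Module ℤ N]
    (f : C(stdSimplex ℝ (Fin (n + 1)), X) → N) (s) : chainLift f (sx s) = f s := by
  have h := Sigma.ι_desc (f := fun _ : (TopCat.toSSet.obj (TopCat.of X)).obj (Opposite.op (SimplexCategory.mk n)) => Zc)
    (fun x => ModuleCat.ofHom (LinearMap.toSpanSingleton ℤ N
      (f (TopCat.toSSetObjEquiv (TopCat.of X) (Opposite.op (SimplexCategory.mk n)) x)))) (simplexOf s)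
  have h' := congrArg (fun φ => φ.hom (1 : ℤ)) h
  refine Eq.trans h' ?_
  refine (LinearMap.toSpanSingleton_apply_one ℤ N _).trans ?_
  exact congrArg f (Equiv.apply_symm_apply _ s)

lemma chain_hom_ext {X : Type} [TopologicalSpace X] {n : ℕ} {N : Type} [AddCommGroup N] [Module ℤ N]
    {f g : (Chains X).X n →ₗ[ℤ] N} (h : ∀ s, f (sx s) = g (sx s)) : f = g := by
  have : ModuleCat.ofHom f = (ModuleCat.ofHom g : (Chains X).X n ⟶ ModuleCat.of ℤ N) := by
    refine SSet.chainComplex_hom_ext (X := TopCat.toSSet.obj (TopCat.of X)) (R := Zc) fun x => ?_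
    obtain ⟨s, rfl⟩ := (TopCat.toSSetObjEquiv (TopCat.of X) (Opposite.op (SimplexCategory.mk n))).symm.surjective x
    ext
    exact h s
  exact congrArg ModuleCat.Hom.hom this

/-- The boundary operator. -/
def bd {X : Type} [TopologicalSpace X] (n : ℕ) : (Chains X).X (n + 1) →ₗ[ℤ] (Chains X).X n :=
  ((Chains X).d (n + 1) n).hom

/-- The chain-level push-forward. -/
def chainPush {X Y : Type} [TopologicalSpace X] [TopologicalSpace Y] (f : C(X, Y)) (n : ℕ) :
    (Chains X).X n →ₗ[ℤ] (Chains Y).X n := ((chainsMap f).f n).hom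

lemma bd_sx {X : Type} [TopologicalSpace X] {n : ℕ} (s : C(stdSimplex ℝ (Fin (n + 2)), X)) :
    bd n (sx s) = ∑ i : Fin (n + 2), (-1 : ℤ) ^ i.val • sx (s.comp (face i)) := by
  have h := congrArg (fun φ => φ.hom (1 : ℤ)) (chainOf_d s)
  refine Eq.trans h ?_
  simp [sx]

lemma chainPush_sx {X Y : Type} [TopologicalSpace X] [TopologicalSpace Y] (f : C(X, Y)) {n : ℕ}
    (s : C(stdSimplex ℝ (Fin (n + 1)), X)) : chainPush f n (sx s) = sx (f.comp s) :=
  congrArg (fun φ => φ.hom (1 : ℤ)) (SSet.ι_chainComplexMap_f _ _ (TopCat.toSSet.map (TopCat.ofHom f)) Zc (simplexOf s))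

lemma bd_bd {X : Type} [TopologicalSpace X] {n : ℕ} (c : (Chains X).X (n + 2)) :
    bd n (bd (n + 1) c) = 0 :=
  congrArg (fun φ => φ.hom c) ((Chains X).d_comp_d (n + 2) (n + 1) n)

lemma bd_chainPush {X Y : Type} [TopologicalSpace X] [TopologicalSpace Y] (f : C(X, Y)) {n : ℕ}
    (c : (Chains X).X (n + 1)) : bd n (chainPush f (n + 1) c) = chainPush f n (bd n c) :=
  congrArg (fun φ => φ.hom c) ((chainsMap f).comm (n + 1) n)

/-- The quotient map by the span kills every simplex, hence vanishes by `chain_hom_ext`. Arguments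
that check a property of chains on simplices use this. -/
lemma span_sx {X : Type} [TopologicalSpace X] (n : ℕ) :
    Submodule.span ℤ (Set.range (sx (X := X) (n := n))) = ⊤ := by
  set S := Submodule.span ℤ (Set.range (sx (X := X) (n := n)))
  let : Module ℤ ((Chains X).X n ⧸ S) := Submodule.Quotient.module S
  have h : S.mkQ = 0 := by
    refine chain_hom_ext fun s => ?_
    exact (Submodule.Quotient.mk_eq_zero S).mpr (Submodule.subset_span ⟨s, rfl⟩)
  rw [← Submodule.ker_mkQ S, h, LinearMap.ker_zero]

lemma chainPush_comp {X Y Z : Type} [TopologicalSpace X] [TopologicalSpace Y] [TopologicalSpace Z]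
    (g : C(Y, Z)) (f : C(X, Y)) (n : ℕ) (c : (Chains X).X n) :
    chainPush g n (chainPush f n c) = chainPush (g.comp f) n c := by
  have : chainPush g n ∘ₗ chainPush f n = chainPush (g.comp f) n :=
    chain_hom_ext fun s => by
      rw [LinearMap.comp_apply, chainPush_sx, chainPush_sx, chainPush_sx, ContinuousMap.comp_assoc]
  exact congrArg (fun φ => φ c) this

lemma chainPush_incl_injective {X : Type} [TopologicalSpace X] (A : Set X) (n : ℕ) :
    Function.Injective (chainPush (incl A) n) := by
  have := mono_chainsMap_incl A
  exact (ModuleCat.mono_iff_injective _).mp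
    (inferInstanceAs (Mono ((chainsMap (incl A)).f n)))

/-! ### Barycentric subdivision of formal simplices -/

/-- Formal combinations of `n`-tuples of points (`n = 0` gives the augmentation). -/
abbrev Tup (W : Type) (n : ℕ) : Type := (Fin n → W) →₀ ℤ

/-- The alternating sum of the faces. -/
def tbd {W : Type} (n : ℕ) : Tup W (n + 1) →ₗ[ℤ] Tup W n :=
  Finsupp.linearCombination ℤ fun w =>
    ∑ i : Fin (n + 1), (-1 : ℤ) ^ i.val • Finsupp.single (fun j => w (i.succAbove j)) (1 : ℤ)

lemma tbd_single {W : Type} {n : ℕ} (w : Fin (n + 1) → W) : tbd n (Finsupp.single w 1) =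
    ∑ i : Fin (n + 1), (-1 : ℤ) ^ i.val • Finsupp.single (fun j => w (i.succAbove j)) (1 : ℤ) := by
  rw [tbd, Finsupp.linearCombination_single, one_smul]

/-- The cone with apex `x`. -/
def tcone {W : Type} (x : W) (n : ℕ) : Tup W n →ₗ[ℤ] Tup W (n + 1) :=
  Finsupp.lmapDomain ℤ ℤ fun w : Fin n → W => (Fin.cons x w : Fin (n + 1) → W)

lemma tcone_single {W : Type} (x : W) {n : ℕ} (w : Fin n → W) :
    tcone x n (Finsupp.single w 1) = Finsupp.single (Fin.cons x w : Fin (n + 1) → W) 1 :=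
  Finsupp.mapDomain_single

lemma tup_hom_ext {W N : Type} [AddCommGroup N] [Module ℤ N] {n : ℕ} {f g : Tup W n →ₗ[ℤ] N}
    (h : ∀ w, f (Finsupp.single w 1) = g (Finsupp.single w 1)) : f = g :=
  Finsupp.lhom_ext' fun w => LinearMap.ext_ring (h w)

lemma tbd_tcone_zero {W : Type} (x : W) (c : Tup W 0) : tbd 0 (tcone x 0 c) = c := by
  have : tbd 0 ∘ₗ tcone x 0 = LinearMap.id := by
    refine tup_hom_ext fun w => ?_
    rw [LinearMap.comp_apply, tcone_single, tbd_single, Fin.sum_univ_one]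
    simp only [Fin.val_zero, pow_zero, one_smul, LinearMap.id_apply]
    congr 1
  exact congrArg (fun φ => φ c) this

/-- The face opposite the apex returns the tuple itself; the other faces are cones on its faces,
with the sign shifted by one. This identity drives the inductions below. -/
lemma tbd_tcone_succ {W : Type} (x : W) {n : ℕ} (c : Tup W (n + 1)) :
    tbd (n + 1) (tcone x (n + 1) c) = c - tcone x n (tbd n c) := by
  have : tbd (n + 1) ∘ₗ tcone x (n + 1) = LinearMap.id - tcone x n ∘ₗ tbd n := by
    refine tup_hom_ext fun w => ?_
    rw [LinearMap.comp_apply, tcone_single, tbd_single, Fin.sum_univ_succ, LinearMap.sub_apply,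
      LinearMap.comp_apply, tbd_single, map_sum, sub_eq_add_neg, ← Finset.sum_neg_distrib]
    congr 1
    · simp
    · refine Finset.sum_congr rfl fun i _ => ?_
      rw [map_smul, tcone_single, Fin.val_succ, pow_succ, mul_neg_one, neg_smul]
      congr 3
      funext j
      refine Fin.cases ?_ (fun k => ?_) j
      · rw [Fin.succ_succAbove_zero, Fin.cons_zero, Fin.cons_zero]
      · rw [Fin.succ_succAbove_succ, Fin.cons_succ, Fin.cons_succ]
  exact congrArg (fun φ => φ c) this

/-- Every tuple is the cone on its tail, so the cone formula turns the statement into the one a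
degree lower. -/
lemma tbd_tbd {W : Type} : ∀ (n : ℕ) (c : Tup W (n + 2)), tbd n (tbd (n + 1) c) = 0 := by
  intro n
  induction n with
  | zero =>
    intro c
    have : tbd 0 ∘ₗ tbd 1 = (0 : Tup W 2 →ₗ[ℤ] Tup W 0) := by
      refine tup_hom_ext fun w => ?_
      rw [← Fin.cons_self_tail w, ← tcone_single, LinearMap.comp_apply, tbd_tcone_succ, map_sub,
        tbd_tcone_zero, sub_self, LinearMap.zero_apply]
    exact congrArg (fun φ => φ c) this
  | succ n ih =>
    intro c
    have : tbd (n + 1) ∘ₗ tbd (n + 2) = (0 : Tup W (n + 3) →ₗ[ℤ] Tup W (n + 1)) := by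
      refine tup_hom_ext fun w => ?_
      rw [← Fin.cons_self_tail w, ← tcone_single, LinearMap.comp_apply, tbd_tcone_succ, map_sub,
        tbd_tcone_succ, ih, map_zero, sub_zero, sub_self, LinearMap.zero_apply]
    exact congrArg (fun φ => φ c) this

/-- The push-forward of tuples. -/
def tmap {W W' : Type} (g : W → W') (n : ℕ) : Tup W n →ₗ[ℤ] Tup W' n :=
  Finsupp.lmapDomain ℤ ℤ fun w => g ∘ w

lemma tmap_single {W W' : Type} (g : W → W') {n : ℕ} (w : Fin n → W) :
    tmap g n (Finsupp.single w 1) = Finsupp.single (g ∘ w) 1 :=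
  Finsupp.mapDomain_single

lemma tmap_tbd {W W' : Type} (g : W → W') {n : ℕ} (c : Tup W (n + 1)) :
    tmap g n (tbd n c) = tbd n (tmap g (n + 1) c) := by
  have : tmap g n ∘ₗ tbd n = tbd n ∘ₗ tmap g (n + 1) := by
    refine tup_hom_ext fun w => ?_
    rw [LinearMap.comp_apply, LinearMap.comp_apply, tmap_single, tbd_single, tbd_single, map_sum]
    refine Finset.sum_congr rfl fun i _ => ?_
    rw [map_smul, tmap_single]
    rfl
  exact congrArg (fun φ => φ c) this

lemma tmap_tcone {W W' : Type} (g : W → W') (x : W) {n : ℕ} (c : Tup W n) :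
    tmap g (n + 1) (tcone x n c) = tcone (g x) n (tmap g n c) := by
  have : tmap g (n + 1) ∘ₗ tcone x n = tcone (g x) n ∘ₗ tmap g n := by
    refine tup_hom_ext fun w => ?_
    rw [LinearMap.comp_apply, LinearMap.comp_apply, tmap_single, tcone_single, tcone_single,
      tmap_single]
    congr 1
    funext j
    refine Fin.cases ?_ (fun k => ?_) j <;> simp
  exact congrArg (fun φ => φ c) this

/-- A choice of barycenters of tuples. -/
abbrev Bary (W : Type) : Type := ∀ n : ℕ, (Fin (n + 1) → W) → W

/-- The subdivision operator. -/
def tsd {W : Type} (b : Bary W) : ∀ n, Tup W n →ₗ[ℤ] Tup W n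
  | 0 => LinearMap.id
  | n + 1 => Finsupp.linearCombination ℤ fun w => tcone (b n w) n (tsd b n (tbd n (Finsupp.single w 1)))

lemma tsd_single {W : Type} (b : Bary W) {n : ℕ} (w : Fin (n + 1) → W) :
    tsd b (n + 1) (Finsupp.single w 1) = tcone (b n w) n (tsd b n (tbd n (Finsupp.single w 1))) := by
  rw [tsd, Finsupp.linearCombination_single, one_smul]

/-- The chain homotopy between the identity and the subdivision operator. -/
def tht {W : Type} (b : Bary W) : ∀ n, Tup W n →ₗ[ℤ] Tup W (n + 1)
  | 0 => 0
  | n + 1 => Finsupp.linearCombination ℤ fun w =>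
      tcone (b n w) (n + 1) (Finsupp.single w 1 - tht b n (tbd n (Finsupp.single w 1)))

lemma tht_single {W : Type} (b : Bary W) {n : ℕ} (w : Fin (n + 1) → W) :
    tht b (n + 1) (Finsupp.single w 1) =
      tcone (b n w) (n + 1) (Finsupp.single w 1 - tht b n (tbd n (Finsupp.single w 1))) := by
  rw [tht, Finsupp.linearCombination_single, one_smul]

/-- The subdivision of `w` is the cone over its subdivided boundary, so the cone formula gives the
claim up to the cone on `∂S∂w`, which is `S∂∂w = 0` by induction. -/
lemma tbd_tsd {W : Type} (b : Bary W) (n : ℕ) (c : Tup W (n + 1)) :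
    tbd n (tsd b (n + 1) c) = tsd b n (tbd n c) := by
  have : tbd n ∘ₗ tsd b (n + 1) = tsd b n ∘ₗ tbd n := by
    induction n with
    | zero =>
      refine tup_hom_ext fun w => ?_
      rw [LinearMap.comp_apply, LinearMap.comp_apply, tsd_single, tbd_tcone_zero]
    | succ n ih =>
      refine tup_hom_ext fun w => ?_
      have h := congrArg (fun φ => φ (tbd (n + 1) (Finsupp.single w 1))) (ih 0)
      simp only [LinearMap.comp_apply] at h
      rw [LinearMap.comp_apply, LinearMap.comp_apply, tsd_single, tbd_tcone_succ, h, tbd_tbd,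
        map_zero, map_zero, sub_zero]
  exact congrArg (fun φ => φ c) this

/-- With `T w = b·(w - T∂w)` the cone formula gives `∂T w = w - T∂w - b·(∂w - ∂T∂w)`. By induction
`∂T∂w = ∂w - S∂w`, and the last term is `b·S∂w = S w`. -/
lemma tbd_tht {W : Type} (b : Bary W) (n : ℕ) (c : Tup W (n + 1)) :
    tbd (n + 1) (tht b (n + 1) c) = c - tsd b (n + 1) c - tht b n (tbd n c) := by
  have : tbd (n + 1) ∘ₗ tht b (n + 1) = LinearMap.id - tsd b (n + 1) - tht b n ∘ₗ tbd n := by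
    induction n with
    | zero =>
      refine tup_hom_ext fun w => ?_
      simp only [LinearMap.comp_apply, LinearMap.sub_apply, LinearMap.id_apply, tht_single,
        tsd_single, tbd_tcone_succ]
      simp only [tht, LinearMap.zero_apply, sub_zero, tsd, LinearMap.id_apply]
    | succ n ih =>
      refine tup_hom_ext fun w => ?_
      have h := congrArg (fun φ => φ (tbd (n + 1) (Finsupp.single w 1))) (ih 0)
      simp only [LinearMap.comp_apply, LinearMap.sub_apply, LinearMap.id_apply, tbd_tbd, map_zero,
        sub_zero] at h
      simp only [LinearMap.comp_apply, LinearMap.sub_apply, LinearMap.id_apply, tht_single,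
        tsd_single, tbd_tcone_succ, map_sub, h]
      abel
  exact congrArg (fun φ => φ c) this

/-- It is enough that `g` respects barycenters, as affine maps do. This is what lets subdivision
pass from the standard simplex to singular simplices. -/
lemma tmap_tsd {W W' : Type} {b : Bary W} {b' : Bary W'} {g : W → W'}
    (hg : ∀ n w, g (b n w) = b' n (g ∘ w)) (n : ℕ) (c : Tup W n) :
    tmap g n (tsd b n c) = tsd b' n (tmap g n c) := by
  have : tmap g n ∘ₗ tsd b n = tsd b' n ∘ₗ tmap g n := by
    induction n with
    | zero => rfl
    | succ n ih =>
      refine tup_hom_ext fun w => ?_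
      have h := congrArg (fun φ => φ (tbd n (Finsupp.single w 1))) (ih 0)
      simp only [LinearMap.comp_apply] at h
      rw [LinearMap.comp_apply, LinearMap.comp_apply, tsd_single, tmap_tcone, h, tmap_tbd,
        tmap_single, tsd_single, hg]
  exact congrArg (fun φ => φ c) this

lemma tmap_tht {W W' : Type} {b : Bary W} {b' : Bary W'} {g : W → W'}
    (hg : ∀ n w, g (b n w) = b' n (g ∘ w)) (n : ℕ) (c : Tup W n) :
    tmap g (n + 1) (tht b n c) = tht b' n (tmap g n c) := by
  have : tmap g (n + 1) ∘ₗ tht b n = tht b' n ∘ₗ tmap g n := by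
    induction n with
    | zero => simp only [tht, LinearMap.comp_zero, LinearMap.zero_comp]
    | succ n ih =>
      refine tup_hom_ext fun w => ?_
      have h := congrArg (fun φ => φ (tbd n (Finsupp.single w 1))) (ih 0)
      simp only [LinearMap.comp_apply] at h
      rw [LinearMap.comp_apply, LinearMap.comp_apply, tht_single, tmap_tcone, map_sub, h, tmap_tbd,
        tmap_single, tht_single, hg]
  exact congrArg (fun φ => φ c) this

/-- Barycenters lie in balls containing the tuple, and contract diameters. -/
structure Bary.Contracting {W : Type} [PseudoMetricSpace W] (b : Bary W) : Prop where
  dist_le : ∀ {n : ℕ} (w : Fin (n + 1) → W) (x : W) (r : ℝ), (∀ j, dist (w j) x ≤ r) →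
    dist (b n w) x ≤ r
  dist_bary : ∀ {n : ℕ} (w : Fin (n + 1) → W) (δ : ℝ), (∀ i j, dist (w i) (w j) ≤ δ) →
    ∀ j, dist (w j) (b n w) ≤ (n : ℝ) / (n + 1) * δ

/-- The induction carries a second clause: new vertices stay in every closed ball containing the old
ones. Applied to balls around the barycenter of `w`, it controls the distance from the new apex to
the subdivided faces. The bound `K` is fixed because `n / (n + 1) ≤ K / (K + 1)` treats all lower
faces at once. -/
lemma tsd_mem_span {W : Type} [PseudoMetricSpace W] {b : Bary W} (hb : b.Contracting) (K : ℕ)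
    {δ : ℝ} (hδ : 0 ≤ δ) : ∀ n, n ≤ K + 1 → ∀ w : Fin n → W, (∀ i j, dist (w i) (w j) ≤ δ) →
    tsd b n (Finsupp.single w 1) ∈ Submodule.span ℤ {c : Tup W n | ∃ v : Fin n → W,
      c = Finsupp.single v 1 ∧ (∀ i j, dist (v i) (v j) ≤ (K : ℝ) / (K + 1) * δ) ∧
      ∀ x r, (∀ j, dist (w j) x ≤ r) → ∀ i, dist (v i) x ≤ r} := by
  have hK : (0 : ℝ) ≤ (K : ℝ) / (K + 1) * δ := by positivity
  intro n
  induction n with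
  | zero =>
    intro _ w _
    exact Submodule.subset_span ⟨w, rfl, fun i => i.elim0, fun _ _ _ i => i.elim0⟩
  | succ n ih =>
    intro hn w hw
    rw [tsd_single, tbd_single, map_sum, map_sum]
    refine Submodule.sum_mem _ fun i _ => ?_
    rw [map_smul, map_smul]
    refine Submodule.smul_mem _ _ ?_
    have h1 := ih (by omega) (fun j => w (i.succAbove j)) fun _ _ => hw _ _
    have h2 := Submodule.mem_map_of_mem (f := tcone (b n w) n) h1
    rw [Submodule.map_span] at h2
    refine Submodule.span_mono ?_ h2
    rintro _ ⟨_, ⟨v, rfl, hv, hv'⟩, rfl⟩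
    have hball : ∀ j, dist (w j) (b n w) ≤ (K : ℝ) / (K + 1) * δ := fun j => by
      refine (hb.dist_bary w δ hw j).trans (mul_le_mul_of_nonneg_right ?_ hδ)
      rw [div_le_div_iff₀ (by positivity) (by positivity)]
      have : (n : ℝ) ≤ K := by exact_mod_cast (by omega : n ≤ K)
      nlinarith
    have hbv : ∀ j, dist (v j) (b n w) ≤ (K : ℝ) / (K + 1) * δ := hv' _ _ fun j => hball _
    refine ⟨Fin.cons (b n w) v, tcone_single _ _, fun j k => ?_, fun x r hx j => ?_⟩
    · refine Fin.cases ?_ (fun j => ?_) j <;> refine Fin.cases ?_ (fun k => ?_) k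
      · simpa using hK
      · simpa [dist_comm] using hbv k
      · simpa using hbv j
      · simpa using hv j k
    · refine Fin.cases ?_ (fun j => ?_) j
      · exact hb.dist_le w x r hx
      · exact hv' x r (fun j => hx _) j

/-- Formal simplices of diameter at most `δ`. -/
def tsmall (W : Type) [PseudoMetricSpace W] (n : ℕ) (δ : ℝ) : Submodule ℤ (Tup W n) :=
  Submodule.span ℤ {c | ∃ v : Fin n → W, c = Finsupp.single v 1 ∧ ∀ i j, dist (v i) (v j) ≤ δ}

lemma tsd_iterate_mem_tsmall {W : Type} [PseudoMetricSpace W] {b : Bary W} (hb : b.Contracting)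
    (n : ℕ) {δ : ℝ} (hδ : 0 ≤ δ) {c : Tup W (n + 1)} (hc : c ∈ tsmall W (n + 1) δ) (N : ℕ) :
    (tsd b (n + 1))^[N] c ∈ tsmall W (n + 1) (((n : ℝ) / (n + 1)) ^ N * δ) := by
  induction N with
  | zero => simpa using hc
  | succ N ih =>
    rw [Function.iterate_succ_apply']
    have h2 := Submodule.mem_map_of_mem (f := tsd b (n + 1)) ih
    refine (?_ : Submodule.map (tsd b (n + 1)) _ ≤ _) h2
    rw [tsmall, Submodule.map_span, Submodule.span_le]
    rintro _ ⟨_, ⟨v, rfl, hv⟩, rfl⟩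
    refine Submodule.span_mono ?_ (tsd_mem_span hb n (by positivity) (n + 1) le_rfl v hv)
    rintro _ ⟨v, rfl, hv, -⟩
    refine ⟨v, rfl, fun i j => (hv i j).trans (le_of_eq ?_)⟩
    rw [pow_succ]; ring

/-! ### Affine simplices and the subdivision of singular chains -/

/-- The affine map of simplices with prescribed vertices. -/
def aff {n m : ℕ} (w : Fin (n + 1) → stdSimplex ℝ (Fin (m + 1))) :
    C(stdSimplex ℝ (Fin (n + 1)), stdSimplex ℝ (Fin (m + 1))) where
  toFun p := ⟨fun k => ∑ j, p j * w j k, fun k => Finset.sum_nonneg fun j _ =>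
    mul_nonneg (p.2.1 j) ((w j).2.1 k), by
      rw [Finset.sum_comm]
      simp_rw [← Finset.mul_sum]
      have h : ∀ j, ∑ k, (w j) k = 1 := fun j => (w j).2.2
      simp_rw [h, mul_one]
      exact p.2.2⟩
  continuous_toFun := by
    refine Continuous.subtype_mk (continuous_pi fun k => continuous_finsetSum _ fun j _ => ?_) _
    exact ((continuous_apply j).comp continuous_subtype_val).mul continuous_const

lemma aff_apply {n m : ℕ} (w : Fin (n + 1) → stdSimplex ℝ (Fin (m + 1)))
    (p : stdSimplex ℝ (Fin (n + 1))) (k) : aff w p k = ∑ j, p j * w j k := rfl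

/-- The vertices of the standard simplex. -/
def vert (n : ℕ) : Fin (n + 1) → stdSimplex ℝ (Fin (n + 1)) := fun i => ⟨Pi.single i 1, by
  refine ⟨fun k => ?_, ?_⟩
  · by_cases h : k = i
    · subst h; simp
    · simp [h]
  · simp⟩

lemma vert_apply (n : ℕ) (i k : Fin (n + 1)) : vert n i k = (Pi.single i 1 : Fin (n + 1) → ℝ) k := rfl

lemma simplex_ext {n : ℕ} {p q : stdSimplex ℝ (Fin (n + 1))} (h : ∀ k, p k = q k) : p = q :=
  Subtype.ext (funext h)

lemma aff_vert {n : ℕ} : aff (vert n) = ContinuousMap.id _ := by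
  ext p k
  change ∑ j, p j * vert n j k = p k
  simp [vert_apply, Pi.single_apply]

lemma aff_apply_vert {n m : ℕ} (w : Fin (n + 1) → stdSimplex ℝ (Fin (m + 1))) (i) :
    aff w (vert n i) = w i := by
  refine simplex_ext fun k => ?_
  rw [aff_apply]
  simp [vert_apply, Pi.single_apply]

lemma aff_aff {l n m : ℕ} (w : Fin (n + 1) → stdSimplex ℝ (Fin (m + 1)))
    (v : Fin (l + 1) → stdSimplex ℝ (Fin (n + 1))) (p) :
    aff w (aff v p) = aff (fun i => aff w (v i)) p := by
  refine simplex_ext fun k => ?_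
  simp only [aff_apply, Finset.sum_mul, Finset.mul_sum]
  rw [Finset.sum_comm]
  simp_rw [mul_assoc]

lemma aff_comp {l n m : ℕ} (w : Fin (n + 1) → stdSimplex ℝ (Fin (m + 1)))
    (v : Fin (l + 1) → stdSimplex ℝ (Fin (n + 1))) :
    (aff w).comp (aff v) = aff fun i => aff w (v i) :=
  ContinuousMap.ext fun p => aff_aff w v p

lemma face_eq_aff {n : ℕ} (i : Fin (n + 2)) :
    face i = aff fun j => vert (n + 1) (i.succAbove j) := by
  ext p k
  change FunOnFinite.linearMap ℝ ℝ (SimplexCategory.δ i) p k =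
    ∑ j, p j * vert (n + 1) (i.succAbove j) k
  rw [FunOnFinite.linearMap_apply_apply, Finset.sum_filter]
  refine Finset.sum_congr rfl fun j _ => ?_
  rw [vert_apply, Pi.single_apply, mul_ite, mul_one, mul_zero]
  refine if_congr ?_ rfl rfl
  exact eq_comm

lemma aff_comp_face {n m : ℕ} (w : Fin (n + 2) → stdSimplex ℝ (Fin (m + 1))) (i) :
    (aff w).comp (face i) = aff fun j => w (i.succAbove j) := by
  rw [face_eq_aff, aff_comp]
  simp_rw [aff_apply_vert]

/-- The barycenter of the standard simplex. -/
def bary (n : ℕ) : stdSimplex ℝ (Fin (n + 1)) :=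
  ⟨fun _ => 1 / ((n : ℝ) + 1), fun _ => by positivity, by
    rw [Finset.sum_const, Finset.card_univ, Fintype.card_fin, nsmul_eq_mul]
    push_cast
    field_simp⟩

/-- The barycenters of affine simplices. -/
def affBary (m : ℕ) : Bary (stdSimplex ℝ (Fin (m + 1))) := fun n w => aff w (bary n)

lemma affBary_aff {n m : ℕ} (w : Fin (n + 1) → stdSimplex ℝ (Fin (m + 1))) (l : ℕ)
    (v : Fin (l + 1) → stdSimplex ℝ (Fin (n + 1))) :
    aff w (affBary n l v) = affBary m l (aff w ∘ v) := aff_aff w v _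

lemma simplex_dist_le {m : ℕ} {p q : stdSimplex ℝ (Fin (m + 1))} {r : ℝ} :
    dist p q ≤ r ↔ ∀ k, |p k - q k| ≤ r := by
  rw [Subtype.dist_eq, dist_pi_le_iff']
  rfl

lemma dist_aff_le {n m : ℕ} (w : Fin (n + 1) → stdSimplex ℝ (Fin (m + 1)))
    (x : stdSimplex ℝ (Fin (m + 1))) (r : ℝ) (h : ∀ j, dist (w j) x ≤ r) (p) :
    dist (aff w p) x ≤ r := by
  rw [simplex_dist_le]
  intro k
  have hp : ∑ j, p j = 1 := p.2.2
  have : aff w p k - x k = ∑ j, p j * (w j k - x k) := by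
    simp_rw [mul_sub, Finset.sum_sub_distrib, ← Finset.sum_mul, hp, one_mul, aff_apply]
  rw [this]
  calc |∑ j, p j * (w j k - x k)| ≤ ∑ j, |p j * (w j k - x k)| := Finset.abs_sum_le_sum_abs _ _
    _ ≤ ∑ j, p j * r := Finset.sum_le_sum fun j _ => by
        rw [abs_mul, abs_of_nonneg (show 0 ≤ p j from p.2.1 j)]
        exact mul_le_mul_of_nonneg_left (simplex_dist_le.mp (h j) k) (p.2.1 j)
    _ = r := by rw [← Finset.sum_mul, hp, one_mul]

lemma affBary_contracting (m : ℕ) : (affBary m).Contracting where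
  dist_le w x r h := dist_aff_le w x r h _
  dist_bary {n} w δ h j := by
    rw [simplex_dist_le]
    intro k
    have e : w j k - affBary m n w k = ∑ i, 1 / ((n : ℝ) + 1) * (w j k - w i k) := by
      simp_rw [mul_sub, Finset.sum_sub_distrib, Finset.sum_const, Finset.card_univ,
        Fintype.card_fin, nsmul_eq_mul]
      have : affBary m n w k = ∑ i, 1 / ((n : ℝ) + 1) * w i k := rfl
      rw [this]
      push_cast
      field_simp
    rw [e, ← Finset.mul_sum, abs_mul, abs_of_nonneg (by positivity)]
    -- The term `i = j` vanishes, so only `n` of the `n + 1` differences count; this produces the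
    -- factor `n / (n + 1)`.
    have hs : |∑ i, (w j k - w i k)| ≤ n * δ := by
      rw [← Finset.sum_erase_add _ _ (Finset.mem_univ j), sub_self, add_zero]
      refine (Finset.abs_sum_le_sum_abs _ _).trans ?_
      refine (Finset.sum_le_card_nsmul _ _ δ fun i _ => simplex_dist_le.mp (h j i) k).trans ?_
      rw [Finset.card_erase_of_mem (Finset.mem_univ j), Finset.card_univ, Fintype.card_fin,
        nsmul_eq_mul, Nat.add_sub_cancel]
    calc 1 / ((n : ℝ) + 1) * |∑ i, (w j k - w i k)| ≤ 1 / ((n : ℝ) + 1) * (n * δ) :=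
          mul_le_mul_of_nonneg_left hs (by positivity)
      _ = _ := by ring

section

variable {X : Type} [TopologicalSpace X]

/-- The singular chain of a formal combination of affine simplices. -/
def realize {m : ℕ} (σ : C(stdSimplex ℝ (Fin (m + 1)), X)) (n : ℕ) :
    Tup (stdSimplex ℝ (Fin (m + 1))) (n + 1) →ₗ[ℤ] (Chains X).X n :=
  Finsupp.linearCombination ℤ fun w => sx (σ.comp (aff w))

lemma realize_single {m : ℕ} (σ : C(stdSimplex ℝ (Fin (m + 1)), X)) {n : ℕ} (w) :
    realize σ n (Finsupp.single w 1) = sx (σ.comp (aff w)) := by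
  exact (Finsupp.linearCombination_single ℤ _ _).trans 
    (@one_smul ℤ _ _ ((Chains X).X n).isModule.toMulAction _)

lemma bd_realize {m : ℕ} (σ : C(stdSimplex ℝ (Fin (m + 1)), X)) {n : ℕ}
    (c : Tup (stdSimplex ℝ (Fin (m + 1))) (n + 2)) :
    bd n (realize σ (n + 1) c) = realize σ n (tbd (n + 1) c) := by
  have : bd n ∘ₗ realize σ (n + 1) = realize σ n ∘ₗ tbd (n + 1) := by
    refine tup_hom_ext fun w => ?_
    rw [LinearMap.comp_apply, LinearMap.comp_apply, realize_single, bd_sx, tbd_single, map_sum]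
    refine Finset.sum_congr rfl fun i _ => ?_
    rw [map_zsmul, realize_single, ContinuousMap.comp_assoc, aff_comp_face]
  exact congrArg (fun φ => φ c) this

lemma realize_aff {k m : ℕ} (σ : C(stdSimplex ℝ (Fin (m + 1)), X))
    (w : Fin (k + 1) → stdSimplex ℝ (Fin (m + 1))) {n : ℕ} (c) :
    realize (σ.comp (aff w)) n c = realize σ n (tmap (aff w) (n + 1) c) := by
  have : realize (σ.comp (aff w)) n = realize σ n ∘ₗ tmap (aff w) (n + 1) := by
    refine tup_hom_ext fun v => ?_
    rw [LinearMap.comp_apply, tmap_single, realize_single, realize_single,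
      ContinuousMap.comp_assoc, aff_comp]
    rfl
  exact congrArg (fun φ => φ c) this

/-- The identity simplex as a formal affine simplex. -/
abbrev fund (n : ℕ) : Tup (stdSimplex ℝ (Fin (n + 1))) (n + 1) := Finsupp.single (vert n) 1

lemma tmap_fund {n m : ℕ} (w : Fin (n + 1) → stdSimplex ℝ (Fin (m + 1))) :
    tmap (aff w) (n + 1) (fund n) = Finsupp.single w 1 := by
  rw [tmap_single]
  congr 1
  funext i
  exact aff_apply_vert w i

lemma realize_fund {n : ℕ} (σ : C(stdSimplex ℝ (Fin (n + 1)), X)) :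
    realize σ n (fund n) = sx σ := by
  rw [realize_single, aff_vert, ContinuousMap.comp_id]

/-- Barycentric subdivision of singular chains. -/
def subdiv (n : ℕ) : (Chains X).X n →ₗ[ℤ] (Chains X).X n :=
  chainLift fun σ => realize σ n (tsd (affBary n) (n + 1) (fund n))

/-- The chain homotopy between the identity and barycentric subdivision. -/
def subdivHtpy (n : ℕ) : (Chains X).X n →ₗ[ℤ] (Chains X).X (n + 1) :=
  chainLift fun σ => realize σ (n + 1) (tht (affBary n) (n + 1) (fund n))

lemma subdiv_realize {m : ℕ} (σ : C(stdSimplex ℝ (Fin (m + 1)), X)) {n : ℕ} (c) :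
    subdiv n (realize σ n c) = realize σ n (tsd (affBary m) (n + 1) c) := by
  have : subdiv n ∘ₗ realize σ n = realize σ n ∘ₗ tsd (affBary m) (n + 1) := by
    refine tup_hom_ext fun w => ?_
    rw [LinearMap.comp_apply, LinearMap.comp_apply, realize_single, subdiv, chainLift_sx,
      realize_aff, tmap_tsd (affBary_aff w), tmap_fund]
  exact congrArg (fun φ => φ c) this

lemma subdivHtpy_realize {m : ℕ} (σ : C(stdSimplex ℝ (Fin (m + 1)), X)) {n : ℕ} (c) :
    subdivHtpy n (realize σ n c) = realize σ (n + 1) (tht (affBary m) (n + 1) c) := by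
  have : subdivHtpy n ∘ₗ realize σ n = realize σ (n + 1) ∘ₗ tht (affBary m) (n + 1) := by
    refine tup_hom_ext fun w => ?_
    rw [LinearMap.comp_apply, LinearMap.comp_apply, realize_single, subdivHtpy, chainLift_sx,
      realize_aff, tmap_tht (affBary_aff w), tmap_fund]
  exact congrArg (fun φ => φ c) this

/-- Each simplex is the realization of the fundamental affine simplex, and realization intertwines
the formal operators with the singular ones. -/
lemma bd_subdiv {n : ℕ} (c : (Chains X).X (n + 1)) :
    bd n (subdiv (n + 1) c) = subdiv n (bd n c) := by
  have : bd n ∘ₗ subdiv (X := X) (n + 1) = subdiv n ∘ₗ bd n := by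
    refine chain_hom_ext fun σ => ?_
    rw [LinearMap.comp_apply, LinearMap.comp_apply, ← realize_fund σ, subdiv_realize, bd_realize,
      bd_realize, subdiv_realize, tbd_tsd]
  exact congrArg (fun φ => φ c) this

lemma bd_subdivHtpy {n : ℕ} (c : (Chains X).X (n + 1)) :
    bd (n + 1) (subdivHtpy (n + 1) c) = c - subdiv (n + 1) c - subdivHtpy n (bd n c) := by
  have : bd (n + 1) ∘ₗ subdivHtpy (X := X) (n + 1) =
      LinearMap.id - subdiv (n + 1) - subdivHtpy n ∘ₗ bd n := by
    refine chain_hom_ext fun σ => ?_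
    simp only [LinearMap.comp_apply, LinearMap.sub_apply, LinearMap.id_apply]
    rw [← realize_fund σ, subdivHtpy_realize, bd_realize, bd_realize, subdivHtpy_realize,
      subdiv_realize, tbd_tht, map_sub, map_sub]
  exact congrArg (fun φ => φ c) this

/-! ### Chains subordinate to an open cover by two sets -/

/-- The chains that are combinations of simplices contained in `A` or in `B`. -/
def smallChains (A B : Set X) (n : ℕ) : Submodule ℤ ((Chains X).X n) :=
  Submodule.span ℤ {c | ∃ s : C(stdSimplex ℝ (Fin (n + 1)), X),
    c = sx s ∧ ((∀ p, s p ∈ A) ∨ ∀ p, s p ∈ B)}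

lemma realize_mem_smallChains {A B : Set X} {m : ℕ} {σ : C(stdSimplex ℝ (Fin (m + 1)), X)}
    (h : (∀ p, σ p ∈ A) ∨ ∀ p, σ p ∈ B) (n : ℕ) (c) : realize σ n c ∈ smallChains A B n := by
  change c ∈ (smallChains A B n).comap (realize σ n)
  induction c using Finsupp.induction_linear with
  | zero => exact Submodule.zero_mem _
  | add f g hf hg => exact Submodule.add_mem _ hf hg
  | single w a =>
    rw [← mul_one a, ← smul_eq_mul, ← Finsupp.smul_single]
    refine Submodule.smul_mem _ _ ?_
    rw [Submodule.mem_comap, realize_single]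
    exact Submodule.subset_span ⟨_, rfl, h.imp (fun h p => h _) fun h p => h _⟩

lemma subdiv_mem_smallChains {A B : Set X} {n : ℕ} {c : (Chains X).X n}
    (hc : c ∈ smallChains A B n) : subdiv n c ∈ smallChains A B n := by
  have h2 := Submodule.mem_map_of_mem (f := subdiv n) hc
  refine (?_ : Submodule.map (subdiv n) _ ≤ _) h2
  rw [smallChains, Submodule.map_span, Submodule.span_le]
  rintro _ ⟨_, ⟨v, rfl, hv⟩, rfl⟩
  rw [subdiv, chainLift_sx]
  exact realize_mem_smallChains hv _ _

lemma subdivHtpy_mem_smallChains {A B : Set X} {n : ℕ} {c : (Chains X).X n}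
    (hc : c ∈ smallChains A B n) : subdivHtpy n c ∈ smallChains A B (n + 1) := by
  have h2 := Submodule.mem_map_of_mem (f := subdivHtpy n) hc
  refine (?_ : Submodule.map (subdivHtpy n) _ ≤ _) h2
  rw [smallChains, Submodule.map_span, Submodule.span_le]
  rintro _ ⟨_, ⟨v, rfl, hv⟩, rfl⟩
  rw [subdivHtpy, chainLift_sx]
  exact realize_mem_smallChains hv _ _

lemma subdiv_iterate_sx {n : ℕ} (σ : C(stdSimplex ℝ (Fin (n + 1)), X)) (N : ℕ) :
    (subdiv n)^[N] (sx σ) = realize σ n ((tsd (affBary n) (n + 1))^[N] (fund n)) := by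
  induction N with
  | zero => exact (realize_fund σ).symm
  | succ N ih => rw [Function.iterate_succ_apply', Function.iterate_succ_apply', ih, subdiv_realize]

lemma exists_subdiv_iterate_sx_mem {A B : Set X} (hA : IsOpen A) (hB : IsOpen B)
    (hAB : A ∪ B = Set.univ) {n : ℕ} (σ : C(stdSimplex ℝ (Fin (n + 1)), X)) :
    ∃ N, (subdiv n)^[N] (sx σ) ∈ smallChains A B n := by
  -- A Lebesgue number for the cover of the simplex by the preimages of `A` (index `true`) and `B`
  -- (index `false`).
  obtain ⟨ε, hε, hleb⟩ := lebesgue_number_lemma_of_metric (s := (Set.univ : Set (stdSimplex ℝ (Fin (n + 1)))))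
    (c := fun i : Bool => σ ⁻¹' (bif i then A else B)) isCompact_univ
    (fun i => by cases i <;> [exact hB.preimage σ.continuous; exact hA.preimage σ.continuous])
    (fun p _ => by
      have : σ p ∈ A ∪ B := hAB ▸ Set.mem_univ _
      rw [Set.mem_iUnion]
      exact this.elim (fun h => ⟨true, h⟩) fun h => ⟨false, h⟩)
  obtain ⟨D, hD⟩ := Metric.isBounded_iff.mp
    (isCompact_univ (X := stdSimplex ℝ (Fin (n + 1)))).isBounded
  have hc1 : (n : ℝ) / (n + 1) < 1 := by rw [div_lt_one (by positivity)]; linarith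
  have hlim : Filter.Tendsto (fun N => ((n : ℝ) / (n + 1)) ^ N * |D|) Filter.atTop (nhds 0) := by
    simpa using (tendsto_pow_atTop_nhds_zero_of_lt_one (by positivity) hc1).mul_const |D|
  obtain ⟨N, hN⟩ := (hlim.eventually (gt_mem_nhds hε)).exists
  refine ⟨N, ?_⟩
  rw [subdiv_iterate_sx]
  -- The absolute value supplies the nonnegative diameter bound that the iteration requires.
  have hf : fund n ∈ tsmall _ (n + 1) |D| := Submodule.subset_span
    ⟨vert n, rfl, fun i j => (hD (Set.mem_univ _) (Set.mem_univ _)).trans (le_abs_self D)⟩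
  have h := tsd_iterate_mem_tsmall (affBary_contracting n) n (abs_nonneg D) hf N
  have h2 := Submodule.mem_map_of_mem (f := realize σ n) h
  refine (?_ : Submodule.map (realize σ n) _ ≤ _) h2
  rw [tsmall, Submodule.map_span, Submodule.span_le]
  rintro _ ⟨_, ⟨v, rfl, hv⟩, rfl⟩
  rw [realize_single]
  obtain ⟨i, hi⟩ := hleb (v 0) (Set.mem_univ _)
  refine Submodule.subset_span ⟨_, rfl, ?_⟩
  have hb : ∀ p, aff v p ∈ Metric.ball (v 0) ε := fun p =>
    lt_of_le_of_lt (dist_aff_le v (v 0) _ (fun j => hv j 0) p) hN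
  cases i
  · exact Or.inr fun p => hi (hb p)
  · exact Or.inl fun p => hi (hb p)

lemma subdiv_iterate_mem_of_le {A B : Set X} {n : ℕ} {c : (Chains X).X n} {N N' : ℕ} (h : N ≤ N')
    (hc : (subdiv n)^[N] c ∈ smallChains A B n) : (subdiv n)^[N'] c ∈ smallChains A B n := by
  induction N', h using Nat.le_induction with
  | base => exact hc
  | succ k _ ih => rw [Function.iterate_succ_apply']; exact subdiv_mem_smallChains ih

lemma exists_subdiv_iterate_mem {A B : Set X} (hA : IsOpen A) (hB : IsOpen B)
    (hAB : A ∪ B = Set.univ) {n : ℕ} (c : (Chains X).X n) :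
    ∃ N, (subdiv n)^[N] c ∈ smallChains A B n := by
  have hc : c ∈ Submodule.span ℤ (Set.range (sx (X := X) (n := n))) := span_sx (X := X) n ▸ trivial
  have hlin : ∀ N, (subdiv (X := X) n)^[N] = ⇑((subdiv (X := X) n) ^ N) := fun N =>
    (Module.End.coe_pow _ N).symm
  induction hc using Submodule.span_induction with
  | mem _ h =>
    obtain ⟨s, rfl⟩ := h
    exact exists_subdiv_iterate_sx_mem hA hB hAB s
  | zero => exact ⟨0, Submodule.zero_mem _⟩
  | add x y _ _ hx hy =>
    obtain ⟨N, hx⟩ := hx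
    obtain ⟨N', hy⟩ := hy
    refine ⟨max N N', ?_⟩
    have h1 := subdiv_iterate_mem_of_le (le_max_left N N') hx
    have h2 := subdiv_iterate_mem_of_le (le_max_right N N') hy
    rw [hlin] at h1 h2 ⊢
    rw [map_add]
    exact Submodule.add_mem _ h1 h2
  | smul a x _ hx =>
    obtain ⟨N, hx⟩ := hx
    refine ⟨N, ?_⟩
    rw [hlin] at hx ⊢
    exact (LinearMap.map_smul (subdiv n ^ N) a x).symm ▸ Submodule.smul_mem _ a hx

/-- A chain with small boundary differs by a boundary from a small chain. -/
theorem exists_sub_bd_mem_smallChains {A B : Set X} (hA : IsOpen A) (hB : IsOpen B)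
    (hAB : A ∪ B = Set.univ) {n : ℕ} (c : (Chains X).X (n + 1))
    (hc : bd n c ∈ smallChains A B n) :
    ∃ e, c - bd (n + 1) e ∈ smallChains A B (n + 1) := by
  -- Induction on the number of subdivisions needed: `c` and its subdivision differ by `∂T c + T∂c`,
  -- and `T∂c` is small because `∂c` is.
  obtain ⟨N, hN⟩ := exists_subdiv_iterate_mem hA hB hAB c
  induction N generalizing c with
  | zero => exact ⟨0, by simpa using hN⟩
  | succ N ih =>
    obtain ⟨e, he⟩ := ih (subdiv (n + 1) c) (by rw [bd_subdiv]; exact subdiv_mem_smallChains hc) hN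
    refine ⟨e + subdivHtpy (n + 1) c, ?_⟩
    have : c - bd (n + 1) (e + subdivHtpy (n + 1) c) =
        (subdiv (n + 1) c - bd (n + 1) e) + subdivHtpy n (bd n c) := by
      rw [map_add, bd_subdivHtpy]; abel
    rw [this]
    exact Submodule.add_mem _ he (subdivHtpy_mem_smallChains hc)

end

/-! ### Homology classes of cycles -/

section

variable (K : ChainComplex (ModuleCat.{0} ℤ) ℕ)

/-- A cycle as an element of the module of cycles. -/
def cyc {n : ℕ} (z : K.X (n + 1)) (hz : (K.d (n + 1) n).hom z = 0) : K.cycles (n + 1) :=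
  (K.liftCycles (ModuleCat.ofHom (LinearMap.toSpanSingleton ℤ (K.X (n + 1)) z) : Zc ⟶ _) n (by simp)
    (by
      ext
      change (K.d (n + 1) n).hom (LinearMap.toSpanSingleton ℤ (K.X (n + 1)) z (1 : ℤ)) = 0
      rw [LinearMap.toSpanSingleton_apply_one, hz])).hom (1 : ℤ)

lemma iCycles_cyc {n : ℕ} (z : K.X (n + 1)) (hz : (K.d (n + 1) n).hom z = 0) :
    (K.iCycles (n + 1)).hom (cyc K z hz) = z := by
  have h := K.liftCycles_i (ModuleCat.ofHom (LinearMap.toSpanSingleton ℤ (K.X (n + 1)) z) : Zc ⟶ _) n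
    (by simp) (by
      ext
      change (K.d (n + 1) n).hom (LinearMap.toSpanSingleton ℤ (K.X (n + 1)) z (1 : ℤ)) = 0
      rw [LinearMap.toSpanSingleton_apply_one, hz])
  refine (congrArg (fun φ => φ.hom (1 : ℤ)) h).trans ?_
  exact LinearMap.toSpanSingleton_apply_one ℤ _ z

lemma iCycles_injective (n : ℕ) : Function.Injective (K.iCycles n).hom :=
  (ModuleCat.mono_iff_injective _).mp inferInstance

/-- The homology class of a cycle. -/
def hcls {n : ℕ} (z : K.X (n + 1)) (hz : (K.d (n + 1) n).hom z = 0) : K.homology (n + 1) :=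
  (K.homologyπ (n + 1)).hom (cyc K z hz)

lemma exists_hcls {n : ℕ} (x : K.homology (n + 1)) : ∃ z hz, x = hcls K (n := n) z hz := by
  obtain ⟨k, rfl⟩ := (ModuleCat.epi_iff_surjective (K.homologyπ (n + 1))).mp inferInstance x
  have hz : (K.d (n + 1) n).hom ((K.iCycles (n + 1)).hom k) = 0 :=
    congrArg (fun φ => φ.hom k) (K.iCycles_d (n + 1) n)
  refine ⟨_, hz, ?_⟩
  rw [hcls]
  congr 1
  exact iCycles_injective K _ (iCycles_cyc K _ hz).symm

lemma hcls_congr {n : ℕ} {z z' : K.X (n + 1)} (h : z = z') (hz : (K.d (n + 1) n).hom z = 0) :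
    hcls K z hz = hcls K z' (h ▸ hz) := by subst h; rfl

lemma hcls_add {n : ℕ} (z z' : K.X (n + 1)) (hz : (K.d (n + 1) n).hom z = 0)
    (hz' : (K.d (n + 1) n).hom z' = 0) :
    hcls K (z + z') (by rw [map_add, hz, hz', add_zero]) = hcls K z hz + hcls K z' hz' := by
  refine Eq.trans ?_ (map_add (K.homologyπ (n + 1)).hom _ _)
  rw [hcls]
  congr 1
  apply iCycles_injective
  refine (iCycles_cyc K _ _).trans (Eq.trans ?_ (map_add (K.iCycles (n + 1)).hom _ _).symm)
  rw [iCycles_cyc, iCycles_cyc]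

lemma hcls_sub {n : ℕ} (z z' : K.X (n + 1)) (hz : (K.d (n + 1) n).hom z = 0)
    (hz' : (K.d (n + 1) n).hom z' = 0) :
    hcls K (z - z') (by rw [map_sub, hz, hz', sub_zero]) = hcls K z hz - hcls K z' hz' := by
  refine Eq.trans ?_ (map_sub (K.homologyπ (n + 1)).hom _ _)
  rw [hcls]
  congr 1
  apply iCycles_injective
  refine (iCycles_cyc K _ _).trans (Eq.trans ?_ (map_sub (K.iCycles (n + 1)).hom _ _).symm)
  rw [iCycles_cyc, iCycles_cyc]

lemma hcls_eq_zero_iff {n : ℕ} (z : K.X (n + 1)) (hz : (K.d (n + 1) n).hom z = 0) :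
    hcls K z hz = 0 ↔ ∃ w, (K.d (n + 2) (n + 1)).hom w = z := by
  have hex : (ShortComplex.mk (K.toCycles (n + 2) (n + 1)) (K.homologyπ (n + 1))
      (K.toCycles_comp_homologyπ _ _)).Exact :=
    ShortComplex.exact_of_g_is_cokernel _ (K.homologyIsCokernel (n + 2) (n + 1) (by simp))
  rw [ShortComplex.moduleCat_exact_iff] at hex
  have hi : ∀ w, (K.iCycles (n + 1)).hom ((K.toCycles (n + 2) (n + 1)).hom w) =
      (K.d (n + 2) (n + 1)).hom w := fun w =>
    congrArg (fun φ => φ.hom w) (K.toCycles_i (n + 2) (n + 1))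
  constructor
  · intro h
    obtain ⟨w, hw⟩ := hex _ h
    exact ⟨w, by rw [← hi, ← iCycles_cyc K z hz]; exact congrArg _ hw⟩
  · rintro ⟨w, rfl⟩
    have : cyc K _ hz = (K.toCycles (n + 2) (n + 1)).hom w :=
      iCycles_injective K _ (by rw [iCycles_cyc, hi])
    rw [hcls, this]
    exact congrArg (fun φ => φ.hom w) (K.toCycles_comp_homologyπ (n + 2) (n + 1))

lemma hcls_eq_iff {n : ℕ} {z z' : K.X (n + 1)} (hz : (K.d (n + 1) n).hom z = 0)
    (hz' : (K.d (n + 1) n).hom z' = 0) :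
    hcls K z hz = hcls K z' hz' ↔ ∃ w, (K.d (n + 2) (n + 1)).hom w = z - z' := by
  rw [← sub_eq_zero, ← hcls_sub, hcls_eq_zero_iff]

variable {K}

lemma homologyMap_hcls {K' : ChainComplex (ModuleCat.{0} ℤ) ℕ} (f : K ⟶ K') {n : ℕ}
    (z : K.X (n + 1)) (hz : (K.d (n + 1) n).hom z = 0) :
    (HomologicalComplex.homologyMap f (n + 1)).hom (hcls K z hz) =
      hcls K' ((f.f (n + 1)).hom z) (by
        have := congrArg (fun φ => φ.hom z) (f.comm (n + 1) n)
        refine Eq.trans this ?_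
        change (f.f n).hom ((K.d (n + 1) n).hom z) = 0
        rw [hz, map_zero]) := by
  have h := congrArg (fun φ => φ.hom (cyc K z hz)) (HomologicalComplex.homologyπ_naturality f (n + 1))
  refine h.trans ?_
  change (K'.homologyπ (n + 1)).hom ((HomologicalComplex.cyclesMap f (n + 1)).hom (cyc K z hz)) = _
  rw [hcls]
  congr 1
  apply iCycles_injective
  rw [iCycles_cyc]
  refine (congrArg (fun φ => φ.hom (cyc K z hz)) (HomologicalComplex.cyclesMap_i f (n + 1))).trans ?_
  exact congrArg (f.f (n + 1)).hom (iCycles_cyc K z hz)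

lemma classOf_eq_hcls (φ : Zc ⟶ K.X 2) (h : φ ≫ K.d 2 1 = 0) :
    classOf K φ h = hcls K (n := 1) (φ.hom (1 : ℤ)) (congrArg (fun φ => φ.hom (1 : ℤ)) h) := by
  rw [hcls, classOf]
  change (K.homologyπ 2).hom ((K.liftCycles φ 1 _ h).hom (1 : ℤ)) = _
  congr 1
  apply iCycles_injective
  rw [iCycles_cyc]
  exact congrArg (fun φ => φ.hom (1 : ℤ)) (K.liftCycles_i φ 1 (by simp) h)

end

/-! ### Homology of pairs -/

section

variable {X Y Z : Type} [TopologicalSpace X] [TopologicalSpace Y] [TopologicalSpace Z]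

/-- The quotient map from chains to relative chains. -/
def relMk (A : Set X) (n : ℕ) : (Chains X).X n →ₗ[ℤ] (RelChains A).X n :=
  ((cokernel.π (chainsMap (incl A))).f n).hom

lemma relMk_surjective (A : Set X) (n : ℕ) : Function.Surjective (relMk A n) :=
  (ModuleCat.epi_iff_surjective _).mp inferInstance

lemma pair_exact (A : Set X) (n : ℕ) :
    ((ShortComplex.mk (chainsMap (incl A)) (cokernel.π (chainsMap (incl A)))
      (cokernel.condition _)).map (HomologicalComplex.eval _ _ n)).Exact :=
  ((pair_shortExact A).map_of_exact (HomologicalComplex.eval _ _ n)).exact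

lemma relMk_eq_zero_iff (A : Set X) {n : ℕ} (c : (Chains X).X n) :
    relMk A n c = 0 ↔ ∃ a, chainPush (incl A) n a = c := by
  constructor
  · exact fun h => (ShortComplex.moduleCat_exact_iff _).mp (pair_exact A n) c h
  · rintro ⟨a, rfl⟩
    exact congrArg (fun φ => (φ.f n).hom a) (cokernel.condition (chainsMap (incl A)))

lemma d_relMk (A : Set X) {n : ℕ} (c : (Chains X).X (n + 1)) :
    ((RelChains A).d (n + 1) n).hom (relMk A (n + 1) c) = relMk A n (bd n c) :=
  congrArg (fun φ => φ.hom c) ((cokernel.π (chainsMap (incl A))).comm (n + 1) n)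

/-- The class of a relative cycle. -/
def relCls (A : Set X) {n : ℕ} (c : (Chains X).X (n + 1))
    (hc : ∃ a, chainPush (incl A) n a = bd n c) : RelH (n + 1) A :=
  hcls (RelChains A) (relMk A (n + 1) c) (by rw [d_relMk, relMk_eq_zero_iff]; exact hc)

/-- The class of a cycle. -/
def absCls {n : ℕ} (c : (Chains X).X (n + 1)) (hc : bd n c = 0) : SingH (n + 1) X :=
  hcls (Chains X) c hc

lemma exists_relCls (A : Set X) {n : ℕ} (x : RelH (n + 1) A) : ∃ c hc, x = relCls A (n := n) c hc := by
  obtain ⟨z, hz, rfl⟩ := exists_hcls _ x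
  obtain ⟨c, rfl⟩ := relMk_surjective A _ z
  exact ⟨c, by rwa [d_relMk, relMk_eq_zero_iff] at hz, rfl⟩

lemma exists_absCls {n : ℕ} (x : SingH (n + 1) X) : ∃ c hc, x = absCls (n := n) c hc :=
  exists_hcls (Chains X) x

lemma relCls_eq_zero_iff (A : Set X) {n : ℕ} (c : (Chains X).X (n + 1)) (hc) :
    relCls A c hc = 0 ↔ ∃ e a, c = bd (n + 1) e + chainPush (incl A) (n + 1) a := by
  rw [relCls, hcls_eq_zero_iff]
  constructor
  · rintro ⟨w, hw⟩
    obtain ⟨e, rfl⟩ := relMk_surjective A _ w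
    rw [d_relMk] at hw
    obtain ⟨a, ha⟩ := (relMk_eq_zero_iff A (c - bd (n + 1) e)).mp (by rw [map_sub, hw, sub_self])
    exact ⟨e, a, by rw [ha]; abel⟩
  · rintro ⟨e, a, rfl⟩
    refine ⟨relMk A _ e, ?_⟩
    rw [d_relMk, map_add, (relMk_eq_zero_iff A (chainPush (incl A) (n + 1) a)).mpr ⟨a, rfl⟩, add_zero]

lemma absCls_eq_zero_iff {n : ℕ} (c : (Chains X).X (n + 1)) (hc) :
    absCls c hc = 0 ↔ ∃ e, bd (n + 1) e = c := hcls_eq_zero_iff (Chains X) c hc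

lemma pushH_absCls (f : C(X, Y)) {n : ℕ} (c : (Chains X).X (n + 1)) (hc) :
    pushH (n + 1) f (absCls c hc) =
      absCls (chainPush f (n + 1) c) (by rw [bd_chainPush, hc, map_zero]) :=
  homologyMap_hcls (chainsMap f) c hc

lemma relChainsMap_relMk (f : C(X, Y)) {A : Set X} {B : Set Y} (h : Set.MapsTo f A B) {n : ℕ}
    (c : (Chains X).X n) :
    ((relChainsMap f h).f n).hom (relMk A n c) = relMk B n (chainPush f n c) := by
  have h' : cokernel.π (chainsMap (incl A)) ≫ relChainsMap f h =
      chainsMap f ≫ cokernel.π (chainsMap (incl B)) := cokernel.π_desc _ _ _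
  exact congrArg (fun φ => (φ.f n).hom c) h'

lemma chainPush_restr (f : C(X, Y)) {A : Set X} {B : Set Y} (h : Set.MapsTo f A B) {n : ℕ} (a) :
    chainPush (incl B) n (chainPush (restr f h) n a) = chainPush f n (chainPush (incl A) n a) := by
  rw [chainPush_comp, chainPush_comp]
  rfl

lemma pushRel_relCls (f : C(X, Y)) {A : Set X} {B : Set Y} (h : Set.MapsTo f A B) {n : ℕ}
    (c : (Chains X).X (n + 1)) (hc) :
    pushRel (n + 1) f h (relCls A c hc) = relCls B (chainPush f (n + 1) c) (by
      obtain ⟨a, ha⟩ := hc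
      exact ⟨chainPush (restr f h) n a, by rw [chainPush_restr, ha, bd_chainPush]⟩) := by
  refine (homologyMap_hcls (relChainsMap f h) _ _).trans ?_
  exact hcls_congr _ (relChainsMap_relMk f h c) _

lemma toRel_absCls (A : Set X) {n : ℕ} (c : (Chains X).X (n + 1)) (hc) :
    toRel (n + 1) A (absCls c hc) = relCls A c ⟨0, by rw [map_zero, hc]⟩ :=
  homologyMap_hcls (cokernel.π (chainsMap (incl A))) c hc

lemma pushH_comp (n : ℕ) (g : C(Y, Z)) (f : C(X, Y)) (x : SingH n X) :
    pushH n g (pushH n f x) = pushH n (g.comp f) x :=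
  (congrArg (fun φ => φ.hom x) (((AlgebraicTopology.singularHomologyFunctor (ModuleCat.{0} ℤ) n).obj Zc).map_comp
    (TopCat.ofHom f) (TopCat.ofHom g))).symm

lemma pushH_id (n : ℕ) (x : SingH n X) : pushH n (ContinuousMap.id X) x = x :=
  congrArg (fun φ => φ.hom x) (((AlgebraicTopology.singularHomologyFunctor (ModuleCat.{0} ℤ) n).obj Zc).map_id
    (TopCat.of X))

lemma relChainsMap_comp (g : C(Y, Z)) (f : C(X, Y)) {A : Set X} {B : Set Y} {C : Set Z}
    (hg : Set.MapsTo g B C) (hf : Set.MapsTo f A B) :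
    relChainsMap f hf ≫ relChainsMap g hg = relChainsMap (g.comp f) (hg.comp hf) := by
  rw [← cancel_epi (cokernel.π (chainsMap (incl A)))]
  have h1 : cokernel.π (chainsMap (incl A)) ≫ relChainsMap f hf =
      chainsMap f ≫ cokernel.π (chainsMap (incl B)) := cokernel.π_desc _ _ _
  have h2 : cokernel.π (chainsMap (incl B)) ≫ relChainsMap g hg =
      chainsMap g ≫ cokernel.π (chainsMap (incl C)) := cokernel.π_desc _ _ _
  have h3 : cokernel.π (chainsMap (incl A)) ≫ relChainsMap (g.comp f) (hg.comp hf) =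
      chainsMap (g.comp f) ≫ cokernel.π (chainsMap (incl C)) := cokernel.π_desc _ _ _
  rw [reassoc_of% h1, h2, h3, ← Category.assoc]
  congr 1
  exact (((AlgebraicTopology.singularChainComplexFunctor (ModuleCat.{0} ℤ)).obj Zc).map_comp
    (TopCat.ofHom f) (TopCat.ofHom g)).symm

lemma pushRel_comp (n : ℕ) (g : C(Y, Z)) (f : C(X, Y)) {A : Set X} {B : Set Y} {C : Set Z}
    (hg : Set.MapsTo g B C) (hf : Set.MapsTo f A B) (x : RelH n A) :
    pushRel n g hg (pushRel n f hf x) = pushRel n (g.comp f) (hg.comp hf) x := by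
  have h := HomologicalComplex.homologyMap_comp (relChainsMap f hf) (relChainsMap g hg) n
  rw [relChainsMap_comp] at h
  exact (congrArg (fun φ => φ.hom x) h).symm

lemma pushRel_id (n : ℕ) (A : Set X) (h : Set.MapsTo (ContinuousMap.id X) A A) (x : RelH n A) :
    pushRel n (ContinuousMap.id X) h x = x := by
  have h1 : relChainsMap (ContinuousMap.id X) h = 𝟙 (RelChains A) := by
    rw [← cancel_epi (cokernel.π (chainsMap (incl A)))]
    have h1 : cokernel.π (chainsMap (incl A)) ≫ relChainsMap (ContinuousMap.id X) h =
      chainsMap (ContinuousMap.id X) ≫ cokernel.π (chainsMap (incl A)) := cokernel.π_desc _ _ _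
    rw [h1]
    have h2 : chainsMap (ContinuousMap.id X) = 𝟙 _ :=
      ((AlgebraicTopology.singularChainComplexFunctor (ModuleCat.{0} ℤ)).obj Zc).map_id (TopCat.of X)
    rw [h2, Category.id_comp, Category.comp_id]
  rw [pushRel, h1, HomologicalComplex.homologyMap_id]
  rfl

lemma toRel_natural (n : ℕ) (f : C(X, Y)) {A : Set X} {B : Set Y} (h : Set.MapsTo f A B)
    (x : SingH n X) : pushRel n f h (toRel n A x) = toRel n B (pushH n f x) := by
  have h1 : cokernel.π (chainsMap (incl A)) ≫ relChainsMap f h =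
      chainsMap f ≫ cokernel.π (chainsMap (incl B)) := cokernel.π_desc _ _ _
  have h2 := congrArg (fun φ => HomologicalComplex.homologyMap φ n) h1
  simp only [HomologicalComplex.homologyMap_comp] at h2
  exact congrArg (fun φ => φ.hom x) h2

lemma bdry_natural (n : ℕ) (f : C(X, Y)) {A : Set X} {B : Set Y} (h : Set.MapsTo f A B)
    (x : RelH (n + 1) A) : bdry n B (pushRel (n + 1) f h x) = pushH n (restr f h) (bdry n A x) := by
  let φ : ShortComplex.mk (chainsMap (incl A)) (cokernel.π (chainsMap (incl A)))
      (cokernel.condition _) ⟶ ShortComplex.mk (chainsMap (incl B))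
      (cokernel.π (chainsMap (incl B))) (cokernel.condition _) :=
    { τ₁ := chainsMap (restr f h)
      τ₂ := chainsMap f
      τ₃ := relChainsMap f h
      comm₁₂ := by
        change chainsMap (restr f h) ≫ chainsMap (incl B) = chainsMap (incl A) ≫ chainsMap f
        rw [← Functor.map_comp, ← Functor.map_comp]
        rfl
      comm₂₃ := (cokernel.π_desc _ _ _ : cokernel.π (chainsMap (incl A)) ≫ relChainsMap f h = _).symm }
  have := HomologicalComplex.HomologySequence.δ_naturality φ (pair_shortExact A) (pair_shortExact B)
    (n + 1) n (by simp)
  exact (congrArg (fun φ => φ.hom x) this).symm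

lemma exact_toRel (n : ℕ) (A : Set X) (x : SingH n X) :
    toRel n A x = 0 ↔ ∃ a, pushH n (incl A) a = x := by
  have h := (pair_shortExact A).homology_exact₂ n
  constructor
  · exact fun hx => (ShortComplex.moduleCat_exact_iff _).mp h x hx
  · rintro ⟨a, rfl⟩
    have h2 := congrArg (fun φ => HomologicalComplex.homologyMap φ n)
      (cokernel.condition (chainsMap (incl A)))
    simp only [HomologicalComplex.homologyMap_comp, HomologicalComplex.homologyMap_zero] at h2
    exact congrArg (fun φ => φ.hom a) h2

lemma exact_bdry (n : ℕ) (A : Set X) (x : RelH (n + 1) A) :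
    bdry n A x = 0 ↔ ∃ y, toRel (n + 1) A y = x := by
  have h := (pair_shortExact A).homology_exact₃ (n + 1) n (by simp)
  constructor
  · exact fun hx => (ShortComplex.moduleCat_exact_iff _).mp h x hx
  · rintro ⟨a, rfl⟩
    exact congrArg (fun φ => φ.hom a) ((pair_shortExact A).comp_δ (n + 1) n (by simp))

lemma exact_incl (n : ℕ) (A : Set X) (x : SingH n A) :
    pushH n (incl A) x = 0 ↔ ∃ y, bdry n A y = x := by
  have h := (pair_shortExact A).homology_exact₁ (n + 1) n (by simp)
  constructor
  · exact fun hx => (ShortComplex.moduleCat_exact_iff _).mp h x hx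
  · rintro ⟨a, rfl⟩
    exact congrArg (fun φ => φ.hom a) ((pair_shortExact A).δ_comp (n + 1) n (by simp))

/-! ### Homotopy invariance -/

lemma pushH_homotopic (n : ℕ) {f g : C(X, Y)} (h : f.Homotopic g) : pushH n f = pushH n g := by
  obtain ⟨H⟩ := h
  let H' : TopCat.Homotopy (TopCat.ofHom f) (TopCat.ofHom g) := H
  exact congrArg ModuleCat.Hom.hom (H'.congr_homologyMap_singularChainComplexFunctor Zc n)

lemma pushH_id_of_homotopic (n : ℕ) {f : C(X, X)} (h : f.Homotopic (ContinuousMap.id X))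
    (x : SingH n X) : pushH n f x = x := by
  rw [pushH_homotopic n h, pushH_id]

/-- A continuous family of maps parametrized by the unit interval gives a homotopy. -/
lemma homotopic_of_family {f g : C(X, Y)} (H : C(unitInterval × X, Y)) (h0 : ∀ x, H (0, x) = f x)
    (h1 : ∀ x, H (1, x) = g x) : f.Homotopic g :=
  ⟨{ toContinuousMap := H, map_zero_left := h0, map_one_left := h1 }⟩

lemma quasiIso_chainsMap {f : C(X, Y)} {g : C(Y, X)} (h : (f.comp g).Homotopic (ContinuousMap.id Y))
    (h' : (g.comp f).Homotopic (ContinuousMap.id X)) : QuasiIso (chainsMap f) := by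
  refine ⟨fun n => ?_⟩
  rw [quasiIsoAt_iff_isIso_homologyMap]
  refine ⟨HomologicalComplex.homologyMap (chainsMap g) n, ?_, ?_⟩
  · ext x
    exact (pushH_comp n g f x).trans (pushH_id_of_homotopic n h' x)
  · ext x
    exact (pushH_comp n f g x).trans (pushH_id_of_homotopic n h x)

/-- The five lemma for the long exact sequences: quasi-isomorphisms on the space and on the subspace
force one on relative chains. -/
lemma pushRel_injective_of_equiv (n : ℕ) {f : C(X, Y)} {A : Set X} {B : Set Y}
    (h : Set.MapsTo f A B) (h1 : QuasiIso (chainsMap f)) (h2 : QuasiIso (chainsMap (restr f h))) :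
    Function.Injective (pushRel n f h) := by
  let φ : ShortComplex.mk (chainsMap (incl A)) (cokernel.π (chainsMap (incl A)))
      (cokernel.condition _) ⟶ ShortComplex.mk (chainsMap (incl B))
      (cokernel.π (chainsMap (incl B))) (cokernel.condition _) :=
    { τ₁ := chainsMap (restr f h)
      τ₂ := chainsMap f
      τ₃ := relChainsMap f h
      comm₁₂ := by
        change chainsMap (restr f h) ≫ chainsMap (incl B) = chainsMap (incl A) ≫ chainsMap f
        rw [← Functor.map_comp, ← Functor.map_comp]
        rfl
      comm₂₃ := (cokernel.π_desc _ _ _ : cokernel.π (chainsMap (incl A)) ≫ relChainsMap f h = _).symm }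
  have h3 : QuasiIso (relChainsMap f h) :=
    HomologicalComplex.HomologySequence.quasiIso_τ₃ φ (pair_shortExact A) (pair_shortExact B) h2 h1
  have h4 : QuasiIsoAt (relChainsMap f h) n := h3.quasiIsoAt n
  rw [quasiIsoAt_iff_isIso_homologyMap] at h4
  exact (ModuleCat.mono_iff_injective _).mp inferInstance

/-- The inclusion at height `s` of the cylinder. -/
def cylIncl (X : Type) [TopologicalSpace X] (s : unitInterval) : C(X, unitInterval × X) :=
  ⟨fun x => (s, x), by fun_prop⟩

/-- Homotopy invariance of the homology of pairs. -/
theorem pushRel_homotopic (n : ℕ) {f g : C(X, Y)} {A : Set X} {B : Set Y} (hf : Set.MapsTo f A B)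
    (hg : Set.MapsTo g A B) (H : C(unitInterval × X, Y)) (h0 : ∀ x, H (0, x) = f x)
    (h1 : ∀ x, H (1, x) = g x) (hA : ∀ s, ∀ x ∈ A, H (s, x) ∈ B) :
    pushRel n f hf = pushRel n g hg := by
  let A' : Set (unitInterval × X) := {p | p.2 ∈ A}
  let p : C(unitInterval × X, X) := ContinuousMap.snd
  have hp : Set.MapsTo p A' A := fun _ h => h
  have hi : ∀ s, Set.MapsTo (cylIncl X s) A A' := fun _ _ h => h
  -- The cylinder, and the cylinder on `A`, contract to height `0` by multiplying the height.
  have q1 : QuasiIso (chainsMap p) := by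
    refine quasiIso_chainsMap (g := cylIncl X 0) (ContinuousMap.Homotopic.refl _) ?_
    exact homotopic_of_family ⟨fun q : unitInterval × unitInterval × X => (q.1 * q.2.1, q.2.2), by fun_prop⟩
      (fun x => by simp [cylIncl, p]) (fun x => by simp)
  have q2 : QuasiIso (chainsMap (restr p hp)) := by
    refine quasiIso_chainsMap (g := restr (cylIncl X 0) (hi 0)) (ContinuousMap.Homotopic.refl _) ?_
    exact homotopic_of_family ⟨fun q : unitInterval × A' => ⟨(q.1 * q.2.1.1, q.2.1.2), q.2.2⟩, by fun_prop⟩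
      (fun x => by simp [cylIncl, p, restr]) (fun x => by simp)
  have hinj := pushRel_injective_of_equiv n hp q1 q2
  -- Both ends are sections of the projection, which is injective on relative homology.
  have key : ∀ x, pushRel n (cylIncl X 0) (hi 0) x = pushRel n (cylIncl X 1) (hi 1) x := fun x => by
    apply hinj
    rw [pushRel_comp, pushRel_comp]
    rfl
  have hH : Set.MapsTo H A' B := fun q hq => hA q.1 q.2 hq
  have e0 : H.comp (cylIncl X 0) = f := ContinuousMap.ext h0
  have e1 : H.comp (cylIncl X 1) = g := ContinuousMap.ext h1
  subst e0 e1
  ext x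
  have := congrArg (pushRel n H hH) (key x)
  rwa [pushRel_comp, pushRel_comp] at this

/-! ### Excision -/

lemma mem_range_chainPush_incl {A : Set X} {n : ℕ} {s : C(stdSimplex ℝ (Fin (n + 1)), X)}
    (h : ∀ p, s p ∈ A) : ∃ a, chainPush (incl A) n a = sx s :=
  ⟨sx ⟨fun p => ⟨s p, h p⟩, by fun_prop⟩, by rw [chainPush_sx]; rfl⟩

lemma chainPush_mem_smallChains_left (A B : Set X) {n : ℕ} (a) :
    chainPush (incl A) n a ∈ smallChains A B n := by
  have ha : a ∈ Submodule.span ℤ (Set.range (sx (X := A) (n := n))) := span_sx (X := A) n ▸ trivial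
  have h2 := Submodule.mem_map_of_mem (f := chainPush (incl A) n) ha
  refine (?_ : Submodule.map (chainPush (incl A) n) _ ≤ _) h2
  rw [Submodule.map_span, Submodule.span_le]
  rintro _ ⟨_, ⟨s, rfl⟩, rfl⟩
  rw [chainPush_sx]
  exact Submodule.subset_span ⟨_, rfl, Or.inl fun p => (s p).2⟩

lemma smallChains_comm (A B : Set X) (n : ℕ) : smallChains A B n = smallChains B A n := by
  simp only [smallChains, or_comm]

lemma exists_add_of_mem_smallChains {A B : Set X} {n : ℕ} {c : (Chains X).X n}
    (h : c ∈ smallChains A B n) :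
    ∃ a b, c = chainPush (incl A) n a + chainPush (incl B) n b := by
  have hle : smallChains A B n ≤
      LinearMap.range (chainPush (incl A) n) ⊔ LinearMap.range (chainPush (incl B) n) := by
    rw [smallChains, Submodule.span_le]
    rintro _ ⟨s, rfl, hs | hs⟩
    · exact Submodule.mem_sup_left (mem_range_chainPush_incl hs)
    · exact Submodule.mem_sup_right (mem_range_chainPush_incl hs)
  obtain ⟨_, ⟨a, rfl⟩, _, ⟨b, rfl⟩, hab⟩ := Submodule.mem_sup.mp (hle h)
  exact ⟨a, b, hab.symm⟩

open Classical in
/-- The projection of chains onto those contained in `A`. -/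
def chainProj (A : Set X) (n : ℕ) : (Chains X).X n →ₗ[ℤ] (Chains X).X n :=
  chainLift fun s => if ∀ p, s p ∈ A then sx s else 0

lemma chainProj_chainPush (A : Set X) {n : ℕ} (a) :
    chainProj A n (chainPush (incl A) n a) = chainPush (incl A) n a := by
  have : chainProj A n ∘ₗ chainPush (incl A) n = chainPush (incl A) n := by
    refine chain_hom_ext fun s => ?_
    rw [LinearMap.comp_apply, chainPush_sx, chainProj, chainLift_sx]
    exact if_pos fun p => (s p).2
  exact congrArg (fun φ => φ a) this

/-- A chain contained in `A` and in `B` is contained in `A ∩ B`. -/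
lemma exists_of_mem_inter (A B : Set X) {n : ℕ} (a : (Chains A).X n) (b : (Chains B).X n)
    (h : chainPush (incl A) n a = chainPush (incl B) n b) :
    ∃ c : (Chains (Subtype.val ⁻¹' A : Set B)).X n, chainPush (incl _) n c = b := by
  -- Keeping only the simplices inside `A` turns a chain of `B` into a chain of `A ∩ B`; it does not
  -- change `b`, which also comes from `A`.
  have hle : ∀ b : (Chains B).X n, chainProj A n (chainPush (incl B) n b) ∈
      LinearMap.range (chainPush (incl B) n ∘ₗ chainPush (incl (Subtype.val ⁻¹' A : Set B)) n) := by
    intro b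
    have hb : b ∈ Submodule.span ℤ (Set.range (sx (X := B) (n := n))) := span_sx (X := B) n ▸ trivial
    have h2 := Submodule.mem_map_of_mem (f := chainProj A n ∘ₗ chainPush (incl B) n) hb
    refine (?_ : Submodule.map (chainProj A n ∘ₗ chainPush (incl B) n) _ ≤ _) h2
    rw [Submodule.map_span, Submodule.span_le]
    rintro _ ⟨_, ⟨s, rfl⟩, rfl⟩
    rw [LinearMap.comp_apply, chainPush_sx, chainProj, chainLift_sx]
    split_ifs with hs
    · refine ⟨sx ⟨fun p => ⟨s p, hs p⟩, by fun_prop⟩, ?_⟩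
      rw [LinearMap.comp_apply, chainPush_sx, chainPush_sx]
      rfl
    · exact Submodule.zero_mem _
  obtain ⟨c, hc⟩ := hle b
  rw [← h, chainProj_chainPush, h] at hc
  exact ⟨c, chainPush_incl_injective B n hc⟩

lemma mapsTo_incl_preimage (A B : Set X) :
    Set.MapsTo (incl B) (Subtype.val ⁻¹' A : Set B) A := fun _ h => h

/-- Excision: surjectivity of `H_{n+1}(B, A ∩ B) → H_{n+1}(X, A)`. -/
theorem excision_surjective {A B : Set X} (hA : IsOpen A) (hB : IsOpen B) (hAB : A ∪ B = Set.univ)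
    (n : ℕ) : Function.Surjective (pushRel (n + 1) (incl B) (mapsTo_incl_preimage A B)) := by
  intro x
  obtain ⟨c, ⟨a, ha⟩, rfl⟩ := exists_relCls A x
  -- The boundary of `c` lies in `A`, so modulo a boundary `c` becomes `a' + b`. Then `∂b` lies in
  -- `A` as well as in `B`, and `b` is the required relative cycle.
  obtain ⟨e, he⟩ := exists_sub_bd_mem_smallChains hA hB hAB c
    (ha ▸ chainPush_mem_smallChains_left A B a)
  obtain ⟨a', b, hab⟩ := exists_add_of_mem_smallChains he
  have h1 : chainPush (incl A) n (a - bd n a') = chainPush (incl B) n (bd n b) := by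
    have := congrArg (bd n) hab
    rw [map_sub, bd_bd, sub_zero, map_add, bd_chainPush, bd_chainPush, ← ha] at this
    rw [map_sub, this, add_sub_cancel_left]
  obtain ⟨d, hd⟩ := exists_of_mem_inter A B _ _ h1
  refine ⟨relCls _ b ⟨d, hd⟩, ?_⟩
  rw [pushRel_relCls]
  refine (hcls_eq_iff _ _ _).mpr ⟨relMk A _ (-e), ?_⟩
  rw [d_relMk, map_neg, map_neg, ← map_sub, ← sub_eq_zero, ← map_neg, ← map_sub, relMk_eq_zero_iff]
  refine ⟨a', ?_⟩
  rw [sub_eq_iff_eq_add.mp hab]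
  abel

/-- Excision: injectivity of `H_{n+1}(B, A ∩ B) → H_{n+1}(X, A)`. -/
theorem excision_injective {A B : Set X} (hA : IsOpen A) (hB : IsOpen B) (hAB : A ∪ B = Set.univ)
    (n : ℕ) : Function.Injective (pushRel (n + 1) (incl B) (mapsTo_incl_preimage A B)) := by
  rw [injective_iff_map_eq_zero]
  intro x hx
  obtain ⟨c, ⟨a, ha⟩, rfl⟩ := exists_relCls _ x
  rw [pushRel_relCls, relCls_eq_zero_iff] at hx
  obtain ⟨e, a', hea⟩ := hx
  -- From `c = ∂e + a'` the boundary of `e` is small. Writing `e` modulo a boundary as `u + v` gives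
  -- `c - ∂v = a' + ∂u`, a chain lying in both `A` and `B`.
  obtain ⟨f, hf⟩ := exists_sub_bd_mem_smallChains hA hB hAB e (by
    rw [← sub_eq_iff_eq_add.mpr hea]
    refine Submodule.sub_mem _ ?_ (chainPush_mem_smallChains_left A B a')
    rw [smallChains_comm]
    exact chainPush_mem_smallChains_left B A c)
  obtain ⟨u, v, huv⟩ := exists_add_of_mem_smallChains hf
  have h1 : chainPush (incl A) (n + 1) (a' + bd (n + 1) u) =
      chainPush (incl B) (n + 1) (c - bd (n + 1) v) := by
    have := congrArg (bd (n + 1)) huv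
    rw [map_sub, bd_bd, sub_zero, map_add, bd_chainPush, bd_chainPush] at this
    rw [map_sub, map_add, hea, this]
    abel
  obtain ⟨d, hd⟩ := exists_of_mem_inter A B _ _ h1
  rw [relCls_eq_zero_iff]
  exact ⟨v, d, by rw [hd]; abel⟩

end

section

variable {X Y Z : Type} [TopologicalSpace X] [TopologicalSpace Y] [TopologicalSpace Z]

/-! ### Null-homotopic maps -/

lemma singH_unit_eq_zero (n : ℕ) (x : SingH (n + 1) Unit) : x = 0 := by
  have h := AlgebraicTopology.isZero_singularHomologyFunctor_of_totallyDisconnectedSpace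
    (ModuleCat.{0} ℤ) (n + 1) Zc (TopCat.of Unit) (Nat.succ_ne_zero n)
  have := congrArg (fun φ => φ.hom x) (h.eq_of_src (𝟙 _) 0)
  exact this

lemma pushH_const (n : ℕ) (y : Y) (x : SingH (n + 1) X) :
    pushH (n + 1) (ContinuousMap.const X y) x = 0 := by
  have h := pushH_comp (n + 1) (ContinuousMap.const Unit y) (ContinuousMap.const X ()) x
  rw [singH_unit_eq_zero n (pushH (n + 1) (ContinuousMap.const X ()) x), map_zero] at h
  exact h.symm

lemma pushH_eq_zero_of_nullhomotopic (n : ℕ) {f : C(X, Y)} {y : Y}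
    (h : f.Homotopic (ContinuousMap.const X y)) (x : SingH (n + 1) X) : pushH (n + 1) f x = 0 := by
  rw [pushH_homotopic _ h, pushH_const]

lemma singH_eq_zero_of_contractible (n : ℕ) {y : X}
    (h : (ContinuousMap.id X).Homotopic (ContinuousMap.const X y)) (x : SingH (n + 1) X) : x = 0 := by
  rw [← pushH_id (n + 1) x, pushH_eq_zero_of_nullhomotopic n h]

lemma relH_eq_zero_of_subset (n : ℕ) {A : Set X} (h : A = Set.univ) (x : RelH (n + 1) A) : x = 0 := by
  obtain ⟨c, hc, rfl⟩ := exists_relCls A x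
  rw [relCls_eq_zero_iff]
  subst h
  have hc : c ∈ Submodule.span ℤ (Set.range (sx (X := X) (n := n + 1))) := span_sx (X := X) (n + 1) ▸ trivial
  have : Submodule.span ℤ (Set.range (sx (X := X) (n := n + 1))) ≤
      LinearMap.range (chainPush (incl (Set.univ : Set X)) (n + 1)) := by
    rw [Submodule.span_le]
    rintro _ ⟨s, rfl⟩
    exact mem_range_chainPush_incl fun _ => trivial
  obtain ⟨a, ha⟩ := this hc
  exact ⟨0, a, by rw [ha, map_zero, zero_add]⟩

/-- A map into a point of the subspace induces zero on relative homology. -/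
lemma pushRel_const (n : ℕ) {A : Set X} {B : Set Y} (y : Y)
    (h : Set.MapsTo (ContinuousMap.const X y) A B) (hy : y ∈ B) (x : RelH (n + 1) A) :
    pushRel (n + 1) (ContinuousMap.const X y) h x = 0 := by
  have hm : Set.MapsTo (ContinuousMap.const X ()) A (Set.univ : Set Unit) := fun _ _ => trivial
  have h1 := pushRel_comp (n + 1) (C := B)
    (ContinuousMap.const Unit y) (ContinuousMap.const X ()) (fun _ _ => hy) hm x
  rw [relH_eq_zero_of_subset n rfl (pushRel (n + 1) (ContinuousMap.const X ()) hm x), map_zero] at h1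
  exact h1.symm

/-! ### Paths as singular chains -/

/-- The point `x` as a singular chain. -/
def pt (x : X) : (Chains X).X 0 := sx (ContinuousMap.const _ x)

/-- The coordinate `Δ¹ → [0, 1]`. -/
def simplexCoord : C(stdSimplex ℝ (Fin 2), unitInterval) where
  toFun p := ⟨p 1, p.2.1 1, by
    have h : p 0 + p 1 = 1 := by
      have := stdSimplex.sum_eq_one p
      rwa [Fin.sum_univ_two] at this
    have h0 : 0 ≤ p 0 := p.2.1 0
    linarith⟩
  continuous_toFun := Continuous.subtype_mk ((continuous_apply 1).comp continuous_subtype_val) _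

/-- The parametrization `[0, 1] → Δ¹`. -/
def simplexLine : C(unitInterval, stdSimplex ℝ (Fin 2)) where
  toFun t := ⟨![1 - t, t], fun i => by
    fin_cases i
    · exact sub_nonneg.mpr t.2.2
    · exact t.2.1, by simp⟩
  continuous_toFun := Continuous.subtype_mk (continuous_pi fun i => by
    fin_cases i
    · exact continuous_const.sub continuous_subtype_val
    · exact continuous_subtype_val) _

lemma simplexLine_simplexCoord (p : stdSimplex ℝ (Fin 2)) : simplexLine (simplexCoord p) = p := by
  have h : p 0 + p 1 = 1 := by
    have := stdSimplex.sum_eq_one p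
    rwa [Fin.sum_univ_two] at this
  refine simplex_ext fun k => ?_
  fin_cases k
  · change 1 - p 1 = p 0
    linarith
  · rfl

/-- A path as a singular chain. -/
def ps (γ : C(unitInterval, X)) : (Chains X).X 1 := sx (γ.comp simplexCoord)

lemma sx_eq_ps (s : C(stdSimplex ℝ (Fin 2), X)) : sx s = ps (s.comp simplexLine) := by
  rw [ps]
  congr 1
  ext p
  exact congrArg s (simplexLine_simplexCoord p).symm

lemma chainPush_ps (f : C(X, Y)) (γ : C(unitInterval, X)) : chainPush f 1 (ps γ) = ps (f.comp γ) := by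
  rw [ps, chainPush_sx]
  rfl

lemma bd_ps (γ : C(unitInterval, X)) : bd 0 (ps γ) = pt (γ 1) - pt (γ 0) := by
  have hp : ∀ p : stdSimplex ℝ (Fin 1), p 0 = 1 := fun p => by
    have := stdSimplex.sum_eq_one p
    rwa [Fin.sum_univ_one] at this
  rw [ps, bd_sx, Fin.sum_univ_two]
  have h0 : (γ.comp simplexCoord).comp (face 0) = ContinuousMap.const _ (γ 1) := by
    ext p
    change γ (simplexCoord (face 0 p)) = γ 1
    congr 1
    apply Subtype.ext
    change (face 0 p) 1 = 1
    rw [face_eq_aff, aff_apply, Fin.sum_univ_one, hp, one_mul]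
    simp [vert_apply]
  have h1 : (γ.comp simplexCoord).comp (face 1) = ContinuousMap.const _ (γ 0) := by
    ext p
    change γ (simplexCoord (face 1 p)) = γ 0
    congr 1
    apply Subtype.ext
    exact face_apply_zero 1 p
  rw [h0, h1]
  simp only [Fin.val_zero, Fin.val_one, pow_zero, pow_one, one_smul]
  rw [neg_one_zsmul, sub_eq_add_neg]
  rfl

/-- The boundaries in degree one. -/
def B1 (X : Type) [TopologicalSpace X] : Submodule ℤ ((Chains X).X 1) := LinearMap.range (bd 1)

lemma chainPush_mem_B1 (f : C(X, Y)) {c : (Chains X).X 1} (h : c ∈ B1 X) :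
    chainPush f 1 c ∈ B1 Y := by
  obtain ⟨e, rfl⟩ := h
  exact ⟨chainPush f 2 e, bd_chainPush f e⟩

lemma mem_B1_of_contractible {y : X} (h : (ContinuousMap.id X).Homotopic (ContinuousMap.const X y))
    {c : (Chains X).X 1} (hc : bd 0 c = 0) : c ∈ B1 X :=
  (absCls_eq_zero_iff c hc).mp (singH_eq_zero_of_contractible 0 h _)

lemma interval_contractible :
    (ContinuousMap.id unitInterval).Homotopic (ContinuousMap.const unitInterval 0) :=
  homotopic_of_family ⟨fun q : unitInterval × unitInterval => unitInterval.symm q.1 * q.2, by fun_prop⟩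
    (fun x => by simp) (fun x => by simp)

lemma square_contractible : (ContinuousMap.id (unitInterval × unitInterval)).Homotopic
    (ContinuousMap.const _ (0, 0)) :=
  homotopic_of_family ⟨fun q : unitInterval × unitInterval × unitInterval =>
    (unitInterval.symm q.1 * q.2.1, unitInterval.symm q.1 * q.2.2), by fun_prop⟩
    (fun x => by simp) (fun x => by simp)

lemma ps_const_mem_B1 (x : X) : ps (ContinuousMap.const _ x) ∈ B1 X := by
  have h : ps (ContinuousMap.const unitInterval (0 : unitInterval)) ∈ B1 unitInterval :=
    mem_B1_of_contractible interval_contractible (by rw [bd_ps]; exact sub_self _)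
  have := chainPush_mem_B1 (ContinuousMap.const _ x) h
  rwa [chainPush_ps] at this

/-- Horizontal and vertical segments and the diagonal of the unit square. -/
def hseg (t : unitInterval) : C(unitInterval, unitInterval × unitInterval) := ⟨fun s => (s, t), by fun_prop⟩
/-- Vertical segments of the unit square. -/
def vseg (s : unitInterval) : C(unitInterval, unitInterval × unitInterval) := ⟨fun t => (s, t), by fun_prop⟩
/-- The diagonal of the unit square. -/
def dseg : C(unitInterval, unitInterval × unitInterval) := ⟨fun t => (t, t), by fun_prop⟩

/-- The perimeter is a cycle in a contractible square, hence a boundary there; then push it forward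
by `F`. -/
lemma square_mem_B1 (F : C(unitInterval × unitInterval, X)) :
    ps (F.comp (hseg 0)) + ps (F.comp (vseg 1)) - ps (F.comp (hseg 1)) - ps (F.comp (vseg 0)) ∈ B1 X := by
  have h : ps (hseg 0) + ps (vseg 1) - ps (hseg 1) - ps (vseg 0) ∈ B1 (unitInterval × unitInterval) := by
    refine mem_B1_of_contractible square_contractible ?_
    simp only [map_sub, map_add, bd_ps, hseg, vseg, ContinuousMap.coe_mk]
    abel
  have := chainPush_mem_B1 F h
  simpa only [map_sub, map_add, chainPush_ps] using this

lemma diagonal_mem_B1 (F : C(unitInterval × unitInterval, X)) :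
    ps (F.comp dseg) - ps (F.comp (hseg 0)) - ps (F.comp (vseg 1)) ∈ B1 X := by
  have h : ps dseg - ps (hseg 0) - ps (vseg 1) ∈ B1 (unitInterval × unitInterval) := by
    refine mem_B1_of_contractible square_contractible ?_
    simp only [map_sub, bd_ps, hseg, vseg, dseg, ContinuousMap.coe_mk]
    abel
  have := chainPush_mem_B1 F h
  simpa only [map_sub, chainPush_ps] using this

lemma ps_homotopic {x y : X} {p q : Path x y} (h : p.Homotopic q) :
    ps p.toContinuousMap - ps q.toContinuousMap ∈ B1 X := by
  obtain ⟨F⟩ := h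
  -- A path homotopy has its deformation parameter in the first coordinate, whereas the horizontal
  -- edges vary that coordinate; hence the swap.
  have h1 := square_mem_B1 (F.toContinuousMap.comp ⟨Prod.swap, continuous_swap⟩)
  have e1 : (F.toContinuousMap.comp ⟨Prod.swap, continuous_swap⟩).comp (hseg 0) = p.toContinuousMap := by
    ext t; exact F.apply_zero t
  have e2 : (F.toContinuousMap.comp ⟨Prod.swap, continuous_swap⟩).comp (hseg 1) = q.toContinuousMap := by
    ext t; exact F.apply_one t
  have e3 : (F.toContinuousMap.comp ⟨Prod.swap, continuous_swap⟩).comp (vseg 0) = ContinuousMap.const _ x := by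
    ext t; exact F.source t
  have e4 : (F.toContinuousMap.comp ⟨Prod.swap, continuous_swap⟩).comp (vseg 1) = ContinuousMap.const _ y := by
    ext t; exact F.target t
  rw [e1, e2, e3, e4] at h1
  have := Submodule.add_mem _ (Submodule.sub_mem _ h1 (ps_const_mem_B1 y)) (ps_const_mem_B1 x)
  convert this using 1
  abel

/-- In the contractible interval the identity path is homologous to the sum of its two halves; push
this relation along the concatenation. -/
lemma ps_trans {x y z : X} (p : Path x y) (q : Path y z) :
    ps (p.trans q).toContinuousMap - ps p.toContinuousMap - ps q.toContinuousMap ∈ B1 X := by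
  have ha : ∀ t : unitInterval, (t : ℝ) / 2 ∈ unitInterval := fun t =>
    ⟨by linarith [t.2.1], by linarith [t.2.2]⟩
  have hb : ∀ t : unitInterval, (1 + (t : ℝ)) / 2 ∈ unitInterval := fun t =>
    ⟨by linarith [t.2.1], by linarith [t.2.2]⟩
  let a : C(unitInterval, unitInterval) := ⟨fun t => ⟨(t : ℝ) / 2, ha t⟩, by fun_prop⟩
  let b : C(unitInterval, unitInterval) := ⟨fun t => ⟨(1 + (t : ℝ)) / 2, hb t⟩, by fun_prop⟩
  have h : ps (ContinuousMap.id unitInterval) - ps a - ps b ∈ B1 unitInterval := by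
    refine mem_B1_of_contractible interval_contractible ?_
    have e1 : a 1 = b 0 := Subtype.ext (by simp [a, b])
    have e2 : a 0 = 0 := Subtype.ext (by simp [a])
    have e3 : b 1 = 1 := Subtype.ext (by simp [b])
    simp only [map_sub, bd_ps, e1, e2, e3, ContinuousMap.id_apply]
    abel
  have := chainPush_mem_B1 (p.trans q).toContinuousMap h
  simp only [map_sub, chainPush_ps] at this
  have e1 : (p.trans q).toContinuousMap.comp a = p.toContinuousMap := by
    ext t
    change (p.trans q) (a t) = p t
    have ht := t.2.2
    rw [Path.trans_apply, dif_pos (by change (t : ℝ) / 2 ≤ 1 / 2; linarith)]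
    congr 1
    apply Subtype.ext
    change 2 * ((t : ℝ) / 2) = t
    ring
  have e2 : (p.trans q).toContinuousMap.comp b = q.toContinuousMap := by
    ext t
    change (p.trans q) (b t) = q t
    rcases eq_or_lt_of_le t.2.1 with h0 | h0
    · have : t = 0 := Subtype.ext h0.symm
      subst this
      rw [Path.trans_apply, dif_pos (by simp [b])]
      have : (⟨2 * (b 0 : ℝ), (unitInterval.mul_pos_mem_iff zero_lt_two).2 ⟨(b 0).2.1, by simp [b]⟩⟩ : unitInterval) = 1 :=
        Subtype.ext (by simp [b])
      rw [this, p.target, q.source]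
    · rw [Path.trans_apply, dif_neg (by change ¬ (1 + (t : ℝ)) / 2 ≤ 1 / 2; intro h; linarith)]
      congr 1
      apply Subtype.ext
      change 2 * ((1 + (t : ℝ)) / 2) - 1 = t
      ring
  rwa [e1, e2, ContinuousMap.comp_id] at this

/-- Modulo boundaries `Φ` agrees with `G ∘ ∂` on paths, hence on all chains, and `G ∘ ∂` vanishes on
cycles. Statements about `H₁` thus become statements about single paths. -/
lemma mem_B1_of_sub (G : X → (Chains X).X 1) (Φ : (Chains X).X 1 →ₗ[ℤ] (Chains X).X 1)
    (h : ∀ γ : C(unitInterval, X), Φ (ps γ) - (G (γ 1) - G (γ 0)) ∈ B1 X) {c : (Chains X).X 1}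
    (hc : bd 0 c = 0) : Φ c ∈ B1 X := by
  let G' : (Chains X).X 0 →ₗ[ℤ] (Chains X).X 1 := chainLift fun s => G (s (vert 0 0))
  have hG : ∀ x, G' (pt x) = G x := fun x => chainLift_sx _ _
  have key : ∀ c : (Chains X).X 1, Φ c - G' (bd 0 c) ∈ B1 X := by
    intro c
    have hc : c ∈ Submodule.span ℤ (Set.range (sx (X := X) (n := 1))) := span_sx (X := X) 1 ▸ trivial
    have h2 := Submodule.mem_map_of_mem (f := Φ - G' ∘ₗ bd 0) hc
    refine (?_ : Submodule.map (Φ - G' ∘ₗ bd 0) _ ≤ _) h2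
    rw [Submodule.map_span, Submodule.span_le]
    rintro _ ⟨_, ⟨s, rfl⟩, rfl⟩
    rw [LinearMap.sub_apply, LinearMap.comp_apply, sx_eq_ps, bd_ps, map_sub, hG, hG]
    exact h _
  have := key c
  rwa [hc, map_zero, sub_zero] at this

/-- If paths with the same endpoints are homotopic, the first homology vanishes. -/
theorem singH_one_eq_zero (h : ∀ (x y : X) (p q : Path x y), p.Homotopic q) (c : SingH 1 X) :
    c = 0 := by
  classical
  obtain ⟨c, hc, rfl⟩ := exists_absCls c
  rw [absCls_eq_zero_iff]
  -- One base point for each path component; `X` may be disconnected, as it will be for the overlap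
  -- of two slit planes.
  let b : X → X := fun x => (Quotient.mk (pathSetoid X) x).out
  have hb : ∀ x, Nonempty (Path (b x) x) := fun x => Quotient.mk_out (s := pathSetoid X) x
  have hb' : ∀ x y, Joined x y → b x = b y := fun x y hxy =>
    congrArg Quotient.out (Quotient.sound (s := pathSetoid X) hxy)
  let p : ∀ x, Path (b x) x := fun x => (hb x).some
  refine mem_B1_of_sub (fun x => ps (p x).toContinuousMap) LinearMap.id (fun γ => ?_) hc
  let g : Path (γ 0) (γ 1) := ⟨γ, rfl, rfl⟩
  have h1 := ps_trans (p (γ 0)) g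
  have h2 := ps_homotopic (h _ _ ((p (γ 0)).trans g) ((p (γ 1)).cast (hb' _ _ ⟨g⟩) rfl))
  have := Submodule.sub_mem _ h2 h1
  convert this using 1
  have e1 : g.toContinuousMap = γ := rfl
  have e2 : ((p (γ 1)).cast (hb' _ _ ⟨g⟩) rfl).toContinuousMap = (p (γ 1)).toContinuousMap := rfl
  rw [e1, e2, LinearMap.id_apply]
  abel

lemma singH_one_eq_zero_of_simplyConnected [SimplyConnectedSpace X] (c : SingH 1 X) : c = 0 :=
  singH_one_eq_zero (fun _ _ p q => SimplyConnectedSpace.paths_homotopic p q) c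

/-! ### The first homology of a product -/

/-- The inclusion `x ↦ (x, y)`. -/
def inlAt (X : Type) [TopologicalSpace X] (y : Y) : C(X, X × Y) := ⟨fun x => (x, y), by fun_prop⟩

/-- The inclusion `y ↦ (x, y)`. -/
def inrAt (x : X) (Y : Type) [TopologicalSpace Y] : C(Y, X × Y) := ⟨fun y => (x, y), by fun_prop⟩

/-- The first homology of a product of path connected spaces. -/
theorem singH_one_prod [PathConnectedSpace X] [PathConnectedSpace Y] (x₀ : X) (y₀ : Y)
    (c : SingH 1 (X × Y)) :
    c = pushH 1 (inlAt X y₀) (pushH 1 (ContinuousMap.fst : C(X × Y, X)) c) +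
      pushH 1 (inrAt x₀ Y) (pushH 1 (ContinuousMap.snd : C(X × Y, Y)) c) := by
  obtain ⟨c, hc, rfl⟩ := exists_absCls c
  rw [pushH_comp, pushH_comp, ← sub_eq_zero, ← sub_sub, pushH_absCls, pushH_absCls]
  have hbd : bd 0 (c - chainPush ((inlAt X y₀).comp ContinuousMap.fst) 1 c -
      chainPush ((inrAt x₀ Y).comp ContinuousMap.snd) 1 c) = 0 := by
    rw [map_sub, map_sub, bd_chainPush, bd_chainPush, hc, map_zero, map_zero, sub_zero, sub_zero]
  have hmem : c - chainPush ((inlAt X y₀).comp ContinuousMap.fst) 1 c -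
      chainPush ((inrAt x₀ Y).comp ContinuousMap.snd) 1 c ∈ B1 (X × Y) := by
    let p : ∀ x : X, Path x₀ x := fun x => PathConnectedSpace.somePath x₀ x
    let q : ∀ y : Y, Path y₀ y := fun y => PathConnectedSpace.somePath y₀ y
    -- The chosen path to `x`, run at height `y`. The endpoint correction at `(x, y)` is the
    -- difference between running it at height `y` and at height `y₀`.
    let H : X → Y → (Chains (X × Y)).X 1 := fun x y => ps ((inlAt X y).comp (p x).toContinuousMap)
    refine mem_B1_of_sub (fun z => H z.1 z.2 - H z.1 y₀)
      (LinearMap.id - chainPush ((inlAt X y₀).comp ContinuousMap.fst) 1 -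
      chainPush ((inrAt x₀ Y).comp ContinuousMap.snd) 1) (fun γ => ?_) hc
    let sq : C(unitInterval, X) → C(unitInterval, Y) → C(unitInterval × unitInterval, X × Y) :=
      fun a b => a.prodMap b
    let a : C(unitInterval, X) := ContinuousMap.fst.comp γ
    let b : C(unitInterval, Y) := ContinuousMap.snd.comp γ
    -- The diagonal replaces `γ` by a horizontal edge and a vertical edge; the four squares slide
    -- these to height `y₀` and to the line over `x₀`, leaving only the endpoint corrections.
    have d := diagonal_mem_B1 (sq a b)
    have s1 := square_mem_B1 (sq a (q (b 0)).toContinuousMap)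
    have s2 := square_mem_B1 (sq (p (a 1)).toContinuousMap b)
    have s3 := square_mem_B1 (sq (p (a 1)).toContinuousMap (q (b 0)).toContinuousMap)
    have s4 := square_mem_B1 (sq (p (a 0)).toContinuousMap (q (b 0)).toContinuousMap)
    have hh : ∀ (a : C(unitInterval, X)) (b : C(unitInterval, Y)) t,
        (sq a b).comp (hseg t) = (inlAt X (b t)).comp a := fun _ _ _ => rfl
    have hv : ∀ (a : C(unitInterval, X)) (b : C(unitInterval, Y)) s,
        (sq a b).comp (vseg s) = (inrAt (a s) Y).comp b := fun _ _ _ => rfl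
    have hd : (sq a b).comp dseg = γ := rfl
    have hp0 : ∀ x, (p x).toContinuousMap 0 = x₀ := fun x => (p x).source
    have hp1 : ∀ x, (p x).toContinuousMap 1 = x := fun x => (p x).target
    have hq0 : ∀ y, (q y).toContinuousMap 0 = y₀ := fun y => (q y).source
    have hq1 : ∀ y, (q y).toContinuousMap 1 = y := fun y => (q y).target
    simp only [hh, hv, hd, hp0, hp1, hq0, hq1] at d s1 s2 s3 s4
    have := Submodule.add_mem _ (Submodule.sub_mem _ (Submodule.sub_mem _ (Submodule.add_mem _ d s2) s1) s4) s3
    convert this using 1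
    simp only [LinearMap.sub_apply, LinearMap.id_apply, chainPush_ps]
    have e1 : ((inlAt X y₀).comp ContinuousMap.fst).comp γ = (inlAt X y₀).comp a := rfl
    have e2 : ((inrAt x₀ Y).comp ContinuousMap.snd).comp γ = (inrAt x₀ Y).comp b := rfl
    have e3 : (γ 1).1 = a 1 := rfl
    have e4 : (γ 1).2 = b 1 := rfl
    have e5 : (γ 0).1 = a 0 := rfl
    have e6 : (γ 0).2 = b 0 := rfl
    rw [e1, e2, e3, e4, e5, e6]
    simp only [H]
    abel
  have h0 := (absCls_eq_zero_iff _ hbd).mpr hmem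
  refine Eq.trans ?_ h0
  refine Eq.trans ?_ (hcls_sub (Chains (X × Y)) _ _ (by
    change bd 0 _ = 0
    rw [map_sub, bd_chainPush, hc, map_zero, sub_zero]) (by
    change bd 0 _ = 0
    rw [bd_chainPush, hc, map_zero])).symm
  congr 1
  exact (hcls_sub (Chains (X × Y)) _ _ hc (by
    change bd 0 _ = 0
    rw [bd_chainPush, hc, map_zero])).symm

end

section

variable {X Y : Type} [TopologicalSpace X] [TopologicalSpace Y]

/-! ### Classes of discs and spheres -/

lemma discSimplex_boundary : ∃ a, chainPush (incl circ) 1 a = bd 1 (sx discSimplex) := by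
  rw [← relMk_eq_zero_iff, ← d_relMk]
  exact congrArg (fun φ => φ.hom (1 : ℤ)) (relChainOf_d circ discSimplex fun p hp =>
    clamp_mem_circ (one_le_norm_triangle p hp))

lemma discClass_eq :
    discClass = relCls circ (n := 1) (sx discSimplex) discSimplex_boundary :=
  classOf_eq_hcls _ _

lemma bd_disc_sub {f g : C(Disc, X)} (h : ∀ z ∈ circ, f z = g z) :
    bd 1 (sx (f.comp discSimplex) - sx (g.comp discSimplex)) = 0 :=
  congrArg (fun φ => φ.hom (1 : ℤ)) (chainOf_sub_d (f.comp discSimplex) (g.comp discSimplex)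
    fun p hp => h _ (clamp_mem_circ (one_le_norm_triangle p hp)))

/-- The class of the sphere obtained by gluing two discs along their common boundary. -/
def sphereDiff (f g : C(Disc, X)) (h : ∀ z ∈ circ, f z = g z) : SingH 2 X :=
  absCls (n := 1) (sx (f.comp discSimplex) - sx (g.comp discSimplex)) (bd_disc_sub h)

lemma sphereClass_eq : sphereClass =
    sphereDiff collapse (ContinuousMap.const _ infPt) (fun _ h => collapse_circ h) :=
  classOf_eq_hcls _ _

lemma pushH_sphereDiff (φ : C(X, Y)) (f g : C(Disc, X)) (h : ∀ z ∈ circ, f z = g z) :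
    pushH 2 φ (sphereDiff f g h) =
      sphereDiff (φ.comp f) (φ.comp g) (fun z hz => congrArg φ (h z hz)) := by
  rw [sphereDiff, pushH_absCls]
  refine hcls_congr _ ?_ _
  change chainPush φ 2 (_ - _) = _
  rw [map_sub, chainPush_sx, chainPush_sx]
  rfl

/-- When the common boundary lies in `A`, each disc is a relative cycle by itself. This converts an
identity between spheres into an additive relation between disc classes. -/
lemma toRel_sphereDiff {A : Set X} (f g : C(Disc, X)) (h : ∀ z ∈ circ, f z = g z)
    (hf : Set.MapsTo f circ A) (hg : Set.MapsTo g circ A) :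
    toRel 2 A (sphereDiff f g h) = pushRel 2 f hf discClass - pushRel 2 g hg discClass := by
  rw [sphereDiff, toRel_absCls, discClass_eq, pushRel_relCls, pushRel_relCls]
  refine Eq.trans ?_ (hcls_sub _ _ _ _ _)
  refine hcls_congr _ ?_ _
  rw [chainPush_sx, chainPush_sx, map_sub]

/-- The union of two discs along their boundary. -/
abbrev DoubleDisc : Type := {p : ℂ × ℝ // |p.2| = 1 - ‖p.1‖}

/-- The projection of the double disc. -/
def doubleProj : C(DoubleDisc, Disc) :=
  ⟨fun p => ⟨p.1.1, by
    rw [mem_closedBall_zero_iff]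
    have := p.2
    have := abs_nonneg p.1.2
    linarith⟩, by fun_prop⟩

/-- The upper half of the double disc. -/
def doubleUp : C(Disc, DoubleDisc) :=
  ⟨fun z => ⟨((z : ℂ), 1 - ‖(z : ℂ)‖), abs_of_nonneg (sub_nonneg.mpr z.norm_le)⟩, by fun_prop⟩

/-- The lower half of the double disc. -/
def doubleDown : C(Disc, DoubleDisc) :=
  ⟨fun z => ⟨((z : ℂ), -(1 - ‖(z : ℂ)‖)), by
    rw [abs_neg]; exact abs_of_nonneg (sub_nonneg.mpr z.norm_le)⟩, by fun_prop⟩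

lemma doubleUp_eq_doubleDown : ∀ z ∈ circ, doubleUp z = doubleDown z := by
  intro z hz
  have hz : ‖(z : ℂ)‖ = 1 := hz
  apply Subtype.ext
  change ((z : ℂ), 1 - ‖(z : ℂ)‖) = ((z : ℂ), -(1 - ‖(z : ℂ)‖))
  rw [hz]
  simp

open Classical in
/-- The sphere class does not change in a family of pairs of discs with common boundary. -/
theorem sphereDiff_family (F G : C(unitInterval × Disc, X))
    (h : ∀ s, ∀ z ∈ circ, F (s, z) = G (s, z)) {f₀ g₀ f₁ g₁ : C(Disc, X)}
    (hf₀ : ∀ z, F (0, z) = f₀ z) (hg₀ : ∀ z, G (0, z) = g₀ z)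
    (hf₁ : ∀ z, F (1, z) = f₁ z) (hg₁ : ∀ z, G (1, z) = g₁ z) :
    sphereDiff f₀ g₀ (fun z hz => by rw [← hf₀, ← hg₀, h 0 z hz]) =
      sphereDiff f₁ g₁ (fun z hz => by rw [← hf₁, ← hg₁, h 1 z hz]) := by
  have hcirc : ∀ p : DoubleDisc, p.1.2 = 0 → doubleProj p ∈ circ := fun p hp => by
    have := p.2
    rw [hp, abs_zero] at this
    change ‖p.1.1‖ = 1
    linarith
  -- The two families agree on the circle and glue to one family on the double disc. The sphere
  -- class is the image of a class of the double disc, so absolute homotopy invariance applies.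
  let H : C(unitInterval × DoubleDisc, X) :=
    ⟨fun q => if (0 : ℝ) ≤ q.2.1.2 then F (q.1, doubleProj q.2) else G (q.1, doubleProj q.2),
      Continuous.if_le (by fun_prop) (by fun_prop) continuous_const (by fun_prop)
        fun q hq => h _ _ (hcirc _ hq.symm)⟩
  have hup : ∀ s z, H (s, doubleUp z) = F (s, z) := fun s z =>
    if_pos (sub_nonneg.mpr z.norm_le)
  have hdown : ∀ s z, H (s, doubleDown z) = G (s, z) := fun s z => by
    by_cases hz : (0 : ℝ) ≤ (doubleDown z).1.2
    · have hz' : (0 : ℝ) ≤ -(1 - ‖(z : ℂ)‖) := hz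
      refine (if_pos hz).trans (h s z ?_)
      change ‖(z : ℂ)‖ = 1
      linarith [z.norm_le]
    · exact if_neg hz
  have key := pushH_homotopic 2 (f := H.comp (cylIncl _ 0)) (g := H.comp (cylIncl _ 1))
    (homotopic_of_family H (fun _ => rfl) fun _ => rfl)
  have := congrArg (fun φ => φ (sphereDiff doubleUp doubleDown doubleUp_eq_doubleDown)) key
  simp only [pushH_sphereDiff] at this
  have e0 : (H.comp (cylIncl _ 0)).comp doubleUp = f₀ := ContinuousMap.ext fun z => (hup 0 z).trans (hf₀ z)
  have e1 : (H.comp (cylIncl _ 0)).comp doubleDown = g₀ := ContinuousMap.ext fun z => (hdown 0 z).trans (hg₀ z)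
  have e2 : (H.comp (cylIncl _ 1)).comp doubleUp = f₁ := ContinuousMap.ext fun z => (hup 1 z).trans (hf₁ z)
  have e3 : (H.comp (cylIncl _ 1)).comp doubleDown = g₁ := ContinuousMap.ext fun z => (hdown 1 z).trans (hg₁ z)
  simpa only [e0, e1, e2, e3] using this

/-! ### Complex conjugation reverses the orientation of the disc -/

/-- The degenerate 3-simplex with vertices `v₀, v₁, v₀, v₂` has the swapped and the original
triangle as faces 0 and 2, both with sign `+`. Faces 1 and 3 lie on edges, which `s` maps into `A`.
-/
lemma relCls_swap (A : Set X) (s : C(stdSimplex ℝ (Fin 3), X)) (h : ∀ p, (∃ i, p i = 0) → s p ∈ A)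
    (hs) (hs') :
    relCls A (n := 1) (sx (s.comp (aff ![vert 2 1, vert 2 0, vert 2 2]))) hs' =
      -relCls A (n := 1) (sx s) hs := by
  rw [eq_neg_iff_add_eq_zero]
  refine (hcls_add _ _ _ _ _).symm.trans ((hcls_eq_zero_iff _ _ _).mpr ?_)
  refine ⟨relMk A 3 (sx (s.comp (aff ![vert 2 0, vert 2 1, vert 2 0, vert 2 2]))), ?_⟩
  rw [d_relMk, bd_sx, Fin.sum_univ_four]
  simp only [ContinuousMap.comp_assoc, aff_comp_face]
  have e0 : (fun j => (![vert 2 0, vert 2 1, vert 2 0, vert 2 2] : Fin 4 → _) ((0 : Fin 4).succAbove j)) =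
      ![vert 2 1, vert 2 0, vert 2 2] := by
    funext j; fin_cases j <;> rfl
  have e2 : (fun j => (![vert 2 0, vert 2 1, vert 2 0, vert 2 2] : Fin 4 → _) ((2 : Fin 4).succAbove j)) =
      vert 2 := by
    funext j; fin_cases j <;> rfl
  have z1 : relMk A 2 (sx (s.comp (aff fun j =>
      (![vert 2 0, vert 2 1, vert 2 0, vert 2 2] : Fin 4 → _) ((1 : Fin 4).succAbove j)))) = 0 := by
    rw [relMk_eq_zero_iff]
    refine mem_range_chainPush_incl fun p => h _ ⟨1, ?_⟩
    rw [aff_apply]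
    refine Finset.sum_eq_zero fun j _ => ?_
    fin_cases j <;> exact mul_eq_zero_of_right _ rfl
  have z3 : relMk A 2 (sx (s.comp (aff fun j =>
      (![vert 2 0, vert 2 1, vert 2 0, vert 2 2] : Fin 4 → _) ((3 : Fin 4).succAbove j)))) = 0 := by
    rw [relMk_eq_zero_iff]
    refine mem_range_chainPush_incl fun p => h _ ⟨2, ?_⟩
    rw [aff_apply]
    refine Finset.sum_eq_zero fun j _ => ?_
    fin_cases j <;> exact mul_eq_zero_of_right _ rfl
  rw [map_add, map_add, map_add, map_zsmul, map_zsmul, map_zsmul, map_zsmul, z1, z3, e0, e2, aff_vert,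
    ContinuousMap.comp_id, zsmul_zero, zsmul_zero, add_zero, add_zero]
  have h0 : (-1 : ℤ) ^ ((0 : Fin 4) : ℕ) = 1 := rfl
  have h2 : (-1 : ℤ) ^ ((2 : Fin 4) : ℕ) = 1 := rfl
  rw [h0, h2, one_zsmul, one_zsmul]

/-- Complex conjugation of the disc. -/
def conjDisc : C(Disc, Disc) :=
  ⟨fun z => ⟨starRingEnd ℂ z, by
    rw [mem_closedBall_zero_iff, RCLike.norm_conj]; exact z.norm_le⟩, by fun_prop⟩

lemma mapsTo_conjDisc : Set.MapsTo conjDisc circ circ := fun z hz => by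
  change ‖starRingEnd ℂ (z : ℂ)‖ = 1
  rw [RCLike.norm_conj]; exact hz

/-- The family of rotated reflections `z ↦ -e^{iπs} z̄` of the disc. -/
def reflRot : C(unitInterval × Disc, Disc) :=
  ⟨fun q => ⟨-(Complex.exp (((Real.pi * q.1 : ℝ) : ℂ) * Complex.I) * starRingEnd ℂ (q.2 : ℂ)), by
    rw [mem_closedBall_zero_iff, norm_neg, norm_mul, Complex.norm_exp_ofReal_mul_I, one_mul,
      RCLike.norm_conj]
    exact q.2.norm_le⟩, by fun_prop⟩

lemma reflRot_mem (s : unitInterval) : ∀ z ∈ circ, reflRot (s, z) ∈ circ := fun z hz => by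
  change ‖-(Complex.exp (((Real.pi * s : ℝ) : ℂ) * Complex.I) * starRingEnd ℂ (z : ℂ))‖ = 1
  rw [norm_neg, norm_mul, Complex.norm_exp_ofReal_mul_I, one_mul, RCLike.norm_conj]
  exact hz

theorem pushRel_conjDisc : pushRel 2 conjDisc mapsTo_conjDisc discClass = -discClass := by
  -- The reflection `z ↦ -z̄` exchanges the first two vertices of the triangle, so it acts on the
  -- simplex exactly by the swap; rotation joins it to `z ↦ z̄`.
  have h0 : Set.MapsTo (reflRot.comp (cylIncl _ 0)) circ circ := reflRot_mem 0
  have h1 : pushRel 2 (reflRot.comp (cylIncl _ 0)) h0 = pushRel 2 conjDisc mapsTo_conjDisc := by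
    refine pushRel_homotopic 2 h0 _ reflRot (fun _ => rfl) (fun z => Subtype.ext ?_) reflRot_mem
    change -(Complex.exp (((Real.pi * (1 : ℝ) : ℝ) : ℂ) * Complex.I) * starRingEnd ℂ (z : ℂ)) = _
    rw [mul_one, Complex.exp_pi_mul_I, neg_mul, one_mul, neg_neg]
    rfl
  rw [← h1, discClass_eq, pushRel_relCls]
  have e : (reflRot.comp (cylIncl _ 0)).comp discSimplex =
      discSimplex.comp (aff ![vert 2 1, vert 2 0, vert 2 2]) := by
    ext p
    have ht : triangle (aff ![vert 2 1, vert 2 0, vert 2 2] p) = -starRingEnd ℂ (triangle p) := by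
      have a0 : aff ![vert 2 1, vert 2 0, vert 2 2] p 0 = p 1 := by
        rw [aff_apply, Fin.sum_univ_three]
        simp [vert_apply]
      have a1 : aff ![vert 2 1, vert 2 0, vert 2 2] p 1 = p 0 := by
        rw [aff_apply, Fin.sum_univ_three]
        simp [vert_apply]
      have a2 : aff ![vert 2 1, vert 2 0, vert 2 2] p 2 = p 2 := by
        rw [aff_apply, Fin.sum_univ_three]
        simp [vert_apply]
      apply Complex.ext
      · change 4 * (aff ![vert 2 1, vert 2 0, vert 2 2] p 1 - aff ![vert 2 1, vert 2 0, vert 2 2] p 0) =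
          -(4 * (p 1 - p 0))
        rw [a0, a1]; ring
      · change 4 * aff ![vert 2 1, vert 2 0, vert 2 2] p 2 - 2 * aff ![vert 2 1, vert 2 0, vert 2 2] p 0 -
          2 * aff ![vert 2 1, vert 2 0, vert 2 2] p 1 = - -(4 * p 2 - 2 * p 0 - 2 * p 1)
        rw [a0, a1, a2]; ring
    change -(Complex.exp (((Real.pi * (0 : ℝ) : ℝ) : ℂ) * Complex.I) *
      starRingEnd ℂ (triangle p / ((max 1 ‖triangle p‖ : ℝ) : ℂ))) =
      triangle (aff ![vert 2 1, vert 2 0, vert 2 2] p) /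
        ((max 1 ‖triangle (aff ![vert 2 1, vert 2 0, vert 2 2] p)‖ : ℝ) : ℂ)
    rw [ht, norm_neg, RCLike.norm_conj]
    simp [neg_div]
  refine Eq.trans (hcls_congr _ ?_ _) (relCls_swap circ discSimplex
    (fun p hp => clamp_mem_circ (one_le_norm_triangle p hp)) _ ?_)
  · change relMk circ 2 (chainPush _ 2 (sx discSimplex)) = _
    rw [chainPush_sx, e]
  · rw [← e, ← chainPush_sx, bd_chainPush]
    obtain ⟨a, ha⟩ := discSimplex_boundary
    exact ⟨chainPush (restr _ h0) 1 a, by rw [chainPush_restr, ha]⟩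

end

section

variable {X Y : Type} [TopologicalSpace X] [TopologicalSpace Y]

/-! ### Relative homology of products -/

lemma singH_one_prod_set {A : Set X} {B : Set Y} (hA : IsPathConnected A) (hB : IsPathConnected B)
    {a : X} {b : Y} (h1 : Set.MapsTo ((inlAt X b).comp ContinuousMap.fst) (A ×ˢ B) (A ×ˢ B))
    (h2 : Set.MapsTo ((inrAt a Y).comp ContinuousMap.snd) (A ×ˢ B) (A ×ˢ B))
    (ha : a ∈ A) (hb : b ∈ B) (c : SingH 1 (A ×ˢ B : Set (X × Y))) :
    c = pushH 1 (restr _ h1) c + pushH 1 (restr _ h2) c := by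
  have := isPathConnected_iff_pathConnectedSpace.mp hA
  have := isPathConnected_iff_pathConnectedSpace.mp hB
  let e : C((A ×ˢ B : Set (X × Y)), A × B) :=
    ⟨fun p => (⟨p.1.1, p.2.1⟩, ⟨p.1.2, p.2.2⟩), by fun_prop⟩
  let e' : C(A × B, (A ×ˢ B : Set (X × Y))) := ⟨fun p => ⟨(p.1.1, p.2.1), p.1.2, p.2.2⟩, by fun_prop⟩
  have h := congrArg (pushH 1 e') (singH_one_prod (⟨a, ha⟩ : A) (⟨b, hb⟩ : B) (pushH 1 e c))
  rw [map_add] at h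
  simp only [pushH_comp] at h
  have e1 : e'.comp e = ContinuousMap.id _ := rfl
  rw [e1, pushH_id] at h
  exact h

/-- The difference `δ` of the two sides has zero boundary, by Künneth in degree one, and zero
projection to `(X, A)`. So it lifts to `H₂(X × Y)`, with projection coming from `A`. As `Y` is
contractible, the lift is determined by that projection and comes from `A × {b}`, so `δ = 0`. -/
theorem relH_two_prod {A : Set X} {B : Set Y} (hA : IsPathConnected A) (hB : IsPathConnected B)
    {a : X} {b : Y} (ha : a ∈ A) (hb : b ∈ B)
    (hY : (ContinuousMap.id Y).Homotopic (ContinuousMap.const Y b))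
    (i₁ : Set.MapsTo (inlAt X b) A (A ×ˢ B)) (i₂ : Set.MapsTo (inrAt a Y) B (A ×ˢ B))
    (p₁ : Set.MapsTo (ContinuousMap.fst : C(X × Y, X)) (A ×ˢ B) A)
    (p₂ : Set.MapsTo (ContinuousMap.snd : C(X × Y, Y)) (A ×ˢ B) B) (x : RelH 2 (A ×ˢ B)) :
    x = pushRel 2 (inlAt X b) i₁ (pushRel 2 ContinuousMap.fst p₁ x) +
      pushRel 2 (inrAt a Y) i₂ (pushRel 2 ContinuousMap.snd p₂ x) := by
  rw [← sub_eq_zero]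
  set δ := x - (pushRel 2 (inlAt X b) i₁ (pushRel 2 ContinuousMap.fst p₁ x) +
      pushRel 2 (inrAt a Y) i₂ (pushRel 2 ContinuousMap.snd p₂ x)) with hδ
  have hb0 : bdry 1 _ δ = 0 := by
    rw [hδ, pushRel_comp, pushRel_comp, map_sub, map_add, bdry_natural, bdry_natural, sub_eq_zero]
    exact singH_one_prod_set hA hB _ _ ha hb _
  have hp : pushRel 2 ContinuousMap.fst p₁ δ = 0 := by
    have e1 : pushRel 2 ContinuousMap.fst p₁ (pushRel 2 (inlAt X b) i₁ (pushRel 2 ContinuousMap.fst p₁ x)) =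
        pushRel 2 ContinuousMap.fst p₁ x := by
      rw [pushRel_comp, pushRel_comp]
      rfl
    have e2 : pushRel 2 ContinuousMap.fst p₁ (pushRel 2 (inrAt a Y) i₂ (pushRel 2 ContinuousMap.snd p₂ x)) = 0 := by
      rw [pushRel_comp]
      exact pushRel_const 1 a (fun _ _ => ha) ha _
    rw [hδ, map_sub, map_add, e1, e2, add_zero, sub_self]
  obtain ⟨h, hh⟩ := (exact_bdry 1 _ δ).mp hb0
  rw [← hh, toRel_natural, exact_toRel] at hp
  obtain ⟨l, hl⟩ := hp
  have hid : ((inlAt X b).comp ContinuousMap.fst).Homotopic (ContinuousMap.id (X × Y)) := by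
    obtain ⟨H⟩ := hY
    refine ContinuousMap.Homotopic.symm (homotopic_of_family
      ⟨fun q : unitInterval × X × Y => (q.2.1, H (q.1, q.2.2)), by fun_prop⟩ (fun q => ?_) fun q => ?_)
    · exact Prod.ext rfl (H.map_zero_left q.2)
    · exact Prod.ext rfl (H.map_one_left q.2)
  have h3 := pushH_id_of_homotopic 2 hid h
  rw [← pushH_comp, ← hl, pushH_comp] at h3
  rw [← hh, exact_toRel]
  refine ⟨pushH 2 (restr (inlAt X b) i₁) l, ?_⟩
  rw [pushH_comp, ← h3]
  rfl

/-! ### The boundary circle and the section class of a relative class -/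

lemma isPathConnected_circ : IsPathConnected circ := by
  have h : circ = Set.range fun t : ℝ => ofCircle (Circle.exp t) := by
    ext z
    constructor
    · intro hz
      obtain ⟨t, ht⟩ := Circle.exp_surjective ⟨(z : ℂ), mem_sphere_zero_iff_norm.mpr hz⟩
      refine ⟨t, Subtype.ext ?_⟩
      change ((Circle.exp t : Circle) : ℂ) = z
      rw [ht]
    · rintro ⟨t, rfl⟩
      exact Circle.norm_coe _
  rw [h]
  refine isPathConnected_range ?_
  exact Continuous.subtype_mk (by fun_prop) _

lemma one_mem_circ : ofCircle 1 ∈ circ := Circle.norm_coe 1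

/-- Scaling of the disc. -/
def discScale : C(unitInterval × Disc, Disc) :=
  ⟨fun q => ⟨((q.1 : ℝ) : ℂ) * q.2, by
    rw [mem_closedBall_zero_iff, norm_mul, Complex.norm_real, Real.norm_of_nonneg q.1.2.1]
    exact mul_le_one₀ q.1.2.2 (norm_nonneg _) q.2.norm_le⟩, by fun_prop⟩

lemma disc_contractible (w : Disc) :
    (ContinuousMap.id Disc).Homotopic (ContinuousMap.const Disc w) := by
  have hm : ∀ q : unitInterval × Disc,
      (1 - ((q.1 : ℝ) : ℂ)) * (q.2 : ℂ) + ((q.1 : ℝ) : ℂ) * w ∈ Metric.closedBall (0 : ℂ) 1 := fun q => by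
    have h := (convex_closedBall (0 : ℂ) 1) q.2.2 w.2 (sub_nonneg.mpr q.1.2.2) q.1.2.1 (by ring)
    simpa [Complex.real_smul] using h
  refine homotopic_of_family ⟨fun q => ⟨_, hm q⟩, Continuous.subtype_mk (by fun_prop) _⟩
    (fun q => Subtype.ext ?_) fun q => Subtype.ext ?_
  · simp
  · simp

lemma mapsTo_inrAt {L : Set X} {x₀ : X} (h₀ : x₀ ∈ L) :
    Set.MapsTo (inrAt x₀ Disc) circ (L ×ˢ circ : Set (X × Disc)) := fun _ hz => ⟨h₀, hz⟩

lemma mapsTo_inlAt_one (L : Set X) :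
    Set.MapsTo (inlAt X (ofCircle 1)) L (L ×ˢ circ : Set (X × Disc)) := fun _ hx => ⟨hx, one_mem_circ⟩

/-- The class of the constant section through a point of `L`. -/
def hatZero {L : Set X} {x₀ : X} (h₀ : x₀ ∈ L) : RelH 2 (L ×ˢ circ : Set (X × Disc)) :=
  pushRel 2 (inrAt x₀ Disc) (mapsTo_inrAt h₀) discClass

/-- The inclusion of the fibre over `1`. -/
def fibreOne (L : Set X) : RelH 2 L →ₗ[ℤ] RelH 2 (L ×ˢ circ : Set (X × Disc)) :=
  pushRel 2 (inlAt X (ofCircle 1)) (mapsTo_inlAt_one L)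

lemma mapsTo_fst_prod (L : Set X) (C : Set Y) :
    Set.MapsTo (ContinuousMap.fst : C(X × Y, X)) (L ×ˢ C) L := fun _ h => h.1

lemma mapsTo_snd_prod (L : Set X) (C : Set Y) :
    Set.MapsTo (ContinuousMap.snd : C(X × Y, Y)) (L ×ˢ C) C := fun _ h => h.2

/-- Künneth gives uniqueness. The sum has the right projections because the constant section
vanishes in `(X, L)` and the fibre over `1` vanishes in `(𝔻, S¹)`. Existence and uniqueness of `β̂`
follow. -/
lemma isHat_iff {L : Set X} (hL : IsPathConnected L) {x₀ : X} (h₀ : x₀ ∈ L) (β : RelH 2 L)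
    (b : RelH 2 (L ×ˢ circ : Set (X × Disc))) :
    IsHat L β b ↔ b = fibreOne L β + hatZero h₀ := by
  change pushRel 2 _ (mapsTo_fst_prod L circ) b = β ∧
    pushRel 2 _ (mapsTo_snd_prod L circ) b = discClass ↔ _
  constructor
  · rintro ⟨rfl, h⟩
    have := relH_two_prod hL isPathConnected_circ h₀ one_mem_circ (disc_contractible (ofCircle 1))
      (mapsTo_inlAt_one L) (mapsTo_inrAt h₀) (mapsTo_fst_prod L circ) (mapsTo_snd_prod L circ) b
    rw [h] at this
    exact this
  · rintro rfl
    constructor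
    · rw [map_add, fibreOne, hatZero, pushRel_comp, pushRel_comp]
      have h1 : Set.MapsTo (ContinuousMap.const Disc x₀) circ L := fun _ _ => h₀
      exact (congrArg₂ (· + ·) (pushRel_id 2 L (Set.mapsTo_id _) β)
        (pushRel_const 1 x₀ h1 h₀ discClass)).trans (add_zero _)
    · rw [map_add, fibreOne, hatZero, pushRel_comp, pushRel_comp]
      have h1 : Set.MapsTo (ContinuousMap.const X (ofCircle 1)) L circ := fun _ _ => one_mem_circ
      exact (congrArg₂ (· + ·) (pushRel_const 1 (ofCircle 1) h1 one_mem_circ β)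
        (pushRel_id 2 circ (Set.mapsTo_id _) discClass)).trans (zero_add _)

/-- The section class of a disc. -/
lemma isHat_graph {L : Set X} (α : C(Disc, X)) (hα : Set.MapsTo α circ L)
    (h : Set.MapsTo (α.prodMk (ContinuousMap.id Disc)) circ (L ×ˢ circ)) :
    IsHat L (pushRel 2 α hα discClass) (pushRel 2 (α.prodMk (ContinuousMap.id Disc)) h discClass) :=
  ⟨pushRel_comp 2 _ _ (mapsTo_fst_prod L circ) h _,
    (pushRel_comp 2 _ _ (mapsTo_snd_prod L circ) h _).trans
      (pushRel_id 2 circ (Set.mapsTo_id _) discClass)⟩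

/-! ### The homology of `M × ℂˣ` -/

/-- The exponential map to the units. -/
def expUnit : C(ℂ, ℂˣ) := ⟨fun z => Units.mk0 (Complex.exp z) (Complex.exp_ne_zero z), by
  rw [Units.isEmbedding_val₀.continuous_iff]
  exact Complex.continuous_exp⟩

instance : PathConnectedSpace ℂˣ := by
  have h : Function.Surjective expUnit := fun w =>
    ⟨Complex.log w, Units.ext (Complex.exp_log w.ne_zero)⟩
  exact h.pathConnectedSpace expUnit.continuous

lemma continuous_units_mk0 {f : X → ℂ} (hf : Continuous f) (h : ∀ x, f x ≠ 0) :
    Continuous fun x => Units.mk0 (f x) (h x) := by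
  rw [Units.isEmbedding_val₀.continuous_iff]
  exact hf

/-- The part of `X × ℂˣ` over the slit plane. -/
def slitPos (X : Type) : Set (X × ℂˣ) := {p | (p.2 : ℂ) ∈ Complex.slitPlane}

/-- The part of `X × ℂˣ` over the opposite slit plane. -/
def slitNeg (X : Type) : Set (X × ℂˣ) := {p | -(p.2 : ℂ) ∈ Complex.slitPlane}

lemma isOpen_slitPos : IsOpen (slitPos X) :=
  Complex.isOpen_slitPlane.preimage (Units.continuous_val.comp continuous_snd)

lemma isOpen_slitNeg : IsOpen (slitNeg X) :=
  Complex.isOpen_slitPlane.preimage (Units.continuous_val.comp continuous_snd).neg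

lemma slitPos_union_slitNeg : slitPos X ∪ slitNeg X = Set.univ := by
  ext p
  simp only [slitPos, slitNeg, Set.mem_union, Set.mem_ofPred_eq, Complex.mem_slitPlane_iff,
    Complex.neg_re, Complex.neg_im, Set.mem_univ, iff_true]
  by_contra! h
  exact p.2.ne_zero (Complex.ext (by simp; linarith) (by simpa using h.1.2))

lemma im_ne_zero_of_mem_slit (p : (Subtype.val ⁻¹' slitPos X : Set (slitNeg X))) :
    (p.1.1.2 : ℂ).im ≠ 0 := by
  have h1 : (p.1.1.2 : ℂ) ∈ Complex.slitPlane := p.2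
  have h2 : -(p.1.1.2 : ℂ) ∈ Complex.slitPlane := p.1.2
  rw [Complex.mem_slitPlane_iff] at h1 h2
  intro h
  simp only [Complex.neg_re, Complex.neg_im, h, neg_zero, ne_eq, not_true_eq_false, or_false] at h1 h2
  linarith

/-- The imaginary part has no zero on the overlap, so by the intermediate value theorem a path stays
in one half plane. -/
lemma slit_path_sign {a b : (Subtype.val ⁻¹' slitPos X : Set (slitNeg X))} (p : Path a b)
    (t : unitInterval) : 0 < (a.1.1.2 : ℂ).im * ((p t).1.1.2 : ℂ).im := by
  by_contra! h
  have hc : Continuous fun t => (a.1.1.2 : ℂ).im * ((p t).1.1.2 : ℂ).im := by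
    have : Continuous fun t => ((p t).1.1.2 : ℂ) :=
      Units.continuous_val.comp (continuous_snd.comp (continuous_subtype_val.comp
        (continuous_subtype_val.comp p.continuous)))
    exact continuous_const.mul (Complex.continuous_im.comp this)
  obtain ⟨u, hu⟩ := mem_range_of_exists_le_of_exists_ge hc ⟨t, h⟩
    ⟨0, by rw [p.source]; exact mul_self_nonneg _⟩
  exact mul_ne_zero (im_ne_zero_of_mem_slit a) (im_ne_zero_of_mem_slit (p u)) hu

/-- The overlap is `X` times two open half planes. The `X`-coordinates are homotopic by simple
connectivity, and the complex coordinates are interpolated linearly inside one half plane. -/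
lemma slit_paths_homotopic [SimplyConnectedSpace X]
    (a b : (Subtype.val ⁻¹' slitPos X : Set (slitNeg X))) (p q : Path a b) : p.Homotopic q := by
  let f : C((Subtype.val ⁻¹' slitPos X : Set (slitNeg X)), X) := ⟨fun w => w.1.1.1, by fun_prop⟩
  obtain ⟨F⟩ := SimplyConnectedSpace.paths_homotopic (p.map f.continuous) (q.map f.continuous)
  let g : unitInterval × unitInterval → ℂ := fun r =>
    (1 - ((r.1 : ℝ) : ℂ)) * ((p r.2).1.1.2 : ℂ) + ((r.1 : ℝ) : ℂ) * ((q r.2).1.1.2 : ℂ)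
  have hv : ∀ {u v : (Subtype.val ⁻¹' slitPos X : Set (slitNeg X))} (p : Path u v),
      Continuous fun t => ((p t).1.1.2 : ℂ) := fun p =>
    Units.continuous_val.comp (continuous_snd.comp (continuous_subtype_val.comp
        (continuous_subtype_val.comp p.continuous)))
  have hg : Continuous g :=
    ((continuous_const.sub (Complex.continuous_ofReal.comp (continuous_subtype_val.comp continuous_fst))).mul
      ((hv p).comp continuous_snd)).add
    ((Complex.continuous_ofReal.comp (continuous_subtype_val.comp continuous_fst)).mul
      ((hv q).comp continuous_snd))
  have him : ∀ r, (g r).im ≠ 0 := fun r h => by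
    have h1 : (g r).im = (1 - (r.1 : ℝ)) * ((p r.2).1.1.2 : ℂ).im + (r.1 : ℝ) * ((q r.2).1.1.2 : ℂ).im := by
      simp [g]
    have hp := slit_path_sign p r.2
    have hq := slit_path_sign q r.2
    have h2 : 0 < (a.1.1.2 : ℂ).im * (g r).im := by
      rw [h1, mul_add]
      have e1 := r.1.2.1
      have e2 := r.1.2.2
      rcases eq_or_lt_of_le e1 with e | e
      · rw [← e]; simpa using hp
      · nlinarith [mul_nonneg (sub_nonneg.mpr e2) hp.le, mul_pos e hq]
    rw [h, mul_zero] at h2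
    exact lt_irrefl _ h2
  have hne : ∀ r, g r ≠ 0 := fun r h => him r (by rw [h]; rfl)
  refine ⟨{ toFun := fun r => ⟨⟨(F r, Units.mk0 (g r) (hne r)),
              Complex.mem_slitPlane_iff.mpr (Or.inr (by simpa using him r))⟩,
              Complex.mem_slitPlane_iff.mpr (Or.inr (him r))⟩
            continuous_toFun := ?_
            map_zero_left := fun t => ?_
            map_one_left := fun t => ?_
            prop' := fun s t ht => ?_ }⟩
  · exact Continuous.subtype_mk (Continuous.subtype_mk
      (F.continuous.prodMk (continuous_units_mk0 hg hne)) _) _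
  · refine Subtype.ext (Subtype.ext (Prod.ext (F.apply_zero t) (Units.ext ?_)))
    change g (0, t) = _
    simp [g]
  · refine Subtype.ext (Subtype.ext (Prod.ext (F.apply_one t) (Units.ext ?_)))
    change g (1, t) = _
    simp [g]
  · refine Subtype.ext (Subtype.ext (Prod.ext ?_ (Units.ext ?_)))
    · exact F.eq_fst s ht
    · change g (s, t) = ((p t).1.1.2 : ℂ)
      rcases ht with rfl | rfl
      · simp only [g, p.source, q.source]; ring
      · simp only [g, p.target, q.target]; ring

/-- `H₂(X) → H₂(X × ℂˣ)` is surjective for simply connected `X`. -/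
theorem inlAt_one_surjective [SimplyConnectedSpace X] :
    Function.Surjective (pushH 2 (inlAt X (1 : ℂˣ))) := by
  intro n
  -- Mayer–Vietoris: the overlap has no first homology, so `n` is a sum of classes from the two slit
  -- regions. These contract onto `X × {1}` and `X × {-1}`, which are homotopic in `X × ℂˣ`.
  obtain ⟨y, hy⟩ := excision_surjective isOpen_slitPos isOpen_slitNeg (slitPos_union_slitNeg (X := X)) 1
    (toRel 2 (slitPos X) n)
  obtain ⟨b, rfl⟩ := (exact_bdry 1 _ y).mp (singH_one_eq_zero slit_paths_homotopic _)
  rw [toRel_natural, ← sub_eq_zero, ← map_sub, exact_toRel] at hy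
  obtain ⟨a, ha⟩ := hy
  have hA : (incl (slitPos X)).Homotopic ((inlAt X (1 : ℂˣ)).comp (ContinuousMap.fst.comp (incl (slitPos X)))) := by
    have hne : ∀ q : unitInterval × slitPos X,
        (1 - ((q.1 : ℝ) : ℂ)) * (q.2.1.2 : ℂ) + ((q.1 : ℝ) : ℂ) ≠ 0 := fun q => by
      have h := Complex.starConvex_one_slitPlane
      have h1 := h q.2.2 (a := q.1) (b := 1 - q.1) q.1.2.1 (sub_nonneg.mpr q.1.2.2) (by ring)
      refine Complex.slitPlane_ne_zero ?_
      simpa [Complex.real_smul, add_comm] using h1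
    have hc : Continuous fun q : unitInterval × slitPos X =>
        (1 - ((q.1 : ℝ) : ℂ)) * (q.2.1.2 : ℂ) + ((q.1 : ℝ) : ℂ) := by
      have := Units.continuous_val (M := ℂ)
      fun_prop
    refine homotopic_of_family ⟨fun q => (q.2.1.1, Units.mk0 _ (hne q)),
      Continuous.prodMk (by fun_prop) (continuous_units_mk0 hc hne)⟩ (fun q => ?_) fun q => ?_
    · exact Prod.ext rfl (Units.ext (by simp [incl]))
    · exact Prod.ext rfl (Units.ext (by simp [inlAt]))
  have hB : (incl (slitNeg X)).Homotopic ((inlAt X (-1 : ℂˣ)).comp (ContinuousMap.fst.comp (incl (slitNeg X)))) := by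
    have hne : ∀ q : unitInterval × slitNeg X,
        (1 - ((q.1 : ℝ) : ℂ)) * (q.2.1.2 : ℂ) - ((q.1 : ℝ) : ℂ) ≠ 0 := fun q => by
      have h := Complex.starConvex_one_slitPlane
      have h1 := h q.2.2 (a := q.1) (b := 1 - q.1) q.1.2.1 (sub_nonneg.mpr q.1.2.2) (by ring)
      intro h0
      refine Complex.slitPlane_ne_zero h1 ?_
      simp only [Complex.real_smul]
      push_cast
      linear_combination -h0
    have hc : Continuous fun q : unitInterval × slitNeg X =>
        (1 - ((q.1 : ℝ) : ℂ)) * (q.2.1.2 : ℂ) - ((q.1 : ℝ) : ℂ) := by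
      have := Units.continuous_val (M := ℂ)
      fun_prop
    refine homotopic_of_family ⟨fun q => (q.2.1.1, Units.mk0 _ (hne q)),
      Continuous.prodMk (by fun_prop) (continuous_units_mk0 hc hne)⟩ (fun q => ?_) fun q => ?_
    · exact Prod.ext rfl (Units.ext (by simp [incl]))
    · exact Prod.ext rfl (Units.ext (by simp [inlAt]))
  have hneg : (inlAt X (-1 : ℂˣ)).Homotopic (inlAt X (1 : ℂˣ)) := by
    let γ := PathConnectedSpace.somePath (-1 : ℂˣ) 1
    exact homotopic_of_family ⟨fun q : unitInterval × X => (q.2, γ q.1), by fun_prop⟩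
      (fun q => Prod.ext rfl γ.source) fun q => Prod.ext rfl γ.target
  rw [eq_comm, sub_eq_iff_eq_add] at ha
  rw [pushH_homotopic 2 hA, pushH_homotopic 2 hB, ← pushH_comp, ← pushH_comp,
    pushH_homotopic 2 hneg, ← pushH_comp] at ha
  exact ⟨_, (map_sub _ _ _).trans (sub_eq_of_eq_add' ha)⟩

end

/-! ### Local sections of orbit spaces of `ℂˣ` -/

section Normalize

variable {P : Type} [TopologicalSpace P] [MulAction ℂˣ P]

/-- The quotient map onto the orbit space. -/
def mkOrbit (P : Type) [TopologicalSpace P] [MulAction ℂˣ P] :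
    C(P, Quotient (MulAction.orbitRel ℂˣ P)) := ⟨Quotient.mk _, continuous_quotient_mk'⟩

lemma isOpenQuotientMap_mkOrbit [ContinuousConstSMul ℂˣ P] : IsOpenQuotientMap (mkOrbit P) :=
  ⟨Quotient.mk_surjective, (mkOrbit P).continuous, isOpenMap_quotient_mk'_mul⟩

lemma mkOrbit_smul (c : ℂˣ) (p : P) : mkOrbit P (c • p) = mkOrbit P p :=
  Quotient.sound ⟨c, rfl⟩

/-- The part of the orbit space where an equivariant function does not vanish. -/
def nonvanishing (l : C(P, ℂ)) : Set (Quotient (MulAction.orbitRel ℂˣ P)) :=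
  {q | ∃ p, mkOrbit P p = q ∧ l p ≠ 0}

variable {l : C(P, ℂ)} (hl : ∀ (c : ℂˣ) (p : P), l (c • p) = c * l p)
include hl

lemma mk_mem_nonvanishing_iff (p : P) : mkOrbit P p ∈ nonvanishing l ↔ l p ≠ 0 := by
  constructor
  · rintro ⟨p', h, h'⟩
    obtain ⟨c, rfl⟩ := MulAction.orbitRel_apply.mp (Quotient.exact h)
    rw [hl] at h'
    exact right_ne_zero_of_mul h'
  · exact fun h => ⟨p, rfl, h⟩

lemma isOpen_nonvanishing [ContinuousConstSMul ℂˣ P] : IsOpen (nonvanishing l) := by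
  rw [← isOpenQuotientMap_mkOrbit.isQuotientMap.isOpen_preimage]
  have h : mkOrbit P ⁻¹' nonvanishing l = {p | l p ≠ 0} := Set.ext fun p => mk_mem_nonvanishing_iff hl p
  rw [h]
  exact isOpen_ne_fun l.continuous continuous_const

lemma exists_normalized (q : nonvanishing l) : ∃ p, mkOrbit P p = q.1 ∧ l p = 1 := by
  obtain ⟨q, p, rfl, h⟩ := q
  refine ⟨(Units.mk0 _ h)⁻¹ • p, mkOrbit_smul _ _, ?_⟩
  rw [hl, Units.val_inv_eq_inv_val, Units.val_mk0, inv_mul_cancel₀ h]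

lemma normalized_unique {p p' : P} (h : mkOrbit P p = mkOrbit P p') (h1 : l p = 1) (h1' : l p' = 1) :
    p = p' := by
  obtain ⟨c, rfl⟩ := MulAction.orbitRel_apply.mp (Quotient.exact h)
  change l (c • p') = 1 at h1
  rw [hl, h1', mul_one] at h1
  have hc : c = 1 := Units.ext h1
  change c • p' = p'
  rw [hc, one_smul]

/-- The representative at which the equivariant function `l` takes the value `1`. -/
def normalize [ContinuousSMul ℂˣ P] : C(nonvanishing l, P) where
  toFun q := (exists_normalized hl q).choose
  continuous_toFun := by
    -- Continuity may be tested upstairs, where the normalized representative of `p` is `(l p)⁻¹ •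
    -- p`.
    have hq := (isOpenQuotientMap_mkOrbit (P := P)).restrictPreimage (nonvanishing l)
    rw [← hq.continuous_comp_iff]
    have h0 : ∀ p : (mkOrbit P ⁻¹' nonvanishing l), l p.1 ≠ 0 := fun p =>
      (mk_mem_nonvanishing_iff hl p.1).mp p.2
    have hc : Continuous fun p : (mkOrbit P ⁻¹' nonvanishing l) => Units.mk0 _ (h0 p) :=
      continuous_units_mk0 (by fun_prop) h0
    refine Continuous.congr (hc.inv.smul continuous_subtype_val) fun p => ?_
    have h := (exists_normalized hl ((nonvanishing l).restrictPreimage (mkOrbit P) p)).choose_spec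
    refine (normalized_unique hl (h.1.trans (mkOrbit_smul _ p.1).symm) h.2 ?_).symm
    rw [hl]
    change (((Units.mk0 _ (h0 p))⁻¹ : ℂˣ) : ℂ) * l p.1 = 1
    rw [Units.val_inv_eq_inv_val, Units.val_mk0, inv_mul_cancel₀ (h0 p)]

variable [ContinuousSMul ℂˣ P]

lemma mk_normalize (q : nonvanishing l) : mkOrbit P (normalize hl q) = q.1 :=
  (exists_normalized hl q).choose_spec.1

lemma apply_normalize (q : nonvanishing l) : l (normalize hl q) = 1 :=
  (exists_normalized hl q).choose_spec.2

lemma normalize_eq (q : nonvanishing l) (p : P) (h : mkOrbit P p = q.1) (h1 : l p = 1) :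
    normalize hl q = p :=
  normalized_unique hl ((mk_normalize hl q).trans h.symm) (apply_normalize hl q) h1

end Normalize

/-! ### The two charts of the projective line and of the associated bundle -/

/-- The first coordinate on `ℂ² ∖ 0`. -/
def coordFst : C(V2, ℂ) := ⟨fun v => (v : ℂ × ℂ).1, by fun_prop⟩

/-- The second coordinate on `ℂ² ∖ 0`. -/
def coordSnd : C(V2, ℂ) := ⟨fun v => (v : ℂ × ℂ).2, by fun_prop⟩

lemma coordFst_smul (c : ℂˣ) (v : V2) : coordFst (c • v) = c * coordFst v := rfl

lemma coordSnd_smul (c : ℂˣ) (v : V2) : coordSnd (c • v) = c * coordSnd v := rfl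

section

variable {M : Type} [TopologicalSpace M] [MulAction ℂˣ M]

/-- The first coordinate on `M × (ℂ² ∖ 0)`. -/
def bundleFst (M : Type) [TopologicalSpace M] : C(M × V2, ℂ) := coordFst.comp ContinuousMap.snd

/-- The second coordinate on `M × (ℂ² ∖ 0)`. -/
def bundleSnd (M : Type) [TopologicalSpace M] : C(M × V2, ℂ) := coordSnd.comp ContinuousMap.snd

lemma bundleFst_smul (c : ℂˣ) (p : M × V2) : bundleFst M (c • p) = c * bundleFst M p := rfl

lemma bundleSnd_smul (c : ℂˣ) (p : M × V2) : bundleSnd M (c • p) = c * bundleSnd M p := rfl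

/-- The bundle projection `E → ℙ¹`. -/
def bundleProj (M : Type) [TopologicalSpace M] [MulAction ℂˣ M] : C(AssocBundle M, P1) where
  toFun := Quotient.lift (fun p : M × V2 => toP1 p.2) (by
    rintro p q ⟨c, rfl⟩
    exact Quotient.sound ⟨c, rfl⟩)
  continuous_toFun := Continuous.quotient_lift (by fun_prop) _

lemma mapsTo_bundleProj_fst :
    Set.MapsTo (bundleProj M) (nonvanishing (bundleFst M)) (nonvanishing coordFst) := by
  rintro _ ⟨p, rfl, h⟩
  exact ⟨p.2, rfl, h⟩

lemma mapsTo_bundleProj_snd :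
    Set.MapsTo (bundleProj M) (nonvanishing (bundleSnd M)) (nonvanishing coordSnd) := by
  rintro _ ⟨p, rfl, h⟩
  exact ⟨p.2, rfl, h⟩

lemma nonvanishing_union : nonvanishing coordFst ∪ nonvanishing coordSnd = Set.univ := by
  refine Set.eq_univ_of_forall fun q => ?_
  obtain ⟨v, rfl⟩ := Quotient.exists_rep q
  by_cases h : (v : ℂ × ℂ).1 = 0
  · exact Or.inr ⟨v, rfl, fun h' => v.2 (Prod.ext h h')⟩
  · exact Or.inl ⟨v, rfl, h⟩

lemma nonvanishing_bundle_union :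
    nonvanishing (bundleFst M) ∪ nonvanishing (bundleSnd M) = Set.univ := by
  refine Set.eq_univ_of_forall fun q => ?_
  obtain ⟨p, rfl⟩ := Quotient.exists_rep q
  by_cases h : (p.2 : ℂ × ℂ).1 = 0
  · exact Or.inr ⟨p, rfl, fun h' => p.2.2 (Prod.ext h h')⟩
  · exact Or.inl ⟨p, rfl, h⟩

variable [ContinuousSMul ℂˣ M]

/-! ### The overlap of the two charts -/

lemma fst_ne_zero_of_mem_overlap (w : (Subtype.val ⁻¹' nonvanishing coordFst : Set (nonvanishing coordSnd))) :
    coordFst (normalize coordSnd_smul w.1) ≠ 0 := by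
  rw [← mk_mem_nonvanishing_iff coordFst_smul, mk_normalize]
  exact w.2

/-- The coordinate `α / β` on the overlap of the two charts of `ℙ¹`. -/
def ratio : C((Subtype.val ⁻¹' nonvanishing coordFst : Set (nonvanishing coordSnd)), ℂˣ) :=
  ⟨fun w => Units.mk0 _ (fst_ne_zero_of_mem_overlap w), continuous_units_mk0 (by fun_prop) _⟩

/-- The overlap of the two charts of `E`. -/
abbrev overlap (M : Type) [TopologicalSpace M] [MulAction ℂˣ M] : Set (nonvanishing (bundleSnd M)) :=
  Subtype.val ⁻¹' nonvanishing (bundleFst M)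

lemma mapsTo_overlap : Set.MapsTo (restr (bundleProj M) mapsTo_bundleProj_snd) (overlap M)
    (Subtype.val ⁻¹' nonvanishing coordFst : Set (nonvanishing coordSnd)) :=
  fun _ h => mapsTo_bundleProj_fst h

/-- The map `M × ℂˣ → E`, `(y, w) ↦ [y, (w, 1)]`, onto the overlap of the charts. -/
def toOverlap (M : Type) [TopologicalSpace M] [MulAction ℂˣ M] : C(M × ℂˣ, overlap M) where
  toFun p := ⟨⟨mkOrbit _ (p.1, chartZero p.2), _, rfl, one_ne_zero⟩, _, rfl, p.2.ne_zero⟩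
  continuous_toFun := by
    have hc : Continuous chartZero := Continuous.subtype_mk (by fun_prop) _
    have := Units.continuous_val (M := ℂ)
    refine Continuous.subtype_mk (Continuous.subtype_mk ((mkOrbit _).continuous.comp ?_) _) _
    fun_prop

/-- The fibre coordinate on the chart `β ≠ 0`. -/
def baseSnd (M : Type) [TopologicalSpace M] [MulAction ℂˣ M] [ContinuousSMul ℂˣ M] :
    C(nonvanishing (bundleSnd M), M) := ContinuousMap.fst.comp (normalize bundleSnd_smul)

/-- The fibre coordinate on the chart `α ≠ 0`. -/
def baseFst (M : Type) [TopologicalSpace M] [MulAction ℂˣ M] [ContinuousSMul ℂˣ M] :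
    C(nonvanishing (bundleFst M), M) := ContinuousMap.fst.comp (normalize bundleFst_smul)

/-- The inverse of `toOverlap`. -/
def fromOverlap (M : Type) [TopologicalSpace M] [MulAction ℂˣ M] [ContinuousSMul ℂˣ M] :
    C(overlap M, M × ℂˣ) :=
  ((baseSnd M).comp (incl (overlap M))).prodMk (ratio.comp (restr _ mapsTo_overlap))

lemma normalize_bundleProj (w : nonvanishing (bundleSnd M)) :
    normalize coordSnd_smul (restr (bundleProj M) mapsTo_bundleProj_snd w) =
      (normalize bundleSnd_smul w).2 := by
  refine normalize_eq _ _ _ ?_ (apply_normalize bundleSnd_smul w)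
  have h := congrArg (bundleProj M) (mk_normalize bundleSnd_smul w)
  exact h

lemma toOverlap_fromOverlap (w : overlap M) : toOverlap M (fromOverlap M w) = w := by
  refine Subtype.ext (Subtype.ext ?_)
  rw [← mk_normalize bundleSnd_smul w.1]
  refine congrArg (mkOrbit (M × V2)) (Prod.ext rfl (Subtype.ext (Prod.ext ?_ ?_)))
  · change coordFst (normalize coordSnd_smul (restr _ mapsTo_bundleProj_snd w.1)) = _
    rw [normalize_bundleProj]
    rfl
  · exact (apply_normalize bundleSnd_smul w.1).symm

lemma baseSnd_toOverlap (p : M × ℂˣ) : baseSnd M (toOverlap M p).1 = p.1 :=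
  congrArg Prod.fst (normalize_eq bundleSnd_smul (toOverlap M p).1 (p.1, chartZero p.2) rfl rfl)

/-! ### The fibres as deformation retracts of the charts -/

/-- The inclusion of the fibre over `[1 : 0]`. -/
def bundleFibre (M : Type) [TopologicalSpace M] [MulAction ℂˣ M] : C(M, AssocBundle M) :=
  ⟨fun x => mkOrbit (M × V2) (x, chartInf 0), by fun_prop⟩

/-- The inclusion of the fibre over `[1 : 0]` into the chart. -/
def fibreFst (M : Type) [TopologicalSpace M] [MulAction ℂˣ M] : C(M, nonvanishing (bundleFst M)) :=
  ⟨fun x => ⟨bundleFibre M x, _, rfl, one_ne_zero⟩, by fun_prop⟩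

/-- The inclusion of the fibre over `[0 : 1]` into the chart. -/
def fibreSnd (M : Type) [TopologicalSpace M] [MulAction ℂˣ M] : C(M, nonvanishing (bundleSnd M)) :=
  ⟨fun x => ⟨mkOrbit (M × V2) (x, chartZero 0), _, rfl, one_ne_zero⟩, by fun_prop⟩

lemma baseFst_fibreFst : (baseFst M).comp (fibreFst M) = ContinuousMap.id M := by
  ext x
  exact congrArg Prod.fst (normalize_eq bundleFst_smul (fibreFst M x) (x, chartInf 0) rfl rfl)

lemma continuous_chartZero : Continuous chartZero := Continuous.subtype_mk (by fun_prop) _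

lemma continuous_chartInf : Continuous chartInf := Continuous.subtype_mk (by fun_prop) _

/-- Scale `w` to `0` in the normalized representative `(x, (1, w))`. -/
lemma fibreFst_baseFst : ((fibreFst M).comp (baseFst M)).Homotopic (ContinuousMap.id _) := by
  have hc := continuous_chartInf
  refine homotopic_of_family ⟨fun q : unitInterval × nonvanishing (bundleFst M) =>
    ⟨mkOrbit (M × V2) (baseFst M q.2,
      chartInf (((q.1 : ℝ) : ℂ) * bundleSnd M (normalize bundleFst_smul q.2))), _, rfl, one_ne_zero⟩,
    Continuous.subtype_mk (by fun_prop) _⟩ (fun q => Subtype.ext ?_) fun q => Subtype.ext ?_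
  · change mkOrbit (M × V2) (_, chartInf (((0 : ℝ) : ℂ) * _)) = mkOrbit (M × V2) _
    rw [Complex.ofReal_zero, zero_mul]
  · change mkOrbit (M × V2) (_, chartInf (((1 : ℝ) : ℂ) * _)) = q.1
    rw [Complex.ofReal_one, one_mul, ← mk_normalize bundleFst_smul q]
    exact congrArg (mkOrbit (M × V2)) (Prod.ext rfl (Subtype.ext (Prod.ext
      (apply_normalize bundleFst_smul q).symm rfl)))

lemma fibreSnd_baseSnd : ((fibreSnd M).comp (baseSnd M)).Homotopic (ContinuousMap.id _) := by
  have hc := continuous_chartZero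
  refine homotopic_of_family ⟨fun q : unitInterval × nonvanishing (bundleSnd M) =>
    ⟨mkOrbit (M × V2) (baseSnd M q.2,
      chartZero (((q.1 : ℝ) : ℂ) * bundleFst M (normalize bundleSnd_smul q.2))), _, rfl, one_ne_zero⟩,
    Continuous.subtype_mk (by fun_prop) _⟩ (fun q => Subtype.ext ?_) fun q => Subtype.ext ?_
  · change mkOrbit (M × V2) (_, chartZero (((0 : ℝ) : ℂ) * _)) = mkOrbit (M × V2) _
    rw [Complex.ofReal_zero, zero_mul]
  · change mkOrbit (M × V2) (_, chartZero (((1 : ℝ) : ℂ) * _)) = q.1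
    rw [Complex.ofReal_one, one_mul, ← mk_normalize bundleSnd_smul q]
    exact congrArg (mkOrbit (M × V2)) (Prod.ext rfl (Subtype.ext (Prod.ext rfl
      (apply_normalize bundleSnd_smul q).symm)))

/-- Keep `x` and move the vector along the segment `(s, 1 - s)`, which avoids the origin. -/
lemma fibreSnd_homotopic_bundleFibre :
    ((incl _).comp (fibreSnd M)).Homotopic (bundleFibre M) := by
  have hne : ∀ s : unitInterval, ((((s : ℝ) : ℂ), 1 - ((s : ℝ) : ℂ)) : ℂ × ℂ) ≠ 0 := fun s h => by
    have h1 : ((s : ℝ) : ℂ) = 0 := congrArg Prod.fst h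
    have h2 : 1 - ((s : ℝ) : ℂ) = 0 := congrArg Prod.snd h
    rw [h1, sub_zero] at h2
    exact one_ne_zero h2
  have hc : Continuous fun s : unitInterval => (⟨_, hne s⟩ : V2) := Continuous.subtype_mk (by fun_prop) _
  refine homotopic_of_family ⟨fun q : unitInterval × M => mkOrbit (M × V2) (q.2, ⟨_, hne q.1⟩),
    by fun_prop⟩ (fun q => ?_) fun q => ?_
  · refine congrArg (mkOrbit (M × V2)) (Prod.ext rfl (Subtype.ext ?_))
    simp [chartZero]
  · refine congrArg (mkOrbit (M × V2)) (Prod.ext rfl (Subtype.ext ?_))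
    simp [chartInf]

/-- Let `m` die in `E`. In the chart `α ≠ 0` it bounds a class of `H₃(E, {α ≠ 0})`, which by
excision comes from the other chart; let `w` be the boundary of the excised class in the overlap `M
× ℂˣ`. Now `w` comes from `H₂(M)` and dies in the chart `β ≠ 0`, whose fibre coordinate recovers
that class of `M`. So `w = 0`, and the fibre coordinate of the first chart gives `m = 0`. -/
theorem bundleFibre_injective [SimplyConnectedSpace M] :
    Function.Injective (pushH 2 (bundleFibre M)) := by
  rw [injective_iff_map_eq_zero]
  intro m hm
  have h1 : pushH 2 (incl _) (pushH 2 (fibreFst M) m) = 0 := (pushH_comp 2 _ _ m).trans hm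
  obtain ⟨y, hy⟩ := (exact_incl 2 _ _).mp h1
  obtain ⟨y', rfl⟩ := excision_surjective (isOpen_nonvanishing bundleFst_smul)
    (isOpen_nonvanishing bundleSnd_smul) (nonvanishing_bundle_union (M := M)) 2 y
  set w : SingH 2 (overlap M) := bdry 2 _ y' with hw
  have h2 : pushH 2 (incl (overlap M)) w = 0 := (exact_incl 2 _ _).mpr ⟨y', rfl⟩
  have h3 : w = 0 := by
    obtain ⟨n, hn⟩ := inlAt_one_surjective (pushH 2 (fromOverlap M) w)
    have h4 : w = pushH 2 ((toOverlap M).comp (inlAt M 1)) n := by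
      rw [← pushH_comp, hn, pushH_comp]
      have : (toOverlap M).comp (fromOverlap M) = ContinuousMap.id _ :=
        ContinuousMap.ext toOverlap_fromOverlap
      rw [this, pushH_id]
    have h5 := congrArg (pushH 2 (baseSnd M)) h2
    rw [h4, map_zero, pushH_comp, pushH_comp] at h5
    have : ((baseSnd M).comp (incl (overlap M))).comp ((toOverlap M).comp (inlAt M 1)) =
        ContinuousMap.id M := ContinuousMap.ext fun x => baseSnd_toOverlap (x, 1)
    rw [this, pushH_id] at h5
    rw [h4, h5, map_zero]
  rw [bdry_natural] at hy
  change pushH 2 _ w = _ at hy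
  rw [h3, map_zero] at hy
  have h6 := congrArg (pushH 2 (baseFst M)) hy
  rw [map_zero, pushH_comp, baseFst_fibreFst, pushH_id] at h6
  exact h6.symm

/-- Excise the image of `e` in `H₂(E, {α ≠ 0})` into the other chart. Its boundary lies in `H₁(M ×
ℂˣ)`; the `M`-component vanishes since `H₁(M) = 0`, and the `ℂˣ`-component because `e` dies in `ℙ¹`,
where excision is injective. So `e` is a sum of classes from the two charts, and both charts retract
onto fibres, which are homotopic in `E`. -/
theorem exists_bundleFibre_of_bundleProj_eq_zero [SimplyConnectedSpace M] (e : SingH 2 (AssocBundle M))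
    (he : pushH 2 (bundleProj M) e = 0) : ∃ m, pushH 2 (bundleFibre M) m = e := by
  obtain ⟨e', he'⟩ := excision_surjective (isOpen_nonvanishing bundleFst_smul)
    (isOpen_nonvanishing bundleSnd_smul) (nonvanishing_bundle_union (M := M)) 1
    (toRel 2 (nonvanishing (bundleFst M)) e)
  have h1 : pushRel 2 (restr (bundleProj M) mapsTo_bundleProj_snd) mapsTo_overlap e' = 0 := by
    apply excision_injective (isOpen_nonvanishing coordFst_smul)
      (isOpen_nonvanishing coordSnd_smul) nonvanishing_union 1
    rw [map_zero]
    have h2 := congrArg (pushRel 2 (bundleProj M) mapsTo_bundleProj_fst) he'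
    rw [toRel_natural, he, map_zero] at h2
    refine Eq.trans ?_ h2
    have h3 := pushRel_comp 2 (bundleProj M) (incl _) mapsTo_bundleProj_fst
      (mapsTo_incl_preimage (nonvanishing (bundleFst M)) (nonvanishing (bundleSnd M))) e'
    have h4 := pushRel_comp 2 (incl (nonvanishing coordSnd)) (restr (bundleProj M) mapsTo_bundleProj_snd)
      (mapsTo_incl_preimage (nonvanishing coordFst) (nonvanishing coordSnd)) mapsTo_overlap e'
    exact h4.trans h3.symm
  set c : SingH 1 (overlap M) := bdry 1 _ e' with hc
  have h3 : c = 0 := by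
    have h4 := congrArg (bdry 1 _) h1
    rw [bdry_natural, map_zero, ← hc] at h4
    have h5 := congrArg (pushH 1 ratio) h4
    rw [map_zero, pushH_comp] at h5
    have x₀ : M := Classical.arbitrary M
    have h6 := singH_one_prod x₀ (1 : ℂˣ) (pushH 1 (fromOverlap M) c)
    rw [singH_one_eq_zero_of_simplyConnected (pushH 1 ContinuousMap.fst _), map_zero, zero_add,
      pushH_comp 1 ContinuousMap.snd] at h6
    have h7 : (ContinuousMap.snd : C(M × ℂˣ, ℂˣ)).comp (fromOverlap M) =
        ratio.comp (restr _ mapsTo_overlap) := rfl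
    rw [h7, h5, map_zero] at h6
    have h8 := congrArg (pushH 1 (toOverlap M)) h6
    have : (toOverlap M).comp (fromOverlap M) = ContinuousMap.id _ :=
      ContinuousMap.ext toOverlap_fromOverlap
    rw [pushH_comp, this, pushH_id, map_zero] at h8
    exact h8
  obtain ⟨f, rfl⟩ := (exact_bdry 1 _ e').mp h3
  rw [toRel_natural, eq_comm, ← sub_eq_zero, ← map_sub, exact_toRel] at he'
  obtain ⟨a, ha⟩ := he'
  refine ⟨pushH 2 (baseFst M) a + pushH 2 (baseSnd M) f, ?_⟩
  have e1 : pushH 2 (bundleFibre M) (pushH 2 (baseFst M) a) = pushH 2 (incl _) a := by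
    have : bundleFibre M = (incl _).comp (fibreFst M) := rfl
    rw [this, ← pushH_comp, pushH_comp 2 (fibreFst M), pushH_id_of_homotopic 2 fibreFst_baseFst]
  have e2 : pushH 2 (bundleFibre M) (pushH 2 (baseSnd M) f) = pushH 2 (incl _) f := by
    rw [← pushH_homotopic 2 fibreSnd_homotopic_bundleFibre, ← pushH_comp, pushH_comp 2 (fibreSnd M),
      pushH_id_of_homotopic 2 fibreSnd_baseSnd]
  rw [map_add, e1, e2, ha, sub_add_cancel]

end

section

variable {M : Type} [TopologicalSpace M] [MulAction ℂˣ M]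

/-! ### Rescaling the family -/

lemma mkTotal_eq (c : ℂˣ) {p q : PreTotal M} (h1 : p.1.1 = c • q.1.1) (h2 : p.1.2.1 = q.1.2.1)
    (h3 : p.1.2.2.1 = q.1.2.2.1) (h4 : p.1.2.2.2 = c • q.1.2.2.2) : mkTotal p = mkTotal q :=
  Quotient.sound ⟨c, Subtype.ext (Prod.ext h1.symm (Prod.ext h2.symm (Prod.ext h3.symm h4.symm)))⟩

lemma mkTotal_congr {p q : PreTotal M} (h1 : p.1.1 = q.1.1) (h2 : p.1.2.1 = q.1.2.1)
    (h3 : p.1.2.2.1 = q.1.2.2.1) (h4 : (p.1.2.2.2 : ℂ × ℂ) = q.1.2.2.2) : mkTotal p = mkTotal q :=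
  mkTotal_eq 1 (h1.trans (one_smul _ _).symm) h2 h3 ((Subtype.ext h4).trans (one_smul _ _).symm)

instance [ContinuousSMul ℂˣ M] : ContinuousSMul ℂˣ (PreTotal M) :=
  ⟨Continuous.subtype_mk (by
    have hv : Continuous fun p : PreTotal M => p.1 := continuous_subtype_val
    have : Continuous fun p : ℂˣ × PreTotal M =>
        (p.1 • p.2.1.1, p.2.1.2.1, p.2.1.2.2.1, p.1 • p.2.1.2.2.2) := by fun_prop
    exact this) _⟩

lemma isOpenQuotientMap_mkTotal [ContinuousSMul ℂˣ M] : IsOpenQuotientMap (mkTotal (M := M)) :=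
  isOpenQuotientMap_mkOrbit

/-- The real multiple `r z` of a point of the disc. -/
def discMul (r : unitInterval) (z : Disc) : Disc := discScale (r, z)

/-- Where `z ≠ 0` the equation `z β = t α` forces `α ≠ 0`, so the factor on `β` matters only at `z =
0`. -/
lemma preTotal_scale_ne_zero (p : PreTotal M) {r : ℝ} (h : (p.1.2.1 : ℂ) = 0 → r ≠ 0) :
    (((p.1.2.2.2 : ℂ × ℂ).1, (r : ℂ) * (p.1.2.2.2 : ℂ × ℂ).2) : ℂ × ℂ) ≠ 0 := by
  intro h0
  have h1 : (p.1.2.2.2 : ℂ × ℂ).1 = 0 := congrArg Prod.fst h0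
  have h2 : (r : ℂ) * (p.1.2.2.2 : ℂ × ℂ).2 = 0 := congrArg Prod.snd h0
  have hz : (p.1.2.1 : ℂ) = 0 := by
    by_contra hz
    exact alpha_ne_zero p hz h1
  refine p.1.2.2.2.2 (Prod.ext h1 ((mul_eq_zero.mp h2).resolve_left ?_))
  exact_mod_cast h hz

/-- The map `(x, z, t, (α, β)) ↦ (x, k z, k r t, (α, r β))`, for real functions `k` and `r` of `z`. -/
def preScale (k : C(unitInterval × Disc, unitInterval)) (r : C(unitInterval × Disc, ℝ))
    (h : ∀ s (z : Disc), (z : ℂ) = 0 → r (s, z) ≠ 0) (q : unitInterval × PreTotal M) : PreTotal M :=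
  ⟨(q.2.1.1, discMul (k (q.1, q.2.1.2.1)) q.2.1.2.1,
    ((k (q.1, q.2.1.2.1) : ℝ) : ℂ) * (r (q.1, q.2.1.2.1) : ℂ) * q.2.1.2.2.1,
    ⟨_, preTotal_scale_ne_zero q.2 (h q.1 q.2.1.2.1)⟩), by
    have h := q.2.2
    change ((k (q.1, q.2.1.2.1) : ℝ) : ℂ) * (q.2.1.2.1 : ℂ) *
      ((r (q.1, q.2.1.2.1) : ℂ) * (q.2.1.2.2.2 : ℂ × ℂ).2) = _ * (q.2.1.2.2.2 : ℂ × ℂ).1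
    linear_combination ((k (q.1, q.2.1.2.1) : ℝ) : ℂ) * (r (q.1, q.2.1.2.1) : ℂ) * h⟩

lemma continuous_preScale (k : C(unitInterval × Disc, unitInterval)) (r : C(unitInterval × Disc, ℝ))
    (h : ∀ s (z : Disc), (z : ℂ) = 0 → r (s, z) ≠ 0) : Continuous (preScale (M := M) k r h) := by
  have hv : Continuous fun p : PreTotal M => p.1 := continuous_subtype_val
  refine Continuous.subtype_mk (Continuous.prodMk (by fun_prop) (Continuous.prodMk ?_
    (Continuous.prodMk ?_ (Continuous.subtype_mk ?_ _)))) _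
  · exact discScale.continuous.comp (by fun_prop)
  · fun_prop
  · fun_prop

/-- The family of self-maps `[x, z, t, (α, β)] ↦ [x, k z, k r t, (α, r β)]` of `𝓔`. -/
def scaleTotal [ContinuousSMul ℂˣ M] (k : C(unitInterval × Disc, unitInterval))
    (r : C(unitInterval × Disc, ℝ)) (h : ∀ s (z : Disc), (z : ℂ) = 0 → r (s, z) ≠ 0) :
    C(unitInterval × Total M, Total M) where
  toFun q := Quotient.lift (fun p => mkTotal (preScale k r h (q.1, p))) (by
    rintro p p' ⟨c, rfl⟩
    refine mkTotal_eq c rfl rfl rfl (Subtype.ext (Prod.ext rfl ?_))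
    change ((r _ : ℝ) : ℂ) * ((c : ℂ) * _) = (c : ℂ) * (((r _ : ℝ) : ℂ) * _)
    exact mul_left_comm _ _ _) q.2
  continuous_toFun := by
    have hq : IsOpenQuotientMap (Prod.map id mkTotal : unitInterval × PreTotal M → _) :=
      IsOpenQuotientMap.id.prodMap isOpenQuotientMap_mkTotal
    rw [← hq.continuous_comp_iff]
    exact mkTotal.continuous.comp (continuous_preScale k r h)

/-! ### The retraction onto the central fibre -/

/-- The function `max 0 (2|z| - 1)` on the disc, with values in the unit interval. -/
def outerRadius : C(Disc, ℝ) := ⟨fun z => max 0 (2 * ‖(z : ℂ)‖ - 1), by fun_prop⟩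

/-- The function `max 0 (1 - 2|z|)` on the disc. -/
def innerRadius : C(Disc, ℝ) := ⟨fun z => max 0 (1 - 2 * ‖(z : ℂ)‖), by fun_prop⟩

lemma outerRadius_nonneg (z : Disc) : 0 ≤ outerRadius z := le_max_left _ _

lemma outerRadius_le_one (z : Disc) : outerRadius z ≤ 1 :=
  max_le zero_le_one (by linarith [z.norm_le])

lemma outerRadius_mul_innerRadius (z : Disc) : outerRadius z * innerRadius z = 0 := by
  change max 0 _ * max 0 _ = _
  rcases le_total (2 * ‖(z : ℂ)‖) 1 with h | h
  · rw [max_eq_left (by linarith : 2 * ‖(z : ℂ)‖ - 1 ≤ 0), zero_mul]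
  · rw [max_eq_left (by linarith : 1 - 2 * ‖(z : ℂ)‖ ≤ 0), mul_zero]

lemma outerRadius_circ {z : Disc} (h : z ∈ circ) : outerRadius z = 1 := by
  have h' : ‖(z : ℂ)‖ = 1 := h
  change max 0 _ = _
  rw [h']
  norm_num

lemma innerRadius_circ {z : Disc} (h : z ∈ circ) : innerRadius z = 0 := by
  have h' : ‖(z : ℂ)‖ = 1 := h
  change max 0 _ = _
  rw [h']
  norm_num

lemma innerRadius_zero {z : Disc} (h : (z : ℂ) = 0) : innerRadius z = 1 := by
  change max 0 _ = _
  rw [h]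
  norm_num

/-- The rescaling of `z` in the retraction. -/
def outerFamily : C(unitInterval × Disc, unitInterval) :=
  ⟨fun q => ⟨1 - (q.1 : ℝ) + q.1 * outerRadius q.2,
    by nlinarith [q.1.2.1, q.1.2.2, outerRadius_nonneg q.2],
    by nlinarith [q.1.2.1, q.1.2.2, outerRadius_le_one q.2]⟩, Continuous.subtype_mk (by fun_prop) _⟩

/-- The rescaling of `β` in the retraction. -/
def innerFamily : C(unitInterval × Disc, ℝ) :=
  ⟨fun q => 1 - (q.1 : ℝ) + q.1 * innerRadius q.2, by fun_prop⟩

lemma innerFamily_ne_zero (s : unitInterval) (z : Disc) (h : (z : ℂ) = 0) :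
    innerFamily (s, z) ≠ 0 := by
  change 1 - (s : ℝ) + s * innerRadius z ≠ 0
  rw [innerRadius_zero h, mul_one, sub_add_cancel]
  exact one_ne_zero

variable [ContinuousSMul ℂˣ M]

/-- The deformation of `𝓔` onto the central fibre. -/
def deformation (M : Type) [TopologicalSpace M] [MulAction ℂˣ M] [ContinuousSMul ℂˣ M] :
    C(unitInterval × Total M, Total M) := scaleTotal outerFamily innerFamily innerFamily_ne_zero

lemma toBlowup_deformation (s : unitInterval) (e : Total M) :
    (toBlowup (deformation M (s, e))).1.2.1 =
      ((outerFamily (s, (toBlowup e).1.1) : ℝ) : ℂ) * (innerFamily (s, (toBlowup e).1.1) : ℂ) *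
        (toBlowup e).1.2.1 := by
  obtain ⟨p, rfl⟩ := Quotient.exists_rep e
  rfl

lemma deformation_zero (e : Total M) : deformation M (0, e) = e := by
  obtain ⟨p, rfl⟩ := Quotient.exists_rep e
  refine mkTotal_congr rfl (Subtype.ext ?_) ?_ (Prod.ext rfl ?_)
  · change ((1 - (0 : ℝ) + 0 * outerRadius _ : ℝ) : ℂ) * _ = _
    simp
  · change ((1 - (0 : ℝ) + 0 * outerRadius _ : ℝ) : ℂ) * ((1 - (0 : ℝ) + 0 * innerRadius _ : ℝ) : ℂ) * _ = _
    simp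
  · change ((1 - (0 : ℝ) + 0 * innerRadius _ : ℝ) : ℂ) * _ = _
    simp

/-- For `|z| = 1` the factor on `z` stays `1` and the factor on `β` is `1 - s`, so `𝓛` is preserved
throughout. -/
lemma deformation_bdryPoint (s : unitInterval) (x : M) (z : circ) (t : ℂ) :
    deformation M (s, bdryPoint x z t) = bdryPoint x z ((1 - (s : ℝ) : ℝ) * t) := by
  have h1 : (outerFamily (s, z.1) : ℝ) = 1 := by
    change 1 - (s : ℝ) + s * outerRadius z.1 = 1
    rw [outerRadius_circ z.2]
    ring
  have h2 : innerFamily (s, z.1) = 1 - (s : ℝ) := by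
    change 1 - (s : ℝ) + s * innerRadius z.1 = _
    rw [innerRadius_circ z.2]
    ring
  refine mkTotal_congr rfl (Subtype.ext ?_) ?_ (Prod.ext rfl ?_)
  · change ((outerFamily (s, z.1) : ℝ) : ℂ) * _ = _
    rw [h1, Complex.ofReal_one, one_mul]
    rfl
  · change ((outerFamily (s, z.1) : ℝ) : ℂ) * (innerFamily (s, z.1) : ℂ) * t = _
    rw [h1, h2, Complex.ofReal_one, one_mul]
    rfl
  · change (innerFamily (s, z.1) : ℂ) * t = _
    rw [h2]
    rfl

lemma deformation_one_mem (e : Total M) : (toBlowup (deformation M (1, e))).1.2.1 = 0 := by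
  rw [toBlowup_deformation]
  have h : (outerFamily (1, (toBlowup e).1.1) : ℝ) * innerFamily (1, (toBlowup e).1.1) = 0 := by
    change (1 - (1 : ℝ) + 1 * outerRadius _) * (1 - (1 : ℝ) + 1 * innerRadius _) = 0
    rw [sub_self, zero_add, one_mul, zero_add, one_mul, outerRadius_mul_innerRadius]
  rw [← Complex.ofReal_mul, h, Complex.ofReal_zero, zero_mul]

/-- The retraction of `𝓔` onto the central fibre. -/
def retraction (M : Type) [TopologicalSpace M] [MulAction ℂˣ M] [ContinuousSMul ℂˣ M] :
    C(Total M, Fibre M 0) :=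
  ⟨fun e => ⟨deformation M (1, e), deformation_one_mem e⟩, by fun_prop⟩

lemma mapsTo_retraction (L : Set M) : Set.MapsTo (retraction M) (totalBdry L) (fibreBdry L 0) := by
  rintro _ ⟨x, hx, z, t, rfl⟩
  refine ⟨x, hx, z, (deformation_bdryPoint 1 x z t).trans ?_⟩
  rw [Set.Icc.coe_one, sub_self, Complex.ofReal_zero, zero_mul]

lemma pushRel_fibreIncl_retraction (L : Set M) (a : RelH 2 (totalBdry L)) :
    pushRel 2 (fibreIncl 0) (mapsTo_fibreIncl L 0) (pushRel 2 (retraction M) (mapsTo_retraction L) a) = a := by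
  rw [pushRel_comp, ← pushRel_homotopic 2 (f := ContinuousMap.id _) (Set.mapsTo_id _) _ (deformation M)
    deformation_zero (fun _ => rfl)]
  · exact pushRel_id 2 _ _ a
  · rintro s _ ⟨x, hx, z, t, rfl⟩
    exact ⟨x, hx, z, _, deformation_bdryPoint s x z t⟩

/-- The deformation multiplies `t` by a factor, so it preserves the central fibre and restricts
there to a homotopy from the identity to the retraction. -/
lemma pushRel_retraction_fibreIncl (L : Set M) (a : RelH 2 (fibreBdry L 0)) :
    pushRel 2 (retraction M) (mapsTo_retraction L) (pushRel 2 (fibreIncl 0) (mapsTo_fibreIncl L 0) a) = a := by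
  have h : ∀ q : unitInterval × Fibre M 0, (toBlowup (deformation M (q.1, q.2.1))).1.2.1 = 0 := fun q => by
    rw [toBlowup_deformation, q.2.2, mul_zero]
  rw [pushRel_comp, ← pushRel_homotopic 2 (f := ContinuousMap.id _) (Set.mapsTo_id _) _
    ⟨fun q : unitInterval × Fibre M 0 => (⟨_, h q⟩ : Fibre M 0), Continuous.subtype_mk (by fun_prop) _⟩
    (fun e => Subtype.ext (deformation_zero e.1)) (fun _ => rfl)]
  · exact pushRel_id 2 _ _ a
  · rintro s e ⟨x, hx, z, he⟩
    refine ⟨x, hx, z, ?_⟩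
    change deformation M (s, e.1) = _
    rw [he, deformation_bdryPoint, mul_zero]

theorem fibreIncl_zero_bijective (L : Set M) :
    Function.Bijective (pushRel 2 (fibreIncl 0) (mapsTo_fibreIncl L 0)) :=
  ⟨Function.LeftInverse.injective (pushRel_retraction_fibreIncl L),
    Function.RightInverse.surjective (pushRel_fibreIncl_retraction L)⟩

/-- The retraction map `H₂(𝓔_t, L̂_t) → H₂(𝓔_0, L̂_0)`. -/
def retractionMap (L : Set M) (t : ℂ) : RelH 2 (fibreBdry L t) →ₗ[ℤ] RelH 2 (fibreBdry L 0) :=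
  pushRel 2 (retraction M) (mapsTo_retraction L) ∘ₗ pushRel 2 (fibreIncl t) (mapsTo_fibreIncl L t)

/-! ### The central fibre and the associated bundle -/

/-- The projection `𝓔 → E`, `[x, z, t, v] ↦ [x, v]`. -/
def totalToBundle (M : Type) [TopologicalSpace M] [MulAction ℂˣ M] : C(Total M, AssocBundle M) where
  toFun := Quotient.lift (fun p : PreTotal M => mkAssoc (p.1.1, p.1.2.2.2)) (by
    rintro p q ⟨c, rfl⟩
    exact Quotient.sound ⟨c, rfl⟩)
  continuous_toFun := by
    have hv : Continuous fun p : PreTotal M => p.1 := continuous_subtype_val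
    exact Continuous.quotient_lift (by fun_prop) _

/-- The projection `𝓔_0 → E`, `[x, z, 0, v] ↦ [x, v]`. -/
def centralToBundle (M : Type) [TopologicalSpace M] [MulAction ℂˣ M] : C(Fibre M 0, AssocBundle M) :=
  (totalToBundle M).comp (fibreIncl 0)

/-- For `t = 0` the equation is `z β = 0`, which survives shrinking `z` with the vector fixed; this
collapses the part `M × 𝔻` onto its fibre in `E`. -/
lemma bundlePart_centralToBundle :
    (bundlePart.comp (centralToBundle M)).Homotopic (ContinuousMap.id (Fibre M 0)) := by
  let k : C(unitInterval × Disc, unitInterval) := ContinuousMap.fst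
  let H : C(unitInterval × Total M, Total M) := scaleTotal k (ContinuousMap.const _ 1)
    fun _ _ _ => one_ne_zero
  have h : ∀ q : unitInterval × Fibre M 0, (toBlowup (H (q.1, q.2.1))).1.2.1 = 0 := by
    rintro ⟨s, e, he⟩
    obtain ⟨p, rfl⟩ := Quotient.exists_rep e
    change _ * _ * p.1.2.2.1 = 0
    exact mul_eq_zero_of_right _ he
  refine homotopic_of_family ⟨fun q => ⟨_, h q⟩, Continuous.subtype_mk (by fun_prop) _⟩ ?_ ?_
  · rintro ⟨e, he⟩
    obtain ⟨p, rfl⟩ := Quotient.exists_rep e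
    refine Subtype.ext (mkTotal_congr rfl (Subtype.ext ?_) ?_ (Prod.ext rfl ?_))
    · change ((0 : ℝ) : ℂ) * _ = 0
      rw [Complex.ofReal_zero, zero_mul]
    · change ((0 : ℝ) : ℂ) * _ * _ = 0
      rw [Complex.ofReal_zero, zero_mul, zero_mul]
    · exact (congrArg (· * _) Complex.ofReal_one).trans (one_mul _)
  · rintro ⟨e, he⟩
    obtain ⟨p, rfl⟩ := Quotient.exists_rep e
    refine Subtype.ext (mkTotal_congr rfl (Subtype.ext ?_) ?_ (Prod.ext rfl ?_))
    · change ((1 : ℝ) : ℂ) * _ = _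
      rw [Complex.ofReal_one, one_mul]
    · change ((1 : ℝ) : ℂ) * ((1 : ℝ) : ℂ) * _ = _
      rw [Complex.ofReal_one, one_mul, one_mul]
    · exact (congrArg (· * _) Complex.ofReal_one).trans (one_mul _)

/-! ### The trivialization of the general fibre -/

/-- The function `β / t`. -/
def betaOver (M : Type) [TopologicalSpace M] [MulAction ℂˣ M] (t : ℂ) : C(PreTotal M, ℂ) :=
  ⟨fun p => (p.1.2.2.2 : ℂ × ℂ).2 / t, by
    have hv : Continuous fun p : PreTotal M => p.1 := continuous_subtype_val
    fun_prop⟩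

omit [ContinuousSMul ℂˣ M] in
lemma betaOver_smul (t : ℂ) (c : ℂˣ) (p : PreTotal M) :
    betaOver M t (c • p) = c * betaOver M t p := mul_div_assoc _ _ _

/-- If `β = 0` then `t α = 0`, and both coordinates of the vector would vanish. -/
lemma fibre_mem_nonvanishing {t : ℂ} (ht : t ≠ 0) (e : Fibre M t) : e.1 ∈ nonvanishing (betaOver M t) := by
  obtain ⟨e, he⟩ := e
  obtain ⟨p, rfl⟩ := Quotient.exists_rep e
  refine ⟨p, rfl, div_ne_zero (fun h => ?_) ht⟩
  have h1 := p.2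
  have h2 : p.1.2.2.1 = t := he
  rw [h, mul_zero, h2] at h1
  exact p.1.2.2.2.2 (Prod.ext ((mul_eq_zero.mp h1.symm).resolve_left ht) h)

/-- The inverse of the trivialization. -/
def untrivialize (M : Type) [TopologicalSpace M] [MulAction ℂˣ M] [ContinuousSMul ℂˣ M] {t : ℂ}
    (ht : t ≠ 0) : C(Fibre M t, M × Disc) where
  toFun e := ((normalize (betaOver_smul t) ⟨e.1, fibre_mem_nonvanishing ht e⟩).1.1, fibreToDisc t e)
  continuous_toFun := by
    have hv : Continuous fun p : PreTotal M => p.1 := continuous_subtype_val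
    have h : Continuous fun e : Fibre M t => (⟨e.1, fibre_mem_nonvanishing ht e⟩ :
      nonvanishing (betaOver M t)) := Continuous.subtype_mk (by fun_prop) _
    fun_prop

/-- Once the representative is normalized to `β = t`, the equation `z t = t α` forces `α = z`. -/
lemma trivialization_untrivialize {t : ℂ} (ht : t ≠ 0) (e : Fibre M t) :
    trivialization t ht (untrivialize M ht e) = e := by
  set p := normalize (betaOver_smul t) ⟨e.1, fibre_mem_nonvanishing ht e⟩ with hp
  have h1 : mkTotal p = e.1 := mk_normalize (betaOver_smul t) ⟨e.1, fibre_mem_nonvanishing ht e⟩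
  have h2 : (p.1.2.2.2 : ℂ × ℂ).2 / t = 1 :=
    apply_normalize (betaOver_smul t) ⟨e.1, fibre_mem_nonvanishing ht e⟩
  rw [div_eq_one_iff_eq ht] at h2
  have h3 : p.1.2.2.1 = t := by
    have := e.2
    rw [← h1] at this
    exact this
  have h4 : (toBlowup e.1).1.1 = p.1.2.1 := by
    rw [← h1]
    rfl
  have h5 := p.2
  rw [h2, h3, mul_comm] at h5
  refine Subtype.ext (Eq.trans (mkTotal_congr (q := p) rfl h4 h3.symm (Prod.ext ?_ h2.symm)) h1)
  exact (congrArg Subtype.val h4).trans (mul_left_cancel₀ ht h5)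

lemma mapsTo_untrivialize (L : Set M) {t : ℂ} (ht : t ≠ 0) :
    Set.MapsTo (untrivialize M ht) (fibreBdry L t) (L ×ˢ circ) := by
  rintro ⟨e, he⟩ ⟨x, hx, z, rfl⟩
  refine ⟨?_, z.2⟩
  have h := normalize_eq (betaOver_smul t) ⟨bdryPoint x z t, fibre_mem_nonvanishing ht ⟨_, he⟩⟩
    (preBdryPoint x z t) rfl (div_self ht)
  change (normalize (betaOver_smul t) _).1.1 ∈ L
  rw [h]
  exact hx

lemma generalClass_surjective (L : Set M) {t : ℂ} (ht : t ≠ 0) :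
    Function.Surjective (generalClass L t ht) := fun a =>
  ⟨pushRel 2 (untrivialize M ht) (mapsTo_untrivialize L ht) a, by
    have h : (trivialization t ht).comp (untrivialize M ht) = ContinuousMap.id _ :=
      ContinuousMap.ext (trivialization_untrivialize ht)
    rw [generalClass, pushRel_comp]
    simp only [h]
    exact pushRel_id 2 _ _ a⟩

end

section

variable {M : Type} [TopologicalSpace M] [MulAction ℂˣ M]

/-! ### Points of the central fibre and of the associated bundle -/

lemma mkAssoc_eq (c : ℂˣ) {p q : M × V2} (h1 : p.1 = c • q.1) (h2 : (p.2 : ℂ × ℂ) = (c : ℂ) • (q.2 : ℂ × ℂ)) :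
    mkAssoc p = mkAssoc q :=
  Quotient.sound ⟨c, Prod.ext h1.symm (Subtype.ext h2.symm)⟩

lemma mkAssoc_congr {p q : M × V2} (h1 : p.1 = q.1) (h2 : (p.2 : ℂ × ℂ) = q.2) :
    mkAssoc p = mkAssoc q := congrArg _ (Prod.ext h1 (Subtype.ext h2))

/-- The point `[x, z, 0, v]` of `𝓔_0`. -/
def centralPoint (x : M) (z : Disc) (v : V2) (h : (z : ℂ) * (v : ℂ × ℂ).2 = 0) : Fibre M 0 :=
  ⟨mkTotal ⟨(x, z, 0, v), h.trans (zero_mul _).symm⟩, rfl⟩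

lemma continuous_centralPoint {W : Type} [TopologicalSpace W] {x : W → M} {z : W → Disc} {v : W → V2}
    (hx : Continuous x) (hz : Continuous z) (hv : Continuous v)
    (h : ∀ w, (z w : ℂ) * (v w : ℂ × ℂ).2 = 0) :
    Continuous fun w => centralPoint (x w) (z w) (v w) (h w) :=
  Continuous.subtype_mk (mkTotal.continuous.comp (Continuous.subtype_mk (by fun_prop) _)) _

/-! ### The sphere completing a disc with boundary `z ↦ z⁻¹ x₀` -/

lemma cap_ne_zero (c : ℂˣ) (z : Disc) :
    (((z : ℂ), (1 - ((‖(z : ℂ)‖ : ℝ) : ℂ)) * c) : ℂ × ℂ) ≠ 0 := by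
  intro h
  have h1 : (z : ℂ) = 0 := congrArg Prod.fst h
  have h2 : (1 - ((‖(z : ℂ)‖ : ℝ) : ℂ)) * c = 0 := congrArg Prod.snd h
  rw [h1] at h2
  simp at h2

/-- The map `z ↦ (z, (1 - |z|) c)`. -/
def cap : C(ℂˣ × Disc, V2) :=
  ⟨fun q => ⟨_, cap_ne_zero q.1 q.2⟩, by
    have := Units.continuous_val (M := ℂ)
    exact Continuous.subtype_mk (by fun_prop) _⟩

lemma cap_circ (c : ℂˣ) {z : Disc} (hz : z ∈ circ) : (cap (c, z) : ℂ × ℂ) = ((z : ℂ), 0) := by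
  have h : ‖(z : ℂ)‖ = 1 := hz
  refine Prod.ext rfl ?_
  change (1 - ((‖(z : ℂ)‖ : ℝ) : ℂ)) * c = 0
  rw [h, Complex.ofReal_one, sub_self, zero_mul]

/-- The section `z ↦ [x₀, (z, (1 - |z|) c)]` over the disc. -/
def capSection (x₀ : M) (c : ℂˣ) : C(Disc, AssocBundle M) := ⟨fun z => mkAssoc (x₀, cap (c, z)), by fun_prop⟩

/-- `α z = z⁻¹ x₀` on the circle. -/
def BoundsInverseOrbit (x₀ : M) (α : C(Disc, M)) : Prop := ∀ z : circ, α z = (circUnit z)⁻¹ • x₀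

/-- On the circle the vector is `(z, 0)`; dividing by `z` gives `(1, 0)` and turns `x₀` into `z⁻¹ x₀
= α z`. -/
lemma capSection_circ {x₀ : M} {α : C(Disc, M)} (hα : BoundsInverseOrbit x₀ α) (c : ℂˣ) :
    ∀ z ∈ circ, capSection x₀ c z = bundleFibre M (α z) := fun z hz => by
  refine mkAssoc_eq (circUnit ⟨z, hz⟩) ?_ ?_
  · change x₀ = circUnit ⟨z, hz⟩ • α z
    rw [hα ⟨z, hz⟩, smul_inv_smul]
  · refine (cap_circ c hz).trans ?_
    change ((z : ℂ), (0 : ℂ)) = (z : ℂ) • ((1 : ℂ), (0 : ℂ))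
    simp

/-- The class of the sphere formed by the section over the disc and the disc `α` in the fibre over
`[1 : 0]`. -/
def capClass {x₀ : M} {α : C(Disc, M)} (hα : BoundsInverseOrbit x₀ α) (c : ℂˣ) :
    SingH 2 (AssocBundle M) :=
  sphereDiff (capSection x₀ c) ((bundleFibre M).comp α) (capSection_circ hα c)

/-- Move the constant along a path in `ℂˣ`. The retraction of `𝓔_t` produces `c = t`, whereas the
standard sphere has `c = 1`. -/
lemma capClass_eq {x₀ : M} {α : C(Disc, M)} (hα : BoundsInverseOrbit x₀ α) (c c' : ℂˣ) :
    capClass hα c = capClass hα c' := by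
  let γ := PathConnectedSpace.somePath c c'
  have h := sphereDiff_family
    ⟨fun q : unitInterval × Disc => capSection x₀ (γ q.1) q.2, by
      change Continuous fun q : unitInterval × Disc => mkAssoc (x₀, cap (γ q.1, q.2))
      fun_prop⟩
    ⟨fun q : unitInterval × Disc => bundleFibre M (α q.2), by fun_prop⟩
    (f₀ := capSection x₀ c) (f₁ := capSection x₀ c') (g₀ := (bundleFibre M).comp α)
    (g₁ := (bundleFibre M).comp α)
    (fun s => capSection_circ hα (γ s)) (fun z => congrArg (fun c => capSection x₀ c z) γ.source)
    (fun _ => rfl) (fun z => congrArg (fun c => capSection x₀ c z) γ.target) (fun _ => rfl)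
  exact h

/-! ### The retraction of a constant section -/

/-- The radius of the outer part, in the family shrinking it to the boundary. -/
def shrinkOuter : C(unitInterval × Disc, unitInterval) :=
  ⟨fun q => ⟨max 0 ((2 - (q.1 : ℝ)) * ‖(q.2 : ℂ)‖ - 1), le_max_left _ _,
    max_le zero_le_one (by nlinarith [q.1.2.1, q.1.2.2, q.2.norm_le, norm_nonneg (q.2 : ℂ)])⟩,
    Continuous.subtype_mk (by fun_prop) _⟩

/-- The radius of the inner part, in the family enlarging it to the whole disc. -/
def growInner : C(unitInterval × Disc, ℝ) :=
  ⟨fun q => max 0 (1 - (2 - (q.1 : ℝ)) * ‖(q.2 : ℂ)‖), by fun_prop⟩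

lemma shrinkOuter_mul_growInner (q : unitInterval × Disc) :
    (shrinkOuter q : ℝ) * growInner q = 0 := by
  change max 0 _ * max 0 _ = _
  rcases le_total ((2 - (q.1 : ℝ)) * ‖(q.2 : ℂ)‖) 1 with h | h
  · rw [max_eq_left (sub_nonpos.mpr h), zero_mul]
  · rw [max_eq_left (sub_nonpos.mpr h), mul_zero]

lemma shrinkOuter_circ (s : unitInterval) {z : Disc} (hz : z ∈ circ) :
    (shrinkOuter (s, z) : ℝ) = 1 - s := by
  have h : ‖(z : ℂ)‖ = 1 := hz
  change max 0 ((2 - (s : ℝ)) * ‖(z : ℂ)‖ - 1) = _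
  rw [h, max_eq_right (by linarith [s.2.2])]
  ring

lemma growInner_circ (s : unitInterval) {z : Disc} (hz : z ∈ circ) : growInner (s, z) = 0 := by
  have h : ‖(z : ℂ)‖ = 1 := hz
  change max 0 (1 - (2 - (s : ℝ)) * ‖(z : ℂ)‖) = _
  rw [h]
  exact max_eq_left (by linarith [s.2.2])

lemma shrinkOuter_one (z : Disc) : (shrinkOuter (1, z) : ℝ) = 0 := by
  refine max_eq_left ?_
  have := z.norm_le
  rw [Set.Icc.coe_one]
  linarith

lemma growInner_one (z : Disc) : growInner (1, z) = 1 - ‖(z : ℂ)‖ := by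
  refine (max_eq_right ?_).trans ?_
  · have := z.norm_le
    rw [Set.Icc.coe_one]
    linarith
  · rw [Set.Icc.coe_one]
    ring

lemma growInner_ne_zero (c : ℂˣ) (q : unitInterval × Disc) :
    (((q.2 : ℂ), (growInner q : ℂ) * c) : ℂ × ℂ) ≠ 0 := by
  intro h
  have h1 : (q.2 : ℂ) = 0 := congrArg Prod.fst h
  have h2 : (growInner q : ℂ) * c = 0 := congrArg Prod.snd h
  have h3 : growInner q = 1 := by
    change max 0 (1 - (2 - (q.1 : ℝ)) * ‖(q.2 : ℂ)‖) = 1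
    rw [h1]
    simp
  rw [h3, Complex.ofReal_one, one_mul] at h2
  exact c.ne_zero h2

/-- A point of the family connecting the retraction of a constant section to a section over the
exceptional curve. -/
def retractPoint (x₀ : M) (c : ℂˣ) (q : unitInterval × Disc) : Fibre M 0 :=
  centralPoint x₀ (discMul (shrinkOuter q) q.2) ⟨_, growInner_ne_zero c q⟩ (by
    change ((shrinkOuter q : ℝ) : ℂ) * (q.2 : ℂ) * ((growInner q : ℂ) * c) = 0
    have h : (((shrinkOuter q : ℝ) : ℂ) * (growInner q : ℂ)) = 0 := by
      rw [← Complex.ofReal_mul, shrinkOuter_mul_growInner, Complex.ofReal_zero]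
    linear_combination (q.2 : ℂ) * c * h)

/-- The family connecting the retraction of a constant section to a section over the exceptional
curve. -/
def retractFamily (x₀ : M) (c : ℂˣ) : C(unitInterval × Disc, Fibre M 0) :=
  ⟨retractPoint x₀ c, continuous_centralPoint continuous_const (discScale.continuous.comp (by fun_prop))
    (Continuous.subtype_mk (by fun_prop) _) _⟩

/-- The family contracting the disc part `z ↦ [α z, z, 0, (1, 0)]` to the fibre over `[1 : 0]`. -/
def contractFamily (α : C(Disc, M)) : C(unitInterval × Disc, Fibre M 0) :=
  ⟨fun q => centralPoint (α q.2) (discMul (unitInterval.symm q.1) q.2) (chartInf 0) (mul_zero _),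
    continuous_centralPoint (by fun_prop) (discScale.continuous.comp (by fun_prop)) continuous_const _⟩

lemma retractFamily_circ {x₀ : M} {α : C(Disc, M)} (hα : BoundsInverseOrbit x₀ α) (c : ℂˣ)
    (s : unitInterval) : ∀ z ∈ circ, retractFamily x₀ c (s, z) = contractFamily α (s, z) := fun z hz => by
  refine Subtype.ext (mkTotal_eq (circUnit ⟨z, hz⟩) ?_ (Subtype.ext ?_) rfl (Subtype.ext (Prod.ext ?_ ?_)))
  · change x₀ = circUnit ⟨z, hz⟩ • α z
    rw [hα ⟨z, hz⟩, smul_inv_smul]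
  · change ((shrinkOuter (s, z) : ℝ) : ℂ) * (z : ℂ) = ((1 - (s : ℝ) : ℝ) : ℂ) * (z : ℂ)
    rw [shrinkOuter_circ s hz]
  · exact (mul_one _).symm
  · change (growInner (s, z) : ℂ) * c = (z : ℂ) * 0
    rw [growInner_circ s hz, Complex.ofReal_zero, zero_mul, mul_zero]

/-- The image of a constant section under the retraction. -/
def retractDisc (x₀ : M) (c : ℂˣ) : C(Disc, Fibre M 0) :=
  ⟨fun z => retractFamily x₀ c (0, z), by fun_prop⟩

lemma retractDisc_circ (x₀ : M) (c : ℂˣ) (z : circ) : (retractDisc x₀ c z.1).1 = bdryPoint x₀ z 0 := by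
  refine mkTotal_congr rfl (Subtype.ext ?_) rfl (Prod.ext rfl ?_)
  · change ((shrinkOuter (0, z.1) : ℝ) : ℂ) * (z.1 : ℂ) = (z.1 : ℂ)
    rw [shrinkOuter_circ 0 z.2, Set.Icc.coe_zero, sub_zero, Complex.ofReal_one, one_mul]
  · change (growInner (0, z.1) : ℂ) * c = 0
    rw [growInner_circ 0 z.2, Complex.ofReal_zero, zero_mul]

lemma mapsTo_retractDisc {L : Set M} {x₀ : M} (h₀ : x₀ ∈ L) (c : ℂˣ) :
    Set.MapsTo (retractDisc x₀ c) circ (fibreBdry L 0) :=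
  fun z hz => ⟨x₀, h₀, ⟨z, hz⟩, retractDisc_circ x₀ c ⟨z, hz⟩⟩

variable [ContinuousSMul ℂˣ M]

/-- The representative `(x, z, t, (z, t))` shows that the constant is `t`; at parameter `0` the
radii `shrinkOuter` and `growInner` are the final factors of the deformation. -/
lemma retraction_trivialization {t : ℂ} (ht : t ≠ 0) (x : M) (z : Disc) :
    retraction M (trivialization t ht (x, z)).1 = retractDisc x (Units.mk0 t ht) z := by
  have h1 : (outerFamily (1, z) : ℝ) = shrinkOuter (0, z) := by
    change 1 - (1 : ℝ) + 1 * outerRadius z = max 0 ((2 - (0 : ℝ)) * ‖(z : ℂ)‖ - 1)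
    rw [sub_self, zero_add, one_mul, sub_zero]
    rfl
  have h2 : innerFamily (1, z) = growInner (0, z) := by
    change 1 - (1 : ℝ) + 1 * innerRadius z = max 0 (1 - (2 - (0 : ℝ)) * ‖(z : ℂ)‖)
    rw [sub_self, zero_add, one_mul, sub_zero]
    rfl
  refine Subtype.ext (mkTotal_congr rfl (Subtype.ext ?_) (deformation_one_mem (trivialization t ht (x, z)).1) (Prod.ext rfl ?_))
  · exact congrArg (fun a : ℝ => (a : ℂ) * (z : ℂ)) h1
  · exact congrArg (fun a : ℝ => (a : ℂ) * t) h2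

lemma retractionMap_generalClass_hatZero {L : Set M} {x₀ : M} (h₀ : x₀ ∈ L) {t : ℂ} (ht : t ≠ 0) :
    retractionMap L t (generalClass L t ht (hatZero h₀)) =
      pushRel 2 (retractDisc x₀ (Units.mk0 t ht)) (mapsTo_retractDisc h₀ _) discClass := by
  rw [retractionMap, LinearMap.comp_apply, generalClass, hatZero, pushRel_comp, pushRel_comp, pushRel_comp]
  have h : (((retraction M).comp (fibreIncl t)).comp (trivialization t ht)).comp (inrAt x₀ Disc) =
      retractDisc x₀ (Units.mk0 t ht) := ContinuousMap.ext fun z => retraction_trivialization ht x₀ z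
  simp only [h]

/-- The inclusion of `(M, L)` into the central fibre, as the fibre over the boundary point `1`. -/
def boundaryFibre (M : Type) [TopologicalSpace M] [MulAction ℂˣ M] : C(M, Fibre M 0) :=
  discPart.comp (inlAt M (ofCircle 1))

lemma mapsTo_boundaryFibre {L : Set M} (hL : CircleInvariant L) :
    Set.MapsTo (boundaryFibre M) L (fibreBdry L 0) := (mapsTo_discPart hL).comp (mapsTo_inlAt_one L)

lemma pushRel_discPart_fibreOne {L : Set M} (hL : CircleInvariant L) (β : RelH 2 L) :
    pushRel 2 discPart (mapsTo_discPart hL) (fibreOne L β) =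
      pushRel 2 (boundaryFibre M) (mapsTo_boundaryFibre hL) β := pushRel_comp 2 _ _ _ _ _

/-- Over the boundary point `z = 1` the retraction merely replaces `t` by `0`. -/
lemma retractionMap_generalClass_fibreOne {L : Set M} (hL : CircleInvariant L) {t : ℂ} (ht : t ≠ 0)
    (β : RelH 2 L) : retractionMap L t (generalClass L t ht (fibreOne L β)) =
      pushRel 2 (boundaryFibre M) (mapsTo_boundaryFibre hL) β := by
  rw [retractionMap, LinearMap.comp_apply, generalClass, fibreOne, pushRel_comp, pushRel_comp, pushRel_comp]
  have h : (((retraction M).comp (fibreIncl t)).comp (trivialization t ht)).comp (inlAt M (ofCircle 1)) =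
      boundaryFibre M := ContinuousMap.ext fun x => by
    refine (retraction_trivialization ht x (ofCircle 1)).trans ?_
    refine Subtype.ext ((retractDisc_circ x _ ⟨_, one_mem_circ⟩).trans ?_)
    exact mkTotal_congr rfl rfl rfl rfl
  simp only [h]

/-- The retraction of a constant section is a sphere in `E` plus a disc in `M × 𝔻`. -/
theorem pushRel_retractDisc {L : Set M} (hL : CircleInvariant L) {x₀ : M} (h₀ : x₀ ∈ L) (c : ℂˣ)
    {α : C(Disc, M)} (hα : BoundsInverseOrbit x₀ α)
    (hg : Set.MapsTo (α.prodMk (ContinuousMap.id Disc)) circ (L ×ˢ circ)) :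
    pushRel 2 (retractDisc x₀ c) (mapsTo_retractDisc h₀ c) discClass =
      glue hL (capClass hα 1) (pushRel 2 (α.prodMk (ContinuousMap.id Disc)) hg discClass) := by
  let g₀ : C(Disc, Fibre M 0) := discPart.comp (α.prodMk (ContinuousMap.id Disc))
  have hg₀ : Set.MapsTo g₀ circ (fibreBdry L 0) := (mapsTo_discPart hL).comp hg
  have e0 : ∀ z, contractFamily α (0, z) = g₀ z := fun z => by
    refine Subtype.ext (mkTotal_congr rfl (Subtype.ext ?_) rfl rfl)
    change ((1 - (0 : ℝ) : ℝ) : ℂ) * (z : ℂ) = z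
    rw [sub_zero, Complex.ofReal_one, one_mul]
  have e1 : ∀ z, contractFamily α (1, z) = (bundlePart.comp ((bundleFibre M).comp α)) z := fun z => by
    refine Subtype.ext (mkTotal_congr rfl (Subtype.ext ?_) rfl rfl)
    change ((1 - (1 : ℝ) : ℝ) : ℂ) * (z : ℂ) = 0
    rw [sub_self, Complex.ofReal_zero, zero_mul]
  have e2 : ∀ z, retractFamily x₀ c (1, z) = (bundlePart.comp (capSection x₀ c)) z := fun z => by
    refine Subtype.ext (mkTotal_congr rfl (Subtype.ext ?_) rfl (Prod.ext rfl ?_))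
    · change ((shrinkOuter (1, z) : ℝ) : ℂ) * (z : ℂ) = 0
      rw [shrinkOuter_one, Complex.ofReal_zero, zero_mul]
    · change (growInner (1, z) : ℂ) * c = (1 - ((‖(z : ℂ)‖ : ℝ) : ℂ)) * c
      rw [growInner_one, Complex.ofReal_sub, Complex.ofReal_one]
  -- Shrinking the `z`-coordinates carries the sphere made of the retracted section and the graph of
  -- `α` into `E`. The common boundary leaves `L̂_0` on the way, so the homotopy is one of closed
  -- spheres; relative classes are taken only afterwards.
  have h := sphereDiff_family (retractFamily x₀ c) (contractFamily α) (retractFamily_circ hα c)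
    (f₀ := retractDisc x₀ c) (g₀ := g₀) (fun _ => rfl) e0 e2 e1
  have h2 := congrArg (toRel 2 (fibreBdry L 0)) h
  rw [toRel_sphereDiff _ _ _ (mapsTo_retractDisc h₀ c) hg₀, sub_eq_iff_eq_add] at h2
  rw [h2, glue, capClass_eq hα 1 c, capClass, pushH_sphereDiff, pushRel_comp]

/-- The retraction of a section class in terms of a disc bounding the inverse orbit. -/
theorem retractionMap_generalClass {L : Set M} (hconn : IsPathConnected L) (hL : CircleInvariant L)
    {x₀ : M} (h₀ : x₀ ∈ L) {t : ℂ} (ht : t ≠ 0) {α : C(Disc, M)} (hα : BoundsInverseOrbit x₀ α)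
    (hm : Set.MapsTo α circ L) {β : RelH 2 L} {b b' : RelH 2 (L ×ˢ circ : Set (M × Disc))}
    (hb : IsHat L β b) (hb' : IsHat L (pushRel 2 α hm discClass + β) b') :
    retractionMap L t (generalClass L t ht b) = glue hL (capClass hα 1) b' := by
  have hg : Set.MapsTo (α.prodMk (ContinuousMap.id Disc)) circ (L ×ˢ circ) := fun z hz => ⟨hm hz, hz⟩
  rw [isHat_iff hconn h₀] at hb hb'
  have h1 := (isHat_iff hconn h₀ _ _).mp (isHat_graph α hm hg)
  have h2 : b' = fibreOne L β + pushRel 2 (α.prodMk (ContinuousMap.id Disc)) hg discClass := by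
    rw [hb', h1, map_add, add_comm (fibreOne L _), add_assoc]
  rw [hb, map_add, map_add, retractionMap_generalClass_fibreOne hL, retractionMap_generalClass_hatZero,
    pushRel_retractDisc hL h₀ _ hα hg, h2, glue, glue, map_add, pushRel_discPart_fibreOne hL]
  exact add_left_comm _ _ _

end

section

variable {M : Type} [TopologicalSpace M] [MulAction ℂˣ M] [ContinuousSMul ℂˣ M]

lemma smul_eq_of_boundsInverseOrbit {x₀ : M} {α : C(Disc, M)} (hα : BoundsInverseOrbit x₀ α) (z : circ) :
    x₀ = circUnit z • α z := by rw [hα z, smul_inv_smul]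

lemma cap_one (z : Disc) : (cap (1, z) : ℂ × ℂ) = ((z : ℂ), 1 - ((‖(z : ℂ)‖ : ℝ) : ℂ)) :=
  Prod.ext rfl (mul_one _)

lemma collapse_eq (z : Disc) : collapse z = toP1 (cap (1, z)) :=
  congrArg toP1 (Subtype.ext (cap_one z).symm)

lemma sphereDiff_congr {X : Type} [TopologicalSpace X] {f f' g g' : C(Disc, X)} (hf : f = f') (hg : g = g')
    (h : ∀ z ∈ circ, f z = g z) :
    sphereDiff f g h = sphereDiff f' g' (fun z hz => by rw [← hf, ← hg, h z hz]) := by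
  subst hf hg
  rfl

/-! ### The sphere class of the maximal section -/

lemma toUnits_exp_arg (z : circ) : Circle.toUnits (Circle.exp (Complex.arg ((z : Disc) : ℂ))) = circUnit z := by
  have hz : ‖((z : Disc) : ℂ)‖ = 1 := z.2
  refine Units.ext ?_
  change ((Circle.exp (Complex.arg ((z : Disc) : ℂ)) : Circle) : ℂ) = ((z : Disc) : ℂ)
  have h := Complex.norm_mul_exp_arg_mul_I ((z : Disc) : ℂ)
  rw [hz, Complex.ofReal_one, one_mul] at h
  rw [Circle.coe_exp, h]

lemma arg_discMul {r : unitInterval} (hr : 0 < (r : ℝ)) (z : Disc) :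
    Complex.arg (discMul r z : ℂ) = Complex.arg (z : ℂ) := Complex.arg_real_mul _ hr

lemma pathDisc_discMul (γ : C(unitInterval, M)) (h0 : ∀ c : ℂˣ, c • γ 0 = γ 0) (r : unitInterval) (z : circ) :
    pathDisc γ h0 (discMul r z) = (circUnit z)⁻¹ • γ r := by
  have hz : ‖((z : Disc) : ℂ)‖ = 1 := z.2
  have hn : ‖(discMul r z : ℂ)‖ = r := by
    change ‖((r : ℝ) : ℂ) * ((z : Disc) : ℂ)‖ = r
    rw [norm_mul, hz, mul_one, Complex.norm_real, Real.norm_of_nonneg r.2.1]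
  have hr : (⟨‖(discMul r z : ℂ)‖, norm_nonneg _, (discMul r z.1).norm_le⟩ : unitInterval) = r :=
    Subtype.ext hn
  change (Circle.toUnits (Circle.exp (Complex.arg (discMul r z : ℂ))))⁻¹ •
    γ ⟨‖(discMul r z : ℂ)‖, norm_nonneg _, (discMul r z.1).norm_le⟩ = _
  rw [hr]
  rcases eq_or_lt_of_le r.2.1 with h | h
  · have h' : r = 0 := Subtype.ext h.symm
    rw [h']
    exact (h0 _).trans (h0 _).symm
  · rw [arg_discMul h, toUnits_exp_arg]

lemma pathDisc_of_eq_zero (γ : C(unitInterval, M)) (h0 : ∀ c : ℂˣ, c • γ 0 = γ 0) (w : Disc)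
    (hw : (w : ℂ) = 0) : pathDisc γ h0 w = γ 0 := by
  have hr : (⟨‖(w : ℂ)‖, norm_nonneg _, w.norm_le⟩ : unitInterval) = 0 :=
    Subtype.ext (norm_eq_zero.mpr hw)
  change (Circle.toUnits (Circle.exp (Complex.arg (w : ℂ))))⁻¹ • γ ⟨‖(w : ℂ)‖, norm_nonneg _, w.norm_le⟩ = _
  rw [hr]
  exact h0 _

lemma boundsInverseOrbit_pathDisc (γ : C(unitInterval, M)) (h0 : ∀ c : ℂˣ, c • γ 0 = γ 0) :
    BoundsInverseOrbit (γ 1) (pathDisc γ h0) := fun z => by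
  rw [← pathDisc_discMul γ h0 1 z]
  refine congrArg _ (Subtype.ext ?_)
  exact (one_mul _).symm.trans (congrArg (· * _) Complex.ofReal_one.symm)

/-- The part of the disc of radius `r` bounds the inverse orbit of `γ r`, so sliding the base point
back along `γ` shrinks the cap to a constant. Section and constant cap then move together through
fixed points to `p`, where they are the image of the standard sphere under the fixed section. -/
lemma capClass_pathDisc (γ : C(unitInterval, M)) {p : M} (hp : ∀ c : ℂˣ, c • p = p)
    (h0 : ∀ c : ℂˣ, c • γ 0 = γ 0) (hj : JoinedIn {x : M | ∀ c : ℂˣ, c • x = x} p (γ 0)) :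
    capClass (boundsInverseOrbit_pathDisc γ h0) 1 = pushH 2 (fixedSection hp) sphereClass := by
  obtain ⟨δ, hδ⟩ := hj
  have hc : Continuous fun q : unitInterval × Disc => discMul (unitInterval.symm q.1) q.2 :=
    discScale.continuous.comp (by fun_prop)
  have e1 := sphereDiff_family
    ⟨fun q : unitInterval × Disc => mkAssoc (γ (unitInterval.symm q.1), cap (1, q.2)), by fun_prop⟩
    ⟨fun q : unitInterval × Disc => bundleFibre M (pathDisc γ h0 (discMul (unitInterval.symm q.1) q.2)),
      by fun_prop⟩
    (fun s z hz => by
      refine mkAssoc_eq (circUnit ⟨z, hz⟩) ?_ ?_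
      · change γ _ = circUnit ⟨z, hz⟩ • pathDisc γ h0 (discMul _ _)
        rw [pathDisc_discMul γ h0 _ ⟨z, hz⟩, smul_inv_smul]
      · refine (cap_circ 1 hz).trans ?_
        change ((z : ℂ), (0 : ℂ)) = (z : ℂ) • ((1 : ℂ), (0 : ℂ))
        simp)
    (f₀ := capSection (γ 1) 1) (g₀ := (bundleFibre M).comp (pathDisc γ h0))
    (f₁ := capSection (γ 0) 1) (g₁ := ContinuousMap.const _ (bundleFibre M (γ 0)))
    (fun z => by simp [capSection]) (fun z => by
      refine congrArg (fun z => bundleFibre M (pathDisc γ h0 z)) (Subtype.ext ?_)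
      change ((1 - (0 : ℝ) : ℝ) : ℂ) * (z : ℂ) = z
      rw [sub_zero, Complex.ofReal_one, one_mul])
    (fun z => by simp [capSection]) (fun z => by
      refine congrArg (bundleFibre M) (pathDisc_of_eq_zero γ h0 _ ?_)
      change ((1 - (1 : ℝ) : ℝ) : ℂ) * (z : ℂ) = 0
      rw [sub_self, Complex.ofReal_zero, zero_mul])
  have e2 := sphereDiff_family
    ⟨fun q : unitInterval × Disc => mkAssoc (δ q.1, cap (1, q.2)), by fun_prop⟩
    ⟨fun q : unitInterval × Disc => bundleFibre M (δ q.1), by fun_prop⟩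
    (fun s z hz => by
      refine mkAssoc_eq (circUnit ⟨z, hz⟩) (hδ s _).symm ?_
      refine (cap_circ 1 hz).trans ?_
      change ((z : ℂ), (0 : ℂ)) = (z : ℂ) • ((1 : ℂ), (0 : ℂ))
      simp)
    (f₀ := capSection p 1) (g₀ := ContinuousMap.const _ (bundleFibre M p))
    (f₁ := capSection (γ 0) 1) (g₁ := ContinuousMap.const _ (bundleFibre M (γ 0)))
    (fun z => by simp [capSection]) (fun z => by simp) (fun z => by simp [capSection]) (fun z => by simp)
  refine e1.trans (e2.symm.trans ?_)
  rw [sphereClass_eq]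
  refine Eq.trans ?_ (pushH_sphereDiff _ _ _ _).symm
  have h1 : (fixedSection hp).comp collapse = capSection p 1 := ContinuousMap.ext fun z =>
    congrArg (fixedSection hp) (collapse_eq z)
  have h2 : (fixedSection hp).comp (ContinuousMap.const Disc infPt) = ContinuousMap.const Disc (bundleFibre M p) := rfl
  exact sphereDiff_congr h1.symm h2.symm _

/-! ### The sphere class of the section of an orbit disc -/

/-- On the circle conjugation is inversion, so it turns the orbit into the inverse orbit. -/
lemma boundsInverseOrbit_conjDisc {L : Set M} {u : C(Disc, M)} (hu : IsOrbitDisc L u) :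
    BoundsInverseOrbit (u (ofCircle 1)) (u.comp conjDisc) := fun z => by
  have hz : ‖((z : Disc) : ℂ)‖ = 1 := z.2
  let c : Circle := ⟨((z : Disc) : ℂ), mem_sphere_zero_iff_norm.mpr hz⟩
  have h := hu.2 c⁻¹
  have e1 : ofCircle c⁻¹ = conjDisc z := Subtype.ext (Circle.coe_inv_eq_conj c)
  have e2 : Circle.toUnits c⁻¹ = (circUnit z)⁻¹ := by
    rw [map_inv]
    exact congrArg _ (Units.ext rfl)
  rw [e1, e2] at h
  exact h

lemma clamp_of_norm_le {w : ℂ} (h : ‖w‖ ≤ 1) : (clamp w : ℂ) = w := by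
  change w / ((max 1 ‖w‖ : ℝ) : ℂ) = w
  rw [max_eq_left h, Complex.ofReal_one, div_one]

/-- This includes `|w| = 1`, where the definition uses the other chart and the equivariance of `u`
reconciles the two formulas. -/
lemma sectionOf_outer {L : Set M} {u : C(Disc, M)} (hu : IsOrbitDisc L u) (v : V2) (w : Disc)
    (hv : (v : ℂ × ℂ).1 ≠ 0) (hw : (v : ℂ × ℂ).2 / (v : ℂ × ℂ).1 = w) :
    sectionOf hu (toP1 v) = mkAssoc (u w, chartInf w) := by
  change preSectionOf u v = _
  have hcl : clamp (w : ℂ) = w := Subtype.ext (clamp_of_norm_le w.norm_le)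
  rw [preSectionOf]
  split_ifs with h
  · have h1 : ‖(w : ℂ)‖ = 1 := by
      refine le_antisymm w.norm_le ?_
      rw [← hw, norm_div, one_le_div (norm_pos_iff.mpr hv)]
      exact h
    let c : Circle := ⟨(w : ℂ), mem_sphere_zero_iff_norm.mpr h1⟩
    have h2 : u w = Circle.toUnits c • u (ofCircle 1) := hu.2 c
    have h3 : (w : ℂ) ≠ 0 := norm_ne_zero_iff.mp (by rw [h1]; exact one_ne_zero)
    rw [h2]
    refine (mkAssoc_eq (Circle.toUnits c) rfl ?_).symm
    change ((1 : ℂ), (w : ℂ)) = (w : ℂ) • ((v : ℂ × ℂ).1 / (v : ℂ × ℂ).2, (1 : ℂ))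
    have h4 : (v : ℂ × ℂ).1 / (v : ℂ × ℂ).2 = (w : ℂ)⁻¹ := by rw [← hw, inv_div]
    rw [h4, Prod.smul_mk, smul_eq_mul, smul_eq_mul, mul_inv_cancel₀ h3, mul_one]
  · rw [hw, hcl]

lemma sectionOf_inner {L : Set M} {u : C(Disc, M)} (hu : IsOrbitDisc L u) (v : V2)
    (h : ‖(v : ℂ × ℂ).1‖ ≤ ‖(v : ℂ × ℂ).2‖) :
    sectionOf hu (toP1 v) = mkAssoc (u (ofCircle 1), chartZero ((v : ℂ × ℂ).1 / (v : ℂ × ℂ).2)) :=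
  if_pos h

lemma mul_conj_circ {z : Disc} (hz : z ∈ circ) : (z : ℂ) * (conjDisc z : ℂ) = 1 := by
  have h : ‖(z : ℂ)‖ = 1 := hz
  change (z : ℂ) * (starRingEnd ℂ) (z : ℂ) = 1
  rw [Complex.mul_conj, Complex.normSq_eq_norm_sq, h]
  simp

/-- The radius `1 - s / 2`. -/
def halfRadius : C(unitInterval, unitInterval) :=
  ⟨fun s => ⟨1 - (s : ℝ) / 2, by linarith [s.2.2], by linarith [s.2.1]⟩, Continuous.subtype_mk (by fun_prop) _⟩

/-- The ratio `s / (2 - s)`. -/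
def halfRatio : C(unitInterval, unitInterval) :=
  ⟨fun s => ⟨(s : ℝ) / (2 - s), div_nonneg s.2.1 (by linarith [s.2.2]),
      (div_le_one (by linarith [s.2.2])).mpr (by linarith [s.2.2])⟩,
    Continuous.subtype_mk (Continuous.div (by fun_prop) (by fun_prop) fun s => by
      have := s.2.2
      linarith) _⟩

lemma norm_discMul (r : unitInterval) (z : Disc) : ‖(discMul r z : ℂ)‖ = r * ‖(z : ℂ)‖ := by
  change ‖((r : ℝ) : ℂ) * (z : ℂ)‖ = _
  rw [norm_mul, Complex.norm_real, Real.norm_of_nonneg r.2.1]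

lemma two_sub_norm_ne_zero (z : Disc) : (2 - ((‖(z : ℂ)‖ : ℝ) : ℂ)) ≠ 0 := by
  have := z.norm_le
  exact_mod_cast (by linarith : (0 : ℝ) < 2 - ‖(z : ℂ)‖).ne'

/-- The section `z ↦ [x₀, (z / (2 - |z|), 1)]`, one half of the section of an orbit disc. -/
def innerHalf (x₀ : M) : C(Disc, AssocBundle M) :=
  ⟨fun z => mkAssoc (x₀, chartZero ((z : ℂ) / (2 - ((‖(z : ℂ)‖ : ℝ) : ℂ)))), by
    have := continuous_chartZero
    have h : Continuous fun z : Disc => (z : ℂ) / (2 - ((‖(z : ℂ)‖ : ℝ) : ℂ)) :=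
      Continuous.div (by fun_prop) (by fun_prop) two_sub_norm_ne_zero
    fun_prop⟩

/-- The section `z ↦ [u(z̄), (1, z̄)]`, the other half of the section of an orbit disc. -/
def outerHalf (u : C(Disc, M)) : C(Disc, AssocBundle M) :=
  ⟨fun z => mkAssoc (u (conjDisc z), chartInf (conjDisc z)), by
    have := continuous_chartInf
    fun_prop⟩

lemma innerHalf_eq_outerHalf {L : Set M} {u : C(Disc, M)} (hu : IsOrbitDisc L u) :
    ∀ z ∈ circ, innerHalf (u (ofCircle 1)) z = outerHalf u z := fun z hz => by
  have h : ‖(z : ℂ)‖ = 1 := hz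
  refine mkAssoc_eq (circUnit ⟨z, hz⟩)
    (smul_eq_of_boundsInverseOrbit (boundsInverseOrbit_conjDisc hu) ⟨z, hz⟩) ?_
  change ((z : ℂ) / (2 - ((‖(z : ℂ)‖ : ℝ) : ℂ)), (1 : ℂ)) = (z : ℂ) • ((1 : ℂ), (conjDisc z : ℂ))
  rw [Prod.smul_mk, smul_eq_mul, smul_eq_mul, mul_conj_circ hz, h, mul_one, Complex.ofReal_one]
  norm_num

/-- Restrict `collapse` to radius `1 - s / 2` and fill the missing neighbourhood of `[1 : 0]` by `w
↦ [u w, (1, w)]`. On the rim `w = β / α = s / (2 - s) · z̄`, which explains `halfRatio`. At `s = 1`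
the cut is the equator `|α| = |β|`, where the section changes charts. -/
lemma sphereClass_sectionOf {L : Set M} {u : C(Disc, M)} (hu : IsOrbitDisc L u) :
    pushH 2 (sectionOf hu) sphereClass =
      sphereDiff (innerHalf (u (ofCircle 1))) (outerHalf u) (innerHalf_eq_outerHalf hu) := by
  have hc : Continuous fun q : unitInterval × Disc => discMul (halfRadius q.1) q.2 :=
    discScale.continuous.comp (by fun_prop)
  have hm : Continuous fun q : unitInterval × Disc => discMul (halfRatio q.1) (conjDisc q.2) :=
    discScale.continuous.comp (by fun_prop)
  have hi := continuous_chartInf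
  rw [sphereClass_eq]
  refine (pushH_sphereDiff _ _ _ _).trans (sphereDiff_family
    ⟨fun q : unitInterval × Disc => sectionOf hu (collapse (discMul (halfRadius q.1) q.2)), by fun_prop⟩
    ⟨fun q : unitInterval × Disc => mkAssoc (u (discMul (halfRatio q.1) (conjDisc q.2)),
      chartInf (discMul (halfRatio q.1) (conjDisc q.2))),
      mkAssoc.continuous.comp ((u.continuous.comp hm).prodMk (hi.comp (continuous_subtype_val.comp hm)))⟩
    (fun s z hz => ?_) (fun z => ?_) (fun z => ?_) (fun z => ?_) (fun z => ?_))
  · have h : ‖(z : ℂ)‖ = 1 := hz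
    have h0 : (z : ℂ) ≠ 0 := circ_ne_zero ⟨z, hz⟩
    have hs := s.2.2
    have hs2 : (2 - ((s : ℝ) : ℂ)) ≠ 0 := by exact_mod_cast (by linarith : (0 : ℝ) < 2 - s).ne'
    have e1 : (discMul (halfRadius s) z : ℂ) = (1 - ((s : ℝ) : ℂ) / 2) * z := by
      change ((1 - (s : ℝ) / 2 : ℝ) : ℂ) * (z : ℂ) = _
      push_cast
      rfl
    have e3 : (1 - ((s : ℝ) : ℂ) / 2) ≠ 0 := by
      intro h'
      apply hs2
      linear_combination 2 * h'
    change sectionOf hu (collapse (discMul (halfRadius s) z)) = _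
    rw [collapse_eq]
    refine sectionOf_outer hu _ (discMul (halfRatio s) (conjDisc z)) ?_ ?_
    · change (discMul (halfRadius s) z : ℂ) ≠ 0
      rw [e1]
      exact mul_ne_zero e3 h0
    · rw [cap_one, norm_discMul, h, e1]
      change (1 - (((1 - (s : ℝ) / 2) * 1 : ℝ) : ℂ)) / _ = (((s : ℝ) / (2 - s) : ℝ) : ℂ) * (conjDisc z : ℂ)
      have e4 := mul_conj_circ hz
      push_cast
      rw [div_eq_iff (mul_ne_zero e3 h0)]
      have e5 : (1 - ((s : ℝ) : ℂ) / 2) = (2 - ((s : ℝ) : ℂ)) / 2 := by ring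
      rw [e5]
      have e6 : ((s : ℝ) : ℂ) / (2 - ((s : ℝ) : ℂ)) * (2 - ((s : ℝ) : ℂ)) = ((s : ℝ) : ℂ) := div_mul_cancel₀ _ hs2
      linear_combination (-(z : ℂ) * (conjDisc z : ℂ) / 2) * e6 - (((s : ℝ) : ℂ) / 2) * e4
  · refine congrArg (fun z => sectionOf hu (collapse z)) (Subtype.ext ?_)
    change ((1 - (0 : ℝ) / 2 : ℝ) : ℂ) * (z : ℂ) = z
    simp
  · have e1 : (discMul (halfRatio 0) (conjDisc z) : ℂ) = 0 := by
      change (((0 : ℝ) / (2 - 0) : ℝ) : ℂ) * _ = 0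
      simp
    refine (sectionOf_outer hu ⟨(1, 0), fun h => one_ne_zero (congrArg Prod.fst h)⟩ _ one_ne_zero ?_).symm
    rw [e1]
    exact zero_div _
  · have h1 := z.norm_le
    have e1 : (discMul (halfRadius 1) z : ℂ) = (z : ℂ) / 2 := by
      change ((1 - (1 : ℝ) / 2 : ℝ) : ℂ) * (z : ℂ) = _
      push_cast
      ring
    have e2 : ((halfRadius 1 : unitInterval) : ℝ) = 1 / 2 := by
      change 1 - (1 : ℝ) / 2 = 1 / 2
      norm_num
    change sectionOf hu (collapse (discMul (halfRadius 1) z)) = _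
    rw [collapse_eq, sectionOf_inner]
    · refine mkAssoc_congr rfl (Prod.ext ?_ rfl)
      change (cap (1, discMul (halfRadius 1) z) : ℂ × ℂ).1 / (cap (1, discMul (halfRadius 1) z) : ℂ × ℂ).2 =
        (z : ℂ) / (2 - ((‖(z : ℂ)‖ : ℝ) : ℂ))
      rw [cap_one, norm_discMul, e1, e2]
      have h3 : (1 - ((1 / 2 * ‖(z : ℂ)‖ : ℝ) : ℂ)) = (2 - ((‖(z : ℂ)‖ : ℝ) : ℂ)) / 2 := by
        push_cast
        ring
      rw [h3, div_div_div_cancel_right₀ two_ne_zero]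
    · rw [cap_one, norm_discMul, e2]
      have h3 : (1 - ((1 / 2 * ‖(z : ℂ)‖ : ℝ) : ℂ)) = ((1 - 1 / 2 * ‖(z : ℂ)‖ : ℝ) : ℂ) := by push_cast; rfl
      rw [h3, Complex.norm_real, Real.norm_of_nonneg (by linarith)]
      linarith
  · refine congrArg (fun z => mkAssoc (u z, chartInf z)) (Subtype.ext ?_)
    change (((1 : ℝ) / (2 - 1) : ℝ) : ℂ) * (conjDisc z : ℂ) = conjDisc z
    norm_num

/-- The function `((1 - s) / (2 - |z|) + s) z`. -/
def interpolateFst : C(unitInterval × Disc, ℂ) :=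
  ⟨fun q => ((1 - ((q.1 : ℝ) : ℂ)) / (2 - ((‖(q.2 : ℂ)‖ : ℝ) : ℂ)) + ((q.1 : ℝ) : ℂ)) * (q.2 : ℂ), by
    have h : Continuous fun q : unitInterval × Disc =>
        (1 - ((q.1 : ℝ) : ℂ)) / (2 - ((‖(q.2 : ℂ)‖ : ℝ) : ℂ)) :=
      Continuous.div (by fun_prop) (by fun_prop) fun q => two_sub_norm_ne_zero q.2
    fun_prop⟩

/-- The function `1 - s |z|`. -/
def interpolateSnd : C(unitInterval × Disc, ℂ) :=
  ⟨fun q => 1 - ((q.1 : ℝ) : ℂ) * ((‖(q.2 : ℂ)‖ : ℝ) : ℂ), by fun_prop⟩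

/-- The second entry vanishes only for `s = |z| = 1`, where the first is `z ≠ 0`. -/
lemma interpolate_ne_zero (q : unitInterval × Disc) : (interpolateFst q, interpolateSnd q) ≠ (0 : ℂ × ℂ) := by
  obtain ⟨s, z⟩ := q
  intro h
  have h1 : ((1 - ((s : ℝ) : ℂ)) / (2 - ((‖(z : ℂ)‖ : ℝ) : ℂ)) + ((s : ℝ) : ℂ)) * (z : ℂ) = 0 :=
    congrArg Prod.fst h
  have h2 : 1 - ((s : ℝ) : ℂ) * ((‖(z : ℂ)‖ : ℝ) : ℂ) = 0 := congrArg Prod.snd h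
  have h3 : 1 - (s : ℝ) * ‖(z : ℂ)‖ = 0 := by exact_mod_cast h2
  have hz := z.norm_le
  have hs : (s : ℝ) = 1 := by nlinarith [s.2.1, s.2.2, norm_nonneg (z : ℂ)]
  rw [hs, Complex.ofReal_one, sub_self, zero_div, zero_add, one_mul] at h1
  rw [h1, hs] at h3
  simp at h3

/-- The family of lifts `(((1 - s) / (2 - |z|) + s) z, 1 - s |z|)`. -/
def interpolate : C(unitInterval × Disc, V2) :=
  ⟨fun q => ⟨(interpolateFst q, interpolateSnd q), interpolate_ne_zero q⟩,
    Continuous.subtype_mk (by fun_prop) _⟩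

lemma interpolate_zero (z : Disc) :
    (interpolate (0, z) : ℂ × ℂ) = chartZero ((z : ℂ) / (2 - ((‖(z : ℂ)‖ : ℝ) : ℂ))) := by
  refine Prod.ext ?_ ?_
  · change ((1 - ((0 : ℝ) : ℂ)) / (2 - ((‖(z : ℂ)‖ : ℝ) : ℂ)) + ((0 : ℝ) : ℂ)) * (z : ℂ) = _ / _
    rw [Complex.ofReal_zero]
    ring
  · change 1 - ((0 : ℝ) : ℂ) * _ = 1
    rw [Complex.ofReal_zero, zero_mul, sub_zero]

lemma interpolate_one (z : Disc) : (interpolate (1, z) : ℂ × ℂ) = cap (1, z) := by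
  rw [cap_one]
  refine Prod.ext ?_ ?_
  · change ((1 - ((1 : ℝ) : ℂ)) / (2 - ((‖(z : ℂ)‖ : ℝ) : ℂ)) + ((1 : ℝ) : ℂ)) * (z : ℂ) = z
    rw [Complex.ofReal_one]
    ring
  · change 1 - ((1 : ℝ) : ℂ) * _ = _
    rw [Complex.ofReal_one, one_mul]

lemma interpolate_circ (s : unitInterval) {z : Disc} (hz : z ∈ circ) :
    (interpolate (s, z) : ℂ × ℂ) = (z : ℂ) • ((1 : ℂ), (1 - ((s : ℝ) : ℂ)) * (conjDisc z : ℂ)) := by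
  have h : ‖(z : ℂ)‖ = 1 := hz
  refine Prod.ext ?_ ?_
  · change ((1 - ((s : ℝ) : ℂ)) / (2 - ((‖(z : ℂ)‖ : ℝ) : ℂ)) + ((s : ℝ) : ℂ)) * (z : ℂ) = (z : ℂ) * 1
    rw [h, Complex.ofReal_one]
    ring
  · change 1 - ((s : ℝ) : ℂ) * ((‖(z : ℂ)‖ : ℝ) : ℂ) = (z : ℂ) * ((1 - ((s : ℝ) : ℂ)) * (conjDisc z : ℂ))
    rw [h, Complex.ofReal_one]
    linear_combination -(1 - ((s : ℝ) : ℂ)) * mul_conj_circ hz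

/-- Scaling `w` to `(1 - s) w` pushes the outer half of `σ(u)` into the fibre over `[1 : 0]`;
`interpolate` keeps the inner half attached to it and ends at the cap section. -/
lemma capClass_conjDisc {L : Set M} {u : C(Disc, M)} (hu : IsOrbitDisc L u) :
    capClass (boundsInverseOrbit_conjDisc hu) 1 = pushH 2 (sectionOf hu) sphereClass := by
  rw [sphereClass_sectionOf]
  have hi := continuous_chartInf
  let F : C(unitInterval × Disc, AssocBundle M) :=
    ⟨fun q => mkAssoc (u (ofCircle 1), interpolate q), by fun_prop⟩
  let G : C(unitInterval × Disc, AssocBundle M) :=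
    ⟨fun q => mkAssoc (u (conjDisc q.2), chartInf ((1 - ((q.1 : ℝ) : ℂ)) * (conjDisc q.2 : ℂ))), by fun_prop⟩
  have hFG : ∀ s, ∀ z ∈ circ, F (s, z) = G (s, z) := fun s z hz =>
    mkAssoc_eq (circUnit ⟨z, hz⟩)
      (smul_eq_of_boundsInverseOrbit (boundsInverseOrbit_conjDisc hu) ⟨z, hz⟩) (interpolate_circ s hz)
  have hF₀ : ∀ z, F (0, z) = innerHalf (u (ofCircle 1)) z := fun z =>
    mkAssoc_congr rfl (interpolate_zero z)
  have hF₁ : ∀ z, F (1, z) = capSection (u (ofCircle 1)) 1 z := fun z =>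
    mkAssoc_congr rfl (interpolate_one z)
  have hG₀ : ∀ z, G (0, z) = outerHalf u z := fun z => by
    refine mkAssoc_congr rfl (Prod.ext rfl ?_)
    change (1 - ((0 : ℝ) : ℂ)) * _ = _
    rw [Complex.ofReal_zero, sub_zero, one_mul]
    rfl
  have hG₁ : ∀ z, G (1, z) = (bundleFibre M).comp (u.comp conjDisc) z := fun z => by
    refine mkAssoc_congr rfl (Prod.ext rfl ?_)
    change (1 - ((1 : ℝ) : ℂ)) * _ = 0
    rw [Complex.ofReal_one, sub_self, zero_mul]
  exact (sphereDiff_family F G hFG hF₀ hG₀ hF₁ hG₁).symm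

lemma orbitDiscClass_conj {L : Set M} (hL : CircleInvariant L) {u : C(Disc, M)} (hu : IsOrbitDisc L u)
    (hm : Set.MapsTo (u.comp conjDisc) circ L) :
    pushRel 2 (u.comp conjDisc) hm discClass = -orbitDiscClass hL hu := by
  have h := pushRel_comp 2 u conjDisc (hu.mapsTo hL) mapsTo_conjDisc discClass
  rw [pushRel_conjDisc, map_neg] at h
  exact h.symm

end

section

variable {M : Type} [TopologicalSpace M] [MulAction ℂˣ M] [ContinuousSMul ℂˣ M]

/-! ### Boundaries -/

lemma bdryProj_of_eq {L : Set M} {t : ℂ} {e : fibreBdry L t} {x : M} {z : circ}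
    (h : e.1.1 = bdryPoint x z t) : (bdryProj L t e : M) = x := by
  have h1 : coord scaleOne e.1.1 = scaleOne (preBdryPoint x z t) • x := by
    rw [h]
    exact coord_mk scaleOne_smul (preBdryPoint x z t) (circ_ne_zero z)
  have h2 : scaleOne (preBdryPoint x z t) = 1 :=
    Units.ext ((scaleOne_val (preBdryPoint x z t) (circ_ne_zero z)).trans (div_self (circ_ne_zero z)))
  rw [h2, one_smul] at h1
  exact h1

lemma bdryProjZero_of_eq {L : Set M} (hL : CircleInvariant L) {e : fibreBdry L 0} {x : M} {z : circ}
    (h : e.1.1 = bdryPoint x z 0) : (bdryProjZero hL e : M) = (circUnit z)⁻¹ • x := by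
  have h1 : coord scaleZero e.1.1 = scaleZero (preBdryPoint x z 0) • x := by
    rw [h]
    exact coord_mk scaleZero_smul (preBdryPoint x z 0) (circ_ne_zero z)
  have h2 : scaleZero (preBdryPoint x z 0) = (circUnit z)⁻¹ := by
    apply Units.ext
    rw [scaleZero_val (preBdryPoint x z 0) (circ_ne_zero z), Units.val_inv_eq_inv_val, one_div]
    rfl
  rw [h2] at h1
  exact h1

lemma bdryGeneral_generalClass {L : Set M} {t : ℂ} (ht : t ≠ 0) (b : RelH 2 (L ×ˢ circ : Set (M × Disc))) :
    bdryGeneral L t (generalClass L t ht b) =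
      pushH 1 (restr ContinuousMap.fst (mapsTo_fst_prod L circ)) (bdry 1 _ b) := by
  rw [bdryGeneral, LinearMap.comp_apply, generalClass, bdry_natural, pushH_comp]
  have h : (bdryProj L t).comp (restr (trivialization t ht) (mapsTo_trivialization L t ht)) =
      restr ContinuousMap.fst (mapsTo_fst_prod L circ) := ContinuousMap.ext fun p =>
    Subtype.ext (bdryProj_of_eq (z := ⟨p.1.2, p.2.2⟩) rfl)
  rw [h]

/-- The boundary of the constant section projects to a point of `L`, so only `β` contributes. -/
lemma bdryGeneral_fibreOne_add_hatZero {L : Set M} {x₀ : M} (h₀ : x₀ ∈ L) {t : ℂ} (ht : t ≠ 0) (β : RelH 2 L) :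
    bdryGeneral L t (generalClass L t ht (fibreOne L β + hatZero h₀)) = bdry 1 L β := by
  rw [bdryGeneral_generalClass, map_add, map_add, fibreOne, hatZero, bdry_natural, bdry_natural, pushH_comp,
    pushH_comp]
  have h1 : (restr (ContinuousMap.fst : C(M × Disc, M)) (mapsTo_fst_prod L circ)).comp
      (restr (inlAt M (ofCircle 1)) (mapsTo_inlAt_one L)) = ContinuousMap.id L := rfl
  have h2 : (restr (ContinuousMap.fst : C(M × Disc, M)) (mapsTo_fst_prod L circ)).comp
      (restr (inrAt x₀ Disc) (mapsTo_inrAt h₀)) = ContinuousMap.const circ (⟨x₀, h₀⟩ : L) := rfl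
  rw [h1, h2, pushH_id]
  exact (congrArg _ (pushH_const 0 _ _)).trans (add_zero _)

lemma bdryPoint_circUnit_smul (x : M) (z : circ) :
    bdryPoint (circUnit z • x) z 0 = (discPart (x, z.1)).1 := by
  refine mkTotal_eq (circUnit z) rfl rfl rfl (Subtype.ext ?_)
  change (((z : Disc) : ℂ), (0 : ℂ)) = ((z : Disc) : ℂ) • ((1 : ℂ), (0 : ℂ))
  simp

lemma bdryProjZero_discPart {L : Set M} (hL : CircleInvariant L) (p : (L ×ˢ circ : Set (M × Disc))) :
    (bdryProjZero hL (restr discPart (mapsTo_discPart hL) p) : M) = p.1.1 := by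
  rw [bdryProjZero_of_eq hL (bdryPoint_circUnit_smul p.1.1 ⟨p.1.2, p.2.2⟩).symm, inv_smul_smul]

lemma bdryProjZero_boundaryFibre {L : Set M} (hL : CircleInvariant L) :
    (bdryProjZero hL).comp (restr (boundaryFibre M) (mapsTo_boundaryFibre hL)) = ContinuousMap.id L :=
  ContinuousMap.ext fun x => Subtype.ext
    (bdryProjZero_discPart hL (restr (inlAt M (ofCircle 1)) (mapsTo_inlAt_one L) x))

lemma bdryCentral_boundaryFibre {L : Set M} (hL : CircleInvariant L) (β : RelH 2 L) :
    bdryCentral hL (pushRel 2 (boundaryFibre M) (mapsTo_boundaryFibre hL) β) = bdry 1 L β := by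
  rw [bdryCentral, LinearMap.comp_apply, bdry_natural, pushH_comp, bdryProjZero_boundaryFibre, pushH_id]

/-- The boundary point `[x, z, 0, (z, 0)]` has `L`-coordinate `z⁻¹ x`. The inverse orbit is the
orbit composed with conjugation, which reverses orientation. -/
lemma bdryCentral_retractDisc {L : Set M} (hL : CircleInvariant L) (x : L) (c : ℂˣ) :
    bdryCentral hL (pushRel 2 (retractDisc x.1 c) (mapsTo_retractDisc x.2 c) discClass) = -orbitClass hL x := by
  have h1 := congrArg (bdry 1 circ) pushRel_conjDisc
  rw [bdry_natural, map_neg] at h1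
  rw [bdryCentral, LinearMap.comp_apply, bdry_natural, pushH_comp, orbitClass, circleClass, ← map_neg, ← h1,
    pushH_comp]
  have h : (bdryProjZero hL).comp (restr (retractDisc x.1 c) (mapsTo_retractDisc x.2 c)) =
      (orbitMap hL x).comp (restr conjDisc mapsTo_conjDisc) := ContinuousMap.ext fun z => Subtype.ext (by
    refine (bdryProjZero_of_eq hL (retractDisc_circ x.1 c z)).trans ?_
    have e : (circUnit z)⁻¹ = circUnit (restr conjDisc mapsTo_conjDisc z) := by
      rw [inv_eq_iff_mul_eq_one]
      exact Units.ext (mul_conj_circ z.2)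
    rw [e]
    rfl)
  rw [h]

lemma bdry_orbitDiscClass {L : Set M} (hL : CircleInvariant L) {u : C(Disc, M)} (hu : IsOrbitDisc L u) :
    bdry 1 L (orbitDiscClass hL hu) = orbitClass hL ⟨u (ofCircle 1), hu.1⟩ := by
  rw [orbitDiscClass, bdry_natural, orbitClass, circleClass]
  have h : restr u (hu.mapsTo hL) = orbitMap hL ⟨u (ofCircle 1), hu.1⟩ := ContinuousMap.ext fun z =>
    Subtype.ext (hu.2 ⟨((z : Disc) : ℂ), mem_sphere_zero_iff_norm.mpr z.2⟩)
  rw [h]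

/-! ### Section classes -/

lemma mem_secClasses_iff {L : Set M} (hconn : IsPathConnected L) {x₀ : M} (h₀ : x₀ ∈ L) {t : ℂ} (ht : t ≠ 0)
    (a : RelH 2 (fibreBdry L t)) :
    a ∈ secClasses L t ↔ ∃ β, a = generalClass L t ht (fibreOne L β + hatZero h₀) := by
  have h1 : ∀ b, pushRel 2 (fibreToDisc t) (mapsTo_fibreToDisc L t) (generalClass L t ht b) =
      pushRel 2 ContinuousMap.snd (mapsTo_snd_prod L circ) b := fun b => pushRel_comp 2 _ _ _ _ b
  constructor
  · obtain ⟨b, rfl⟩ := generalClass_surjective L ht a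
    intro h
    have h2 : IsHat L (pushRel 2 ContinuousMap.fst (mapsTo_fst_prod L circ) b) b := ⟨rfl, (h1 b).symm.trans h⟩
    exact ⟨_, congrArg _ ((isHat_iff hconn h₀ _ _).mp h2)⟩
  · rintro ⟨β, rfl⟩
    exact (h1 _).trans ((isHat_iff hconn h₀ β _).mpr rfl).2

lemma retractionMap_fibreOne_add_hatZero {L : Set M} (hL : CircleInvariant L) {x₀ : M} (h₀ : x₀ ∈ L) {t : ℂ}
    (ht : t ≠ 0) (β : RelH 2 L) :
    retractionMap L t (generalClass L t ht (fibreOne L β + hatZero h₀)) =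
      pushRel 2 (boundaryFibre M) (mapsTo_boundaryFibre hL) β +
        pushRel 2 (retractDisc x₀ (Units.mk0 t ht)) (mapsTo_retractDisc h₀ _) discClass := by
  rw [map_add, map_add, retractionMap_generalClass_fibreOne hL, retractionMap_generalClass_hatZero]

theorem bdryCentral_retractionMap {L : Set M} (hconn : IsPathConnected L) (hL : CircleInvariant L) (x : L)
    {t : ℂ} (ht : t ≠ 0) (a : RelH 2 (fibreBdry L t)) (ha : a ∈ secClasses L t) :
    bdryCentral hL (retractionMap L t a) = bdryGeneral L t a - orbitClass hL x := by
  obtain ⟨β, rfl⟩ := (mem_secClasses_iff hconn x.2 ht a).mp ha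
  rw [retractionMap_fibreOne_add_hatZero hL, map_add, bdryCentral_boundaryFibre, bdryCentral_retractDisc,
    bdryGeneral_fibreOne_add_hatZero, sub_eq_add_neg]

lemma pushRel_fibreToBlowup_boundaryFibre {L : Set M} (hL : CircleInvariant L) (β : RelH 2 L) :
    pushRel 2 fibreToBlowup (mapsTo_fibreToBlowup L)
      (pushRel 2 (boundaryFibre M) (mapsTo_boundaryFibre hL) β) = 0 := by
  have h1 : discToBlowup (ofCircle 1) ∈ blowupCirc := mapsTo_discToBlowup one_mem_circ
  have h2 : Set.MapsTo (ContinuousMap.const M (discToBlowup (ofCircle 1))) L blowupCirc := fun _ _ => h1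
  exact (pushRel_comp 2 _ _ _ _ β).trans (pushRel_const 1 _ h2 h1 β)

instance : ContinuousSMul ℂˣ Unit := ⟨continuous_of_const fun _ _ => rfl⟩

/-- The projection forgets `M`, so the computation can be made with `M` a point: there
`pushRel_retractDisc` applies with a constant disc, and the cap class projects to `[ℙ¹]`. -/
lemma pushRel_fibreToBlowup_retractDisc {L : Set M} {x₀ : M} (h₀ : x₀ ∈ L) (c : ℂˣ) :
    pushRel 2 fibreToBlowup (mapsTo_fibreToBlowup L)
        (pushRel 2 (retractDisc x₀ c) (mapsTo_retractDisc h₀ c) discClass) =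
      toRel 2 blowupCirc (pushH 2 sphereToBlowup sphereClass) +
        pushRel 2 discToBlowup mapsTo_discToBlowup discClass := by
  let U : Set Unit := Set.univ
  have hU : CircleInvariant U := fun _ _ _ => trivial
  have hα : BoundsInverseOrbit () (ContinuousMap.const Disc ()) := fun _ => rfl
  have hg : Set.MapsTo ((ContinuousMap.const Disc ()).prodMk (ContinuousMap.id Disc)) circ (U ×ˢ circ) :=
    fun z hz => ⟨trivial, hz⟩
  have h := congrArg (pushRel 2 fibreToBlowup (mapsTo_fibreToBlowup U))
    (pushRel_retractDisc hU (Set.mem_univ ()) c hα hg)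
  rw [glue, map_add, toRel_natural, pushRel_comp, pushH_comp, pushRel_comp, pushRel_comp] at h
  have h1 : pushH 2 ((fibreToBlowup (M := Unit)).comp bundlePart) (capClass hα 1) =
      pushH 2 sphereToBlowup sphereClass := by
    have e1 : (fibreToBlowup (M := Unit)).comp bundlePart = sphereToBlowup.comp (bundleProj Unit) :=
      ContinuousMap.ext fun e => by
        obtain ⟨p, rfl⟩ := Quotient.exists_rep e
        rfl
    have e2 : pushH 2 (bundleProj Unit) (capClass hα 1) = sphereClass := by
      rw [sphereClass_eq]
      refine (pushH_sphereDiff _ _ _ _).trans (sphereDiff_congr (ContinuousMap.ext fun z => ?_)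
        (ContinuousMap.ext fun z => rfl) _)
      exact (collapse_eq z).symm
    rw [e1, ← pushH_comp, e2]
  rw [h1] at h
  exact (pushRel_comp 2 _ _ _ _ discClass).trans h

/-! ### The kernel of the projection to the base -/

lemma centralToBundle_boundaryFibre : (centralToBundle M).comp (boundaryFibre M) = bundleFibre M := rfl

lemma fibreBdry_zero_eq {L : Set M} (hL : CircleInvariant L) (e : fibreBdry L 0) :
    e.1 = discPart ((bdryProjZero hL e : M), fibreToDisc 0 e.1) := by
  obtain ⟨e, x, hx, z, h⟩ := e
  have h1 := bdryProjZero_of_eq hL (e := ⟨e, x, hx, z, h⟩) h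
  have h2 : fibreToDisc 0 e = z.1 := by
    change (toBlowup e.1).1.1 = z.1
    rw [h]
    rfl
  refine Subtype.ext ?_
  change e.1 = _
  rw [h1, h2, ← bdryPoint_circUnit_smul, smul_inv_smul]
  exact h

/-- Boundary points lie in the part `M × 𝔻`, which projects to the fibre of `E` over `[1 : 0]`
whatever `z` is. -/
lemma centralToBundle_incl {L : Set M} (hL : CircleInvariant L) :
    (centralToBundle M).comp (incl (fibreBdry L 0)) = (bundleFibre M).comp ((incl L).comp (bdryProjZero hL)) :=
  ContinuousMap.ext fun e => congrArg (centralToBundle M) (fibreBdry_zero_eq hL e)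

/-- The projection of `L̂_0` to `L` recovers `∂β`, so a class in the kernel lifts to `m` in `H₂(M)`.
In `𝓔_0` the image of `m` comes from `L̂_0`, so in `E` it is the fibre image of a class from `L`.
Injectivity of `H₂(M) → H₂(E)` shows that `m` comes from `L`. -/
theorem boundaryFibre_injective [SimplyConnectedSpace M] {L : Set M} (hL : CircleInvariant L) :
    Function.Injective (pushRel 2 (boundaryFibre M) (mapsTo_boundaryFibre hL)) := by
  rw [injective_iff_map_eq_zero]
  intro β hβ
  have h1 : bdry 1 L β = 0 := by rw [← bdryCentral_boundaryFibre hL, hβ, map_zero]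
  obtain ⟨m, rfl⟩ := (exact_bdry 1 L β).mp h1
  rw [toRel_natural, exact_toRel] at hβ
  obtain ⟨l, hl⟩ := hβ
  have h2 := congrArg (pushH 2 (centralToBundle M)) hl
  rw [pushH_comp, pushH_comp, centralToBundle_boundaryFibre, centralToBundle_incl hL, ← pushH_comp,
    ← pushH_comp] at h2
  exact (exact_toRel 2 L m).mpr ⟨_, bundleFibre_injective h2⟩

lemma centralToBundle_injective : Function.Injective (pushH 2 (centralToBundle M)) := fun a b h => by
  have h1 := congrArg (pushH 2 bundlePart) h
  rwa [pushH_comp, pushH_comp, pushH_id_of_homotopic 2 bundlePart_centralToBundle,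
    pushH_id_of_homotopic 2 bundlePart_centralToBundle] at h1

/-- The boundary of a class which vanishes over the base comes from `L`. -/
lemma bdry_eq_of_pushRel_fibreToBlowup_eq_zero {L : Set M} (hconn : IsPathConnected L) (hL : CircleInvariant L)
    (a : RelH 2 (fibreBdry L 0)) (ha : pushRel 2 fibreToBlowup (mapsTo_fibreToBlowup L) a = 0) :
    bdry 1 _ a = pushH 1 (restr (boundaryFibre M) (mapsTo_boundaryFibre hL)) (bdryCentral hL a) := by
  have := isPathConnected_iff_pathConnectedSpace.mp hconn
  have := isPathConnected_iff_pathConnectedSpace.mp isPathConnected_circ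
  let θ : C(L × circ, fibreBdry L 0) :=
    ⟨fun p => ⟨discPart (p.1.1, p.2.1), mapsTo_discPart hL ⟨p.1.2, p.2.2⟩⟩, by fun_prop⟩
  let κ : C(fibreBdry L 0, circ) := restr (fibreToDisc 0) (mapsTo_fibreToDisc L 0)
  let θ' : C(fibreBdry L 0, L × circ) := (bdryProjZero hL).prodMk κ
  have hθ : θ.comp θ' = ContinuousMap.id _ := ContinuousMap.ext fun e => Subtype.ext (fibreBdry_zero_eq hL e).symm
  let ν : C(blowupCirc, circ) := ⟨fun b => ⟨b.1.1.1.1, b.2⟩, by fun_prop⟩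
  -- Under `L̂_0 ≅ L × S¹` the circle component of the boundary is read off in the base, where the
  -- class vanishes; Künneth in degree one leaves the `L`-component.
  have hκ : pushH 1 κ (bdry 1 _ a) = 0 := by
    have h1 := congrArg (bdry 1 _) ha
    rw [bdry_natural, map_zero] at h1
    have h2 := congrArg (pushH 1 ν) h1
    rw [pushH_comp, map_zero] at h2
    exact h2
  obtain ⟨x₀, h₀⟩ := hconn.nonempty
  have h3 := singH_one_prod (⟨x₀, h₀⟩ : L) (⟨_, one_mem_circ⟩ : circ) (pushH 1 θ' (bdry 1 _ a))
  rw [pushH_comp 1 ContinuousMap.snd] at h3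
  have h4 : (ContinuousMap.snd : C(L × circ, circ)).comp θ' = κ := rfl
  rw [h4, hκ, map_zero, add_zero, pushH_comp 1 ContinuousMap.fst] at h3
  have h5 := congrArg (pushH 1 θ) h3
  rw [pushH_comp, hθ, pushH_id, pushH_comp] at h5
  refine h5.trans ?_
  rw [bdryCentral, LinearMap.comp_apply]
  rfl

/-- The projection of `ℙ¹ ∪ 𝔻` to `ℙ¹`. -/
def blowupToSphere : C(BlowupZero, P1) := ⟨fun b => b.1.1.2.2, by fun_prop⟩

/-- For `t = 0` and `z ≠ 0` the equation `z β = t α` gives `β = 0`. -/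
lemma blowupToSphere_circ (b : blowupCirc) : blowupToSphere b.1 = infPt := by
  obtain ⟨⟨⟨⟨z, t, l⟩, hv⟩, ht⟩, hz⟩ := b
  obtain ⟨v, hl, h⟩ := hv
  change t = 0 at ht
  change l = infPt
  change toP1 v = l at hl
  change (z : ℂ) * (v : ℂ × ℂ).2 = t * (v : ℂ × ℂ).1 at h
  have hz0 : (z : ℂ) ≠ 0 := circ_ne_zero ⟨z, hz⟩
  rw [ht, zero_mul] at h
  have h2 : (v : ℂ × ℂ).2 = 0 := (mul_eq_zero.mp h).resolve_left hz0
  have h1 : (v : ℂ × ℂ).1 ≠ 0 := fun h1 => v.2 (Prod.ext h1 h2)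
  rw [← hl]
  refine Quotient.sound ⟨Units.mk0 _ h1, Subtype.ext (Prod.ext (mul_one _) ?_)⟩
  exact (mul_zero _).trans h2.symm

/-- The boundary of `a` comes from `H₁(L)` and bounds in `M` because `H₁(M) = 0`; subtracting such a
`β` leaves an absolute class `e`. In the base `e` comes from the boundary circle, which the
projection to `ℙ¹` sends to a point, so `e` dies in `ℙ¹`. Hence `e` comes from a fibre, and adding
its class corrects `β`. -/
theorem exists_boundaryFibre_of_base_eq_zero [SimplyConnectedSpace M] {L : Set M} (hconn : IsPathConnected L)
    (hL : CircleInvariant L) (a : RelH 2 (fibreBdry L 0))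
    (ha : pushRel 2 fibreToBlowup (mapsTo_fibreToBlowup L) a = 0) :
    ∃ β, pushRel 2 (boundaryFibre M) (mapsTo_boundaryFibre hL) β = a := by
  obtain ⟨β, hβ⟩ := (exact_incl 1 L (bdryCentral hL a)).mp (singH_one_eq_zero_of_simplyConnected _)
  have h1 : bdry 1 _ (a - pushRel 2 (boundaryFibre M) (mapsTo_boundaryFibre hL) β) = 0 := by
    rw [map_sub, bdry_natural, hβ, bdry_eq_of_pushRel_fibreToBlowup_eq_zero hconn hL a ha, sub_self]
  obtain ⟨e, he⟩ := (exact_bdry 1 _ _).mp h1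
  have h2 := congrArg (pushRel 2 fibreToBlowup (mapsTo_fibreToBlowup L)) he
  rw [map_sub, ha, pushRel_fibreToBlowup_boundaryFibre hL, sub_self, toRel_natural, exact_toRel] at h2
  obtain ⟨l, hl⟩ := h2
  have h3 : pushH 2 (bundleProj M) (pushH 2 (centralToBundle M) e) = 0 := by
    have e1 : (bundleProj M).comp (centralToBundle M) = blowupToSphere.comp fibreToBlowup :=
      ContinuousMap.ext fun e => by
        obtain ⟨e, he⟩ := e
        obtain ⟨p, rfl⟩ := Quotient.exists_rep e
        rfl
    have e2 : blowupToSphere.comp (incl blowupCirc) = ContinuousMap.const _ infPt :=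
      ContinuousMap.ext blowupToSphere_circ
    rw [pushH_comp, e1, ← pushH_comp, ← hl, pushH_comp, e2]
    exact pushH_const 1 _ _
  obtain ⟨m, hm⟩ := exists_bundleFibre_of_bundleProj_eq_zero _ h3
  rw [← centralToBundle_boundaryFibre, ← pushH_comp] at hm
  have h4 := centralToBundle_injective hm
  refine ⟨β + toRel 2 L m, ?_⟩
  rw [map_add, toRel_natural, h4]
  change _ + toRel (1 + 1) _ e = a
  rw [he, add_sub_cancel]

/-- The map is the injection of `H₂(M, L)` into `H₂(𝓔_0, L̂_0)`, translated by the retracted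
constant section. Its image is the coset of the kernel over the base, which is exactly the set of
section classes of `𝓔_0`. -/
theorem bijOn_retractionMap [SimplyConnectedSpace M] {L : Set M} (hconn : IsPathConnected L)
    (hL : CircleInvariant L) {t : ℂ} (ht : t ≠ 0) :
    Set.BijOn (retractionMap L t) (secClasses L t) (secClassesZero L) := by
  obtain ⟨x₀, h₀⟩ := hconn.nonempty
  refine ⟨fun a ha => ?_, fun a ha a' ha' h => ?_, fun a ha => ?_⟩
  · obtain ⟨β, rfl⟩ := (mem_secClasses_iff hconn h₀ ht a).mp ha
    change pushRel 2 fibreToBlowup (mapsTo_fibreToBlowup L) _ = _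
    rw [retractionMap_fibreOne_add_hatZero hL, map_add, pushRel_fibreToBlowup_boundaryFibre hL,
      pushRel_fibreToBlowup_retractDisc h₀, zero_add]
  · obtain ⟨β, rfl⟩ := (mem_secClasses_iff hconn h₀ ht a).mp ha
    obtain ⟨β', rfl⟩ := (mem_secClasses_iff hconn h₀ ht a').mp ha'
    rw [retractionMap_fibreOne_add_hatZero hL, retractionMap_fibreOne_add_hatZero hL, add_left_inj] at h
    rw [boundaryFibre_injective hL h]
  · have h1 : pushRel 2 fibreToBlowup (mapsTo_fibreToBlowup L) (a -
        pushRel 2 (retractDisc x₀ (Units.mk0 t ht)) (mapsTo_retractDisc h₀ _) discClass) = 0 := by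
      rw [map_sub, pushRel_fibreToBlowup_retractDisc h₀, sub_eq_zero]
      exact ha
    obtain ⟨β, hβ⟩ := exists_boundaryFibre_of_base_eq_zero hconn hL _ h1
    refine ⟨_, (mem_secClasses_iff hconn h₀ ht _).mpr ⟨β, rfl⟩, ?_⟩
    rw [retractionMap_fibreOne_add_hatZero hL, hβ, sub_add_cancel]

end

end

end Degeneration

/-! ### The main theorem -/

theorem mainTheorem8 {V : Type*} [NormedAddCommGroup V] [NormedSpace ℂ V] [FiniteDimensional ℂ V]
    {M : Type} [TopologicalSpace M] [ChartedSpace V M] [IsManifold 𝓘(ℂ, V) ω M]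
    [MulAction ℂˣ M] [ContinuousSMul ℂˣ M] [ContMDiffSMul 𝓘(ℂ, ℂ) 𝓘(ℂ, V) ω ℂˣ M]
    [SimplyConnectedSpace M]
    (L : Set M) (hconn : IsPathConnected L) (hL : Degeneration.CircleInvariant L)
    (t : ℂ) (ht : t ≠ 0) :
    -- the inclusion of the central fibre induces `H₂(𝓔_0, L̂_0) ≅ H₂(𝓔, 𝓛)`
    Function.Bijective (Degeneration.pushRel 2 (Degeneration.fibreIncl 0)
      (Degeneration.mapsTo_fibreIncl L 0)) ∧
    -- the section class `β̂` of `β ∈ H₂(M, L)` is well defined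
    (∀ β : Degeneration.RelH 2 L, ∃! b, Degeneration.IsHat L β b) ∧
    -- the retraction map `r : H₂(𝓔_t, L̂_t) → H₂(𝓔, 𝓛) ≅ H₂(𝓔_0, L̂_0)`
    ∃ r : Degeneration.RelH 2 (Degeneration.fibreBdry L t) →ₗ[ℤ]
        Degeneration.RelH 2 (Degeneration.fibreBdry L 0),
      (∀ a, Degeneration.pushRel 2 (Degeneration.fibreIncl 0)
          (Degeneration.mapsTo_fibreIncl L 0) (r a) =
        Degeneration.pushRel 2 (Degeneration.fibreIncl t) (Degeneration.mapsTo_fibreIncl L t) a) ∧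
      -- it is an isomorphism between section classes
      Set.BijOn r (Degeneration.secClasses L t) (Degeneration.secClassesZero L) ∧
      -- `r(β̂) = σ(u) - û + β̂` for every disc `u` contracting an `S¹`-orbit in `L`
      (∀ (u : C(Degeneration.Disc, M)) (hu : Degeneration.IsOrbitDisc L u)
        (β : Degeneration.RelH 2 L) (b b'),
        Degeneration.IsHat L β b →
        Degeneration.IsHat L (β - Degeneration.orbitDiscClass hL hu) b' →
        r (Degeneration.generalClass L t ht b) =
          Degeneration.glue hL
            (Degeneration.pushH 2 (Degeneration.sectionOf hu) Degeneration.sphereClass) b') ∧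
      -- `r(β̂) = σ₀ + α̂₀ + β̂` for the maximal section class `σ₀` and the maximal disc class `α₀`
      (∀ (p : M) (hp : p ∈ Degeneration.maximalLocus V M) (γ : C(unitInterval, M))
        (h0 : γ 0 ∈ Degeneration.maximalLocus V M) (h1 : γ 1 ∈ L),
        JoinedIn (Degeneration.maximalLocus V M) p (γ 0) →
        ∀ (β : Degeneration.RelH 2 L) (b b'),
        Degeneration.IsHat L β b →
        Degeneration.IsHat L (Degeneration.pathDiscClass hL γ h0.1 h1 + β) b' →
        r (Degeneration.generalClass L t ht b) =
          Degeneration.glue hL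
            (Degeneration.pushH 2 (Degeneration.fixedSection hp.1) Degeneration.sphereClass) b') ∧
      -- on boundaries it is the subtraction of the class `λ` of an `S¹`-orbit, with `λ = [∂u]`
      (∀ (x : L), ∀ a ∈ Degeneration.secClasses L t,
        Degeneration.bdryCentral hL (r a) =
          Degeneration.bdryGeneral L t a - Degeneration.orbitClass hL x) ∧
      (∀ (u : C(Degeneration.Disc, M)) (hu : Degeneration.IsOrbitDisc L u),
        Degeneration.bdry 1 L (Degeneration.orbitDiscClass hL hu) =
          Degeneration.orbitClass hL ⟨u (Degeneration.ofCircle 1), hu.1⟩) := by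
  open Degeneration in
  refine ⟨fibreIncl_zero_bijective L, fun β => ?_, retractionMap L t, fun a => pushRel_fibreIncl_retraction L
    (pushRel 2 (fibreIncl t) (mapsTo_fibreIncl L t) a), bijOn_retractionMap hconn hL ht, ?_, ?_,
    fun x a ha => bdryCentral_retractionMap hconn hL x ht a ha, fun u hu => bdry_orbitDiscClass hL hu⟩
  · obtain ⟨x₀, h₀⟩ := hconn.nonempty
    exact ⟨_, (isHat_iff hconn h₀ β _).mpr rfl, fun b hb => (isHat_iff hconn h₀ β b).mp hb⟩
  · intro u hu β b b' hb hb'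
    -- The bounding disc is `u` composed with conjugation; its class is `-[u]`, so `[α] + β = β -
    -- [u]`.
    have hα := boundsInverseOrbit_conjDisc hu
    have hm : Set.MapsTo (u.comp conjDisc) circ L := (hu.mapsTo hL).comp mapsTo_conjDisc
    rw [← capClass_conjDisc hu]
    refine retractionMap_generalClass hconn hL hu.1 ht hα hm hb ?_
    rw [orbitDiscClass_conj hL hu, neg_add_eq_sub]
    exact hb'
  · intro p hp γ h0 h1 hj β b b' hb hb'
    -- The path from `p` to `γ 0` inside the maximal locus consists of fixed points, along which the
    -- section class is constant.
    rw [← capClass_pathDisc γ hp.1 h0.1 (hj.mono fun x hx => hx.1)]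
    exact retractionMap_generalClass hconn hL h1 ht (boundsInverseOrbit_pathDisc γ h0.1)
      (mapsTo_pathDisc hL γ h0.1 h1) hb hb'
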